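/- **Setting.** Fix a labelling $\ell$ of transitions by activities or by the silent symbol $\tau$. A Petri net $N=(P,T,F)$ has finite disjoint sets $P$ of places and $T$ of transitions and arcs $F\subseteq(P\times T)\cup(T\times P)$; ${}^\bullet x$ and $x^\bullet$ are the pre- and post-set of a node $x$. It is a *WF-net* if exactly one place $N_{source}$ has empty pre-set, exactly one place $N_{sink}$ has empty post-set, and every node lies on a path from $N_{source}$ to $N_{sink}$. It is *safe* if no marking reachable from $[N_{source}]$ puts two tokens on a place, and *sound* if every transition is enabled in some marking reachable from $[N_{source}]$, $[N_{sink}]$ is reachable from every marking reachable from $[N_{source}]$, and $[N_{sink}]$ is the only such marking with a token in $N_{sink}$. $\mathcal L(N)$ is the set of label sequences, with $\tau$ deleted, of firing sequences from $[N_{source}]$ to $[N_{sink}]$. **POWL 2.0 models.** Every transition $t$ is a model, with language $\{\langle\ell(t)\rangle\}$, or $\{\langle\rangle\}$ if $\ell(t)=\tau$. If $n\ge 2$ and $\varphi_1,\dots,\varphi_n$ are models, so are $\prec(\varphi_1,\dots,\varphi_n)$ for a strict partial order $\prec$ on $\{1,\dots,n\}$, whose language consists of all interleavings of words $\sigma_i\in\mathcal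 L(\varphi_i)$ in which all of $\sigma_i$ precedes all of $\sigma_j$ whenever $i\prec j$, and $\gamma(\varphi_1,\dots,\varphi_n)$ for a choice graph $\gamma$, i.e. a directed graph on $\{1,\dots,n\}\cup\{\triangleright,\square\}$ in which $\triangleright$ is the only node without incoming edges, $\square$ the only node without outgoing edges, and every node lies on a path from $\triangleright$ to $\square$; its language is the union of $\mathcal L(\varphi_{i_1})\cdots\mathcal L(\varphi_{i_k})$ over all paths $\triangleright,i_1,\dots,i_k,\square$. **Interfaces.** For $S\subseteq T$, $\mathrm{Pre}(S)$ is the set of places $p$ with $p^\bullet\cap S\ne\emptyset$ and ($p=N_{source}$ or ${}^\bullet p\not\subseteq S$); $\mathrm{Post}(S)$ is the set of places $p$ with ${}^\bullet p\cap S\neq\emptyset$ and ($p=N_{sink}$ or $p^\bullet\not\subseteq S$). A partition $G$ of $T$ is *conflict-hiding* if each place lies in $\mathrm{Pre}(S)$ for at most one $S\in G$ and in $\mathrm{Post}(S)$ for at most one $S\in G$, and for every $S\in G$ any two places of $\mathrm{Pre}(S)$, and any two of $\mathrm{Post}(S)$, have the same pre-transitions in $S$ and the same post-transitions in $S$. It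 is *concurrency-hiding* if $|\mathrm{Pre}(S)|=|\mathrm{Post}(S)|=1$ for all $S\in G$. **Projections.** *Normalizing* a net with respect to places $p_s,p_e$ adds a fresh start place joined to $p_s$ by a fresh silent transition if ${}^\bullet p_s\neq\emptyset$, and a fresh end place reached from $p_e$ by a fresh silent transition if $p_e^\bullet\ne\emptyset$. The *partial order projection* of $N$ on $S$ keeps the transitions $S$ and the places adjacent to $S$, replaces all places of $\mathrm{Pre}(S)$ by one fresh place $p_s$ and all places of $\mathrm{Post}(S)$ by one fresh place $p_e$, with all arcs between these places and $S$ redirected accordingly, and normalizes. The *choice graph projection* keeps $S$, the places adjacent to $S$ and the arcs between them, and normalizes with respect to the unique $p_s\in\mathrm{Pre}(S)$ and $p_e\in\mathrm{Post}(S)$. **Partitioning procedures.** Both start with the partition of $T$ into singletons and successively, for each *group* below that has more than one element, merge all parts that meet it; first the split groups are treated, then the join groups. Let $t\leadsto t'$ mean that there is a (possibly trivial) path from $t$ to $t'$. - Procedure A. For each place $p$ with $|p^\bullet|>1$: all $t$ such that $t_1\leadsto t$ and $t_2\not\leadsto t$ for some $t_1,t_2\in p^\bullet$. For each place $p$ with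 $|{}^\bullet p|>1$: all $t$ such that $t\leadsto t_1$ and $t\not\leadsto t_2$ for some $t_1,t_2\in{}^\bullet p$. - Procedure B. For each transition $u$ with $|u^\bullet|>1$: $u$ and all $t$ that are reachable by a path avoiding $u$ from some, but not all, places of $u^\bullet$. For each transition $u$ with $|{}^\bullet u|>1$: $u$ and all $t$ from which some, but not all, places of ${}^\bullet u$ are reachable by a path avoiding $u$. **Algorithm ConvertNetToPOWL($N$).** 1. If $T=\{t\}$, $|P|=2$ and $F=\{(N_{source},t),(t,N_{sink})\}$, return $t$. 2. Otherwise let $G=\{T_1,\dots,T_n\}$ be the result of Procedure A. If $n>1$, $G$ is conflict-hiding and no partial order projection of $N$ on a part is isomorphic to $N$ as a labelled net, convert the partial order projections of $N$ on $T_1,\dots,T_n$ recursively into $\varphi_1,\dots,\varphi_n$ and return $\prec(\varphi_1,\dots,\varphi_n)$, where $\prec$ is the transitive closure of the relation $\mathrm{Post}(T_i)\cap\mathrm{Pre}(T_j)\ne\emptyset$ between $i$ and $j$. 3. Otherwise let $G=\{T_1,\dots,T_n\}$ be the result of Procedure B. If $n>1$, $G$ is concurrency-hiding and no choice graph projection of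 $N$ on a part is isomorphic to $N$, convert the choice graph projections recursively into $\varphi_1,\dots,\varphi_n$ and return $\gamma(\varphi_1,\dots,\varphi_n)$, where $\gamma$ has the edges $(i,j)$ with $\mathrm{Post}(T_i)\cap\mathrm{Pre}(T_j)\neq\emptyset$, $(\triangleright,i)$ with $N_{source}\in\mathrm{Pre}(T_i)$, and $(i,\square)$ with $N_{sink}\in\mathrm{Post}(T_i)$. 4. Otherwise invoke the fall-through. **Theorem (Correctness).** Let $N$ be a safe and sound WF-net. If ConvertNetToPOWL, applied to $N$, terminates with output $\varphi$ without invoking the fall-through at any level of recursion, then $\varphi$ is a POWL 2.0 model and $\mathcal L(N)=\mathcal L(\varphi)$. -/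

import Mathlib

namespace POWL

/-! ## Petri nets

`Pl` is a universe of places, `Tr` the universe of transitions and `A` the set of activities.
The labelling function is `lab : Tr → Option A`, where `none` is the silent activity. -/

/-- A Petri net: finite sets `P` of places and `T` of transitions, and a flow relation, split into
its place-to-transition arcs `pt` and its transition-to-place arcs `tp`. -/
structure PetriNet (Pl Tr : Type*) where
  P : Set Pl
  T : Set Tr
  pt : Pl → Tr → Prop
  tp : Tr → Pl → Prop
  finite_P : P.Finite
  finite_T : T.Finite
  pt_mem : ∀ p t, pt p t → p ∈ P ∧ t ∈ T
  tp_mem : ∀ t p, tp t p → t ∈ T ∧ p ∈ P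

namespace PetriNet

variable {Pl Tr A : Type*}

/-- The flow relation on all nodes. -/
inductive Flow (N : PetriNet Pl Tr) : Pl ⊕ Tr → Pl ⊕ Tr → Prop
  | pt (p : Pl) (t : Tr) (h : N.pt p t) : Flow N (Sum.inl p) (Sum.inr t)
  | tp (t : Tr) (p : Pl) (h : N.tp t p) : Flow N (Sum.inr t) (Sum.inl p)

/-- Transition reachability: there is a (possibly trivial) path from `t` to `t'`. -/
def Reaches (N : PetriNet Pl Tr) (t t' : Tr) : Prop :=
  Relation.ReflTransGen N.Flow (Sum.inr t) (Sum.inr t')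

/-- Pre-set of a place. -/
def preP (N : PetriNet Pl Tr) (p : Pl) : Set Tr := {t | N.tp t p}

/-- Post-set of a place. -/
def postP (N : PetriNet Pl Tr) (p : Pl) : Set Tr := {t | N.pt p t}

/-- Pre-set of a transition. -/
def preT (N : PetriNet Pl Tr) (t : Tr) : Set Pl := {p | N.pt p t}

/-- Post-set of a transition. -/
def postT (N : PetriNet Pl Tr) (t : Tr) : Set Pl := {p | N.tp t p}

/-- `s` is the unique place with empty pre-set. -/
def IsSource (N : PetriNet Pl Tr) (s : Pl) : Prop := {p ∈ N.P | N.preP p = ∅} = {s}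

/-- `e` is the unique place with empty post-set. -/
def IsSink (N : PetriNet Pl Tr) (e : Pl) : Prop := {p ∈ N.P | N.postP p = ∅} = {e}

/-- Places of `N` adjacent to some transition in `S`. -/
def projP (N : PetriNet Pl Tr) (S : Set Tr) : Set Pl :=
  {p ∈ N.P | ((N.preP p ∪ N.postP p) ∩ S).Nonempty}

/-- Workflow nets. -/
def IsWFNet (N : PetriNet Pl Tr) : Prop :=
  ∃ s e, N.IsSource s ∧ N.IsSink e ∧
    (∀ p ∈ N.P, Relation.ReflTransGen N.Flow (Sum.inl s) (Sum.inl p) ∧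
      Relation.ReflTransGen N.Flow (Sum.inl p) (Sum.inl e)) ∧
    (∀ t ∈ N.T, Relation.ReflTransGen N.Flow (Sum.inl s) (Sum.inr t) ∧
      Relation.ReflTransGen N.Flow (Sum.inr t) (Sum.inl e))

/-- Isomorphism of labelled Petri nets. -/
def Iso (lab : Tr → Option A) (N₁ N₂ : PetriNet Pl Tr) : Prop :=
  ∃ (fP : N₁.P ≃ N₂.P) (fT : N₁.T ≃ N₂.T),
    (∀ (p : N₁.P) (t : N₁.T), N₁.pt p t ↔ N₂.pt (fP p) (fT t)) ∧
    (∀ (t : N₁.T) (p : N₁.P), N₁.tp t p ↔ N₂.tp (fT t) (fP p)) ∧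
    (∀ t : N₁.T, lab t = lab (fT t))

/-! ### Behaviour -/

/-- A marking assigns to each place its number of tokens. -/
abbrev Marking (Pl : Type*) := Pl → ℕ

open Classical in
/-- The marking with a single token, in `p`. -/
noncomputable def single (p : Pl) : Marking Pl := fun q => if q = p then 1 else 0

/-- The transition `t` is enabled in `M`. -/
def Enabled (N : PetriNet Pl Tr) (M : Marking Pl) (t : Tr) : Prop :=
  t ∈ N.T ∧ ∀ p, N.pt p t → 1 ≤ M p

open Classical in
/-- Firing the enabled transition `t` in `M` yields `M'`. -/
def Fires (N : PetriNet Pl Tr) (M : Marking Pl) (t : Tr) (M' : Marking Pl) : Prop :=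
  N.Enabled M t ∧
    ∀ p, M' p + (if N.pt p t then 1 else 0) = M p + (if N.tp t p then 1 else 0)

/-- `N.Run M σ M'`: the sequence `σ` of transitions can be fired from `M` and leads to `M'`. -/
inductive Run (N : PetriNet Pl Tr) : Marking Pl → List Tr → Marking Pl → Prop
  | nil (M : Marking Pl) : Run N M [] M
  | cons {M M' M'' : Marking Pl} {t : Tr} {σ : List Tr}
      (h : N.Fires M t M') (hr : Run N M' σ M'') : Run N M (t :: σ) M''

/-- `M'` is reachable from `M`. -/
def Reachable (N : PetriNet Pl Tr) (M M' : Marking Pl) : Prop := ∃ σ, N.Run M σ M'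

/-- Safeness of a net that starts with one token in its source. -/
def IsSafe (N : PetriNet Pl Tr) : Prop :=
  ∀ s, N.IsSource s → ∀ M, N.Reachable (single s) M → ∀ p, M p ≤ 1

/-- Soundness (to be used for workflow nets, where source and sink exist). -/
def IsSound (N : PetriNet Pl Tr) : Prop :=
  ∀ s e, N.IsSource s → N.IsSink e →
    (∀ t ∈ N.T, ∃ M, N.Reachable (single s) M ∧ N.Enabled M t) ∧
    (∀ M, N.Reachable (single s) M → N.Reachable M (single e)) ∧
    (∀ M, N.Reachable (single s) M → 1 ≤ M e → M = single e)

/-- The language of a net: the sequences of visible labels of the firing sequences that lead from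
one token in the source to one token in the sink. -/
def lang (lab : Tr → Option A) (N : PetriNet Pl Tr) : Language A :=
  {w | ∃ s e σ, N.IsSource s ∧ N.IsSink e ∧ N.Run (single s) σ (single e) ∧
    w = σ.filterMap lab}

/-! ### Partitions of the transitions -/

/-- Entry points of a set of transitions. -/
def Pre (N : PetriNet Pl Tr) (S : Set Tr) : Set Pl :=
  {p ∈ N.P | (S ∩ N.postP p).Nonempty ∧ (N.IsSource p ∨ ((N.T \ S) ∩ N.preP p).Nonempty)}

/-- Exit points of a set of transitions. -/
def Post (N : PetriNet Pl Tr) (S : Set Tr) : Set Pl :=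
  {p ∈ N.P | (S ∩ N.preP p).Nonempty ∧ (N.IsSink p ∨ ((N.T \ S) ∩ N.postP p).Nonempty)}

/-- Equivalence of two places with respect to a set of transitions. -/
def PlaceEquiv (N : PetriNet Pl Tr) (S : Set Tr) (p p' : Pl) : Prop :=
  N.preP p ∩ S = N.preP p' ∩ S ∧ N.postP p ∩ S = N.postP p' ∩ S

/-- `G` is a partition of the set of transitions into non-empty, pairwise disjoint parts. -/
def IsPartition (N : PetriNet Pl Tr) (G : Set (Set Tr)) : Prop :=
  ⋃₀ G = N.T ∧ ∅ ∉ G ∧ G.PairwiseDisjoint id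

/-- Conflict-hiding partitions. -/
structure IsConflictHiding (N : PetriNet Pl Tr) (G : Set (Set Tr)) : Prop where
  partition : N.IsPartition G
  no_xor_split : ∀ p ∈ N.P, {S ∈ G | p ∈ N.Pre S}.encard ≤ 1
  no_xor_join : ∀ p ∈ N.P, {S ∈ G | p ∈ N.Post S}.encard ≤ 1
  single_entry : ∀ S ∈ G, ∀ p ∈ N.Pre S, ∀ p' ∈ N.Pre S, N.PlaceEquiv S p p'
  single_exit : ∀ S ∈ G, ∀ p ∈ N.Post S, ∀ p' ∈ N.Post S, N.PlaceEquiv S p p'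

/-- Concurrency-hiding partitions. -/
structure IsConcurrencyHiding (N : PetriNet Pl Tr) (G : Set (Set Tr)) : Prop where
  partition : N.IsPartition G
  single_entry : ∀ S ∈ G, (N.Pre S).encard = 1
  single_exit : ∀ S ∈ G, (N.Post S).encard = 1

/-! ### The two partitioning procedures -/

/-- The list `l` enumerates the set `S`, in an arbitrary order and without repetition. -/
def Enumerates {α : Type*} (l : List α) (S : Set α) : Prop := l.Nodup ∧ ∀ x, x ∈ l ↔ x ∈ S

open Classical in
/-- Merge all parts of `G` that meet `group`, if `group` has more than one element. -/
noncomputable def mergeGroup (G : Set (Set Tr)) (group : Set Tr) : Set (Set Tr) :=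
  if 1 < group.encard then
    (G \ {S ∈ G | (S ∩ group).Nonempty}) ∪ {⋃₀ {S ∈ G | (S ∩ group).Nonempty}}
  else G

/-- The initial partition into singletons. -/
def singletons (N : PetriNet Pl Tr) : Set (Set Tr) := {S | ∃ t ∈ N.T, S = {t}}

/-- The transitions reachable from some, but not all, of the transitions in the post-set of `p`. -/
def xorSplitGroup (N : PetriNet Pl Tr) (p : Pl) : Set Tr :=
  {t ∈ N.T | ∃ t₁ ∈ N.postP p, ∃ t₂ ∈ N.postP p, N.Reaches t₁ t ∧ ¬ N.Reaches t₂ t}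

/-- The transitions from which some, but not all, of the transitions in the pre-set of `p` are
reachable. -/
def xorJoinGroup (N : PetriNet Pl Tr) (p : Pl) : Set Tr :=
  {t ∈ N.T | ∃ t₁ ∈ N.preP p, ∃ t₂ ∈ N.preP p, N.Reaches t t₁ ∧ ¬ N.Reaches t t₂}

/-- `G` is an output of the conflict-hiding partitioning procedure on `N`, the two loops over the
split and the join places being run in some order. -/
def PartitionPO (N : PetriNet Pl Tr) (G : Set (Set Tr)) : Prop :=
  ∃ splits joins : List Pl,
    Enumerates splits {p ∈ N.P | 1 < (N.postP p).encard} ∧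
    Enumerates joins {p ∈ N.P | 1 < (N.preP p).encard} ∧
    G = joins.foldl (fun G p => mergeGroup G (N.xorJoinGroup p))
      (splits.foldl (fun G p => mergeGroup G (N.xorSplitGroup p)) N.singletons)

/-- `N.FwdAvoid u p t`: there is a path from the place `p` to the transition `t` that does not
visit the transition `u`. -/
inductive FwdAvoid (N : PetriNet Pl Tr) (u : Tr) : Pl → Tr → Prop
  | one {p : Pl} {t : Tr} (h : N.pt p t) (ht : t ≠ u) : FwdAvoid N u p t
  | snoc {p q : Pl} {t t' : Tr} (h : FwdAvoid N u p t) (h₁ : N.tp t q) (h₂ : N.pt q t')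
      (ht : t' ≠ u) : FwdAvoid N u p t'

/-- `N.BwdAvoid u p t`: there is a path from the transition `t` to the place `p` that does not
visit the transition `u`. -/
inductive BwdAvoid (N : PetriNet Pl Tr) (u : Tr) : Pl → Tr → Prop
  | one {p : Pl} {t : Tr} (h : N.tp t p) (ht : t ≠ u) : BwdAvoid N u p t
  | cons {p q : Pl} {t t' : Tr} (h : BwdAvoid N u p t) (h₁ : N.pt q t) (h₂ : N.tp t' q)
      (ht : t' ≠ u) : BwdAvoid N u p t'

/-- The AND-split `u` together with the transitions reachable, avoiding `u`, from some but not all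
of its output places. -/
def andSplitGroup (N : PetriNet Pl Tr) (u : Tr) : Set Tr :=
  {u} ∪ {t ∈ N.T | ∃ p₁ ∈ N.postT u, ∃ p₂ ∈ N.postT u, N.FwdAvoid u p₁ t ∧ ¬ N.FwdAvoid u p₂ t}

/-- The AND-join `u` together with the transitions from which, avoiding `u`, some but not all of
its input places are reachable. -/
def andJoinGroup (N : PetriNet Pl Tr) (u : Tr) : Set Tr :=
  {u} ∪ {t ∈ N.T | ∃ p₁ ∈ N.preT u, ∃ p₂ ∈ N.preT u, N.BwdAvoid u p₁ t ∧ ¬ N.BwdAvoid u p₂ t}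

/-- `G` is an output of the concurrency-hiding partitioning procedure on `N`, the two loops over
the split and the join transitions being run in some order. -/
def PartitionCG (N : PetriNet Pl Tr) (G : Set (Set Tr)) : Prop :=
  ∃ splits joins : List Tr,
    Enumerates splits {t ∈ N.T | 1 < (N.postT t).encard} ∧
    Enumerates joins {t ∈ N.T | 1 < (N.preT t).encard} ∧
    G = joins.foldl (fun G t => mergeGroup G (N.andJoinGroup t))
      (splits.foldl (fun G t => mergeGroup G (N.andSplitGroup t)) N.singletons)

/-! ### Projections -/

/-- Add a place `p₀` and a transition `t₀` with the arcs `p₀ → t₀ → ps`. -/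
def addStart (N : PetriNet Pl Tr) (p₀ : Pl) (t₀ : Tr) (ps : Pl) (hps : ps ∈ N.P) :
    PetriNet Pl Tr where
  P := insert p₀ N.P
  T := insert t₀ N.T
  pt := fun p t => N.pt p t ∨ (p = p₀ ∧ t = t₀)
  tp := fun t p => N.tp t p ∨ (t = t₀ ∧ p = ps)
  finite_P := N.finite_P.insert p₀
  finite_T := N.finite_T.insert t₀
  pt_mem := by
    rintro p t (h | ⟨rfl, rfl⟩)
    · exact ⟨Or.inr (N.pt_mem p t h).1, Or.inr (N.pt_mem p t h).2⟩
    · exact ⟨Or.inl rfl, Or.inl rfl⟩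
  tp_mem := by
    rintro t p (h | ⟨rfl, rfl⟩)
    · exact ⟨Or.inr (N.tp_mem t p h).1, Or.inr (N.tp_mem t p h).2⟩
    · exact ⟨Or.inl rfl, Or.inr hps⟩

/-- Add a place `p₀` and a transition `t₀` with the arcs `pe → t₀ → p₀`. -/
def addEnd (N : PetriNet Pl Tr) (pe : Pl) (t₀ : Tr) (p₀ : Pl) (hpe : pe ∈ N.P) :
    PetriNet Pl Tr where
  P := insert p₀ N.P
  T := insert t₀ N.T
  pt := fun p t => N.pt p t ∨ (p = pe ∧ t = t₀)
  tp := fun t p => N.tp t p ∨ (t = t₀ ∧ p = p₀)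
  finite_P := N.finite_P.insert p₀
  finite_T := N.finite_T.insert t₀
  pt_mem := by
    rintro p t (h | ⟨rfl, rfl⟩)
    · exact ⟨Or.inr (N.pt_mem p t h).1, Or.inr (N.pt_mem p t h).2⟩
    · exact ⟨Or.inr hpe, Or.inl rfl⟩
  tp_mem := by
    rintro t p (h | ⟨rfl, rfl⟩)
    · exact ⟨Or.inr (N.tp_mem t p h).1, Or.inr (N.tp_mem t p h).2⟩
    · exact ⟨Or.inl rfl, Or.inl rfl⟩

/-- First half of normalization: if `ps` has incoming arcs, a fresh start place is connected to it
through a fresh silent transition; otherwise nothing changes. -/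
def NormalizeStart (lab : Tr → Option A) (N : PetriNet Pl Tr) (ps : Pl)
    (N' : PetriNet Pl Tr) : Prop :=
  (N.preP ps = ∅ ∧ N' = N) ∨
  (N.preP ps ≠ ∅ ∧ ∃ (p₀ : Pl) (t₀ : Tr) (hps : ps ∈ N.P),
    p₀ ∉ N.P ∧ t₀ ∉ N.T ∧ lab t₀ = none ∧ N' = N.addStart p₀ t₀ ps hps)

/-- Second half of normalization: if `pe` has outgoing arcs, it is connected to a fresh end place
through a fresh silent transition; otherwise nothing changes. -/
def NormalizeEnd (lab : Tr → Option A) (N : PetriNet Pl Tr) (pe : Pl)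
    (N' : PetriNet Pl Tr) : Prop :=
  (N.postP pe = ∅ ∧ N' = N) ∨
  (N.postP pe ≠ ∅ ∧ ∃ (p₀ : Pl) (t₀ : Tr) (hpe : pe ∈ N.P),
    p₀ ∉ N.P ∧ t₀ ∉ N.T ∧ lab t₀ = none ∧ N' = N.addEnd pe t₀ p₀ hpe)

/-- `N'` is a normalization of `N` with start `ps` and end `pe`. -/
def Normalize (lab : Tr → Option A) (N : PetriNet Pl Tr) (ps pe : Pl)
    (N' : PetriNet Pl Tr) : Prop :=
  ∃ N₁, NormalizeStart lab N ps N₁ ∧ NormalizeEnd lab N₁ pe N'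

/-- The partial order projection of `N` on the part `S ⊆ N.T`, before normalization. -/
def corePO (N : PetriNet Pl Tr) (S : Set Tr) (ps pe : Pl) : PetriNet Pl Tr where
  P := (N.projP S \ (N.Pre S ∪ N.Post S)) ∪ {ps, pe}
  T := N.T ∩ S
  pt := fun p t => t ∈ N.T ∩ S ∧
    ((p ∈ N.projP S \ (N.Pre S ∪ N.Post S) ∧ N.pt p t) ∨
      (p = ps ∧ ∃ q ∈ N.Pre S, N.pt q t) ∨ (p = pe ∧ ∃ q ∈ N.Post S, N.pt q t))
  tp := fun t p => t ∈ N.T ∩ S ∧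
    ((p ∈ N.projP S \ (N.Pre S ∪ N.Post S) ∧ N.tp t p) ∨
      (p = ps ∧ ∃ q ∈ N.Pre S, N.tp t q) ∨ (p = pe ∧ ∃ q ∈ N.Post S, N.tp t q))
  finite_P := (N.finite_P.subset (fun _ h => h.1.1)).union ((Set.finite_singleton pe).insert ps)
  finite_T := N.finite_T.subset Set.inter_subset_left
  pt_mem := by
    rintro p t ⟨ht, ⟨h, -⟩ | ⟨rfl, -⟩ | ⟨rfl, -⟩⟩
    · exact ⟨Or.inl h, ht⟩
    · exact ⟨Or.inr (Or.inl rfl), ht⟩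
    · exact ⟨Or.inr (Or.inr rfl), ht⟩
  tp_mem := by
    rintro t p ⟨ht, ⟨h, -⟩ | ⟨rfl, -⟩ | ⟨rfl, -⟩⟩
    · exact ⟨ht, Or.inl h⟩
    · exact ⟨ht, Or.inr (Or.inl rfl)⟩
    · exact ⟨ht, Or.inr (Or.inr rfl)⟩

/-- `N'` is the partial order projection of `N` on `S`, for some choice of the fresh places
`ps`, `pe` and of the nodes added by normalization. -/
def ProjPO (lab : Tr → Option A) (N : PetriNet Pl Tr) (S : Set Tr) (N' : PetriNet Pl Tr) : Prop :=
  ∃ ps pe, ps ∉ N.P ∧ pe ∉ N.P ∧ ps ≠ pe ∧ Normalize lab (N.corePO S ps pe) ps pe N'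

/-- The choice graph projection of `N` on the part `S ⊆ N.T`, before normalization. -/
def coreCG (N : PetriNet Pl Tr) (S : Set Tr) : PetriNet Pl Tr where
  P := N.projP S
  T := N.T ∩ S
  pt := fun p t => p ∈ N.projP S ∧ t ∈ N.T ∩ S ∧ N.pt p t
  tp := fun t p => p ∈ N.projP S ∧ t ∈ N.T ∩ S ∧ N.tp t p
  finite_P := N.finite_P.subset (fun _ h => h.1)
  finite_T := N.finite_T.subset Set.inter_subset_left
  pt_mem := fun _ _ h => ⟨h.1, h.2.1⟩
  tp_mem := fun _ _ h => ⟨h.2.1, h.1⟩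

/-- `N'` is the choice graph projection of `N` on `S`, for some choice of the nodes added by
normalization. -/
def ProjCG (lab : Tr → Option A) (N : PetriNet Pl Tr) (S : Set Tr) (N' : PetriNet Pl Tr) : Prop :=
  ∃ ps pe, N.Pre S = {ps} ∧ N.Post S = {pe} ∧ Normalize lab (N.coreCG S) ps pe N'

end PetriNet

/-! ## POWL 2.0 models -/

/-- The nodes of a choice graph over `{1, …, n}`: these elements and artificial start and end
nodes. -/
inductive CGNode (n : ℕ)
  | start : CGNode n
  | finish : CGNode n
  | node (i : Fin n) : CGNode n

/-- `E` is the edge relation of a choice graph over `{1, …, n}`. -/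
structure IsChoiceGraph {n : ℕ} (E : CGNode n → CGNode n → Prop) : Prop where
  unique_start : {x | ∀ y, ¬ E y x} = {CGNode.start}
  unique_finish : {x | ∀ y, ¬ E x y} = {CGNode.finish}
  connected : ∀ x, Relation.ReflTransGen E CGNode.start x ∧ Relation.ReflTransGen E x CGNode.finish

/-- The paths from start to end of a choice graph, without these two delimiters. -/
def cgPaths {n : ℕ} (E : CGNode n → CGNode n → Prop) : Set (List (Fin n)) :=
  {l | List.IsChain E (CGNode.start :: (l.map CGNode.node ++ [CGNode.finish]))}

/-- The order-preserving shuffle of the words `s 1, …, s n` with respect to `r`. -/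
def shuffle {A : Type*} {n : ℕ} (r : Fin n → Fin n → Prop) (s : Fin n → List A) : Set (List A) :=
  {w | ∃ f : (Σ j : Fin n, Fin (s j).length) ≃ Fin w.length,
    (∀ x : (Σ j : Fin n, Fin (s j).length), w.get (f x) = (s x.1).get x.2) ∧
    (∀ x y : (Σ j : Fin n, Fin (s j).length),
      (r x.1 y.1 ∨ (x.1 = y.1 ∧ (x.2 : ℕ) < (y.2 : ℕ))) → f x < f y)}

/-- Expressions built from transitions by means of binary relations `r` on `{1, …, n}` and edge
relations `E` on `{1, …, n}` with start and end nodes. -/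
inductive Term (Tr : Type*)
  | leaf (t : Tr) : Term Tr
  | order (n : ℕ) (r : Fin n → Fin n → Prop) (φ : Fin n → Term Tr) : Term Tr
  | choice (n : ℕ) (E : CGNode n → CGNode n → Prop) (φ : Fin n → Term Tr) : Term Tr

/-- The expression is a POWL 2.0 model: each inner node has at least two children and carries a
strict partial order or a choice graph. -/
def Term.IsModel {Tr : Type*} : Term Tr → Prop
  | .leaf _ => True
  | .order n r φ => 2 ≤ n ∧ (∀ i, ¬ r i i) ∧ (∀ i j k, r i j → r j k → r i k) ∧
      ∀ i, (φ i).IsModel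
  | .choice n E φ => 2 ≤ n ∧ IsChoiceGraph E ∧ ∀ i, (φ i).IsModel

/-- The language of a POWL 2.0 model. -/
def Term.lang {Tr A : Type*} (lab : Tr → Option A) : Term Tr → Language A
  | .leaf t => {(lab t).toList}
  | .order _ r φ => {w | ∃ s : Fin _ → List A, (∀ i, s i ∈ (φ i).lang lab) ∧ w ∈ shuffle r s}
  | .choice _ E φ => {w | ∃ l ∈ cgPaths E, w ∈ (l.map (fun i => (φ i).lang lab)).prod}

/-! ## The conversion algorithm -/

namespace PetriNet

variable {Pl Tr A : Type*}

/-- The net consists of the single transition `t` between its source and its sink. -/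
def IsBase (N : PetriNet Pl Tr) (t : Tr) : Prop :=
  N.T = {t} ∧ N.P.encard = 2 ∧ ∃ s e, N.IsSource s ∧ N.IsSink e ∧
    (∀ p u, N.pt p u ↔ p = s ∧ u = t) ∧ (∀ u p, N.tp u p ↔ u = t ∧ p = e)

/-- The partition `G` is accepted for a decomposition into a partial order: it has several parts,
is conflict-hiding, and no projection is isomorphic to the net itself. -/
def AcceptsPO (lab : Tr → Option A) (N : PetriNet Pl Tr) (G : Set (Set Tr)) : Prop :=
  1 < G.encard ∧ N.IsConflictHiding G ∧ ¬ ∃ S ∈ G, ∃ N', ProjPO lab N S N' ∧ Iso lab N' N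

/-- The partition `G` is accepted for a decomposition into a choice graph: it has several parts,
is concurrency-hiding, and no projection is isomorphic to the net itself. -/
def AcceptsCG (lab : Tr → Option A) (N : PetriNet Pl Tr) (G : Set (Set Tr)) : Prop :=
  1 < G.encard ∧ N.IsConcurrencyHiding G ∧ ¬ ∃ S ∈ G, ∃ N', ProjCG lab N S N' ∧ Iso lab N' N

/-- `parts` lists the elements of `G` as `T_1, …, T_n`, without repetition. -/
def Indexes {n : ℕ} (parts : Fin n → Set Tr) (G : Set (Set Tr)) : Prop :=
  Function.Injective parts ∧ Set.range parts = G

/-- The execution order of the parts. -/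
def execOrder (N : PetriNet Pl Tr) {n : ℕ} (parts : Fin n → Set Tr) (i j : Fin n) : Prop :=
  (N.Post (parts i) ∩ N.Pre (parts j)).Nonempty

/-- The edges of the execution flow of the parts. -/
inductive ExecFlow (N : PetriNet Pl Tr) {n : ℕ} (parts : Fin n → Set Tr) :
    CGNode n → CGNode n → Prop
  | inner (i j : Fin n) (h : (N.Post (parts i) ∩ N.Pre (parts j)).Nonempty) :
      ExecFlow N parts (.node i) (.node j)
  | enter (i : Fin n) (s : Pl) (hs : N.IsSource s) (h : s ∈ N.Pre (parts i)) :
      ExecFlow N parts .start (.node i)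
  | leave (i : Fin n) (e : Pl) (he : N.IsSink e) (h : e ∈ N.Post (parts i)) :
      ExecFlow N parts (.node i) .finish

/-- `Converts lab N φ`: some run of the conversion algorithm on `N` terminates with output `φ`
without invoking the fall-through at any level of recursion. Runs differ in the choice of fresh
nodes, in the numbering of the parts and in the order in which loops are traversed. Neither the
validity of the output nor any property of the nets in recursive calls is presupposed. -/
inductive Converts (lab : Tr → Option A) : PetriNet Pl Tr → Term Tr → Prop
  | base (N : PetriNet Pl Tr) (t : Tr) (h : N.IsBase t) : Converts lab N (.leaf t)
  | order (N : PetriNet Pl Tr) (G : Set (Set Tr)) (n : ℕ) (parts : Fin n → Set Tr)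
      (Ns : Fin n → PetriNet Pl Tr) (φ : Fin n → Term Tr)
      (not_base : ¬ ∃ t, N.IsBase t)
      (hG : N.PartitionPO G) (accepts : AcceptsPO lab N G)
      (hparts : Indexes parts G)
      (hproj : ∀ i, ProjPO lab N (parts i) (Ns i))
      (hrec : ∀ i, Converts lab (Ns i) (φ i)) :
      Converts lab N (.order n (Relation.TransGen (N.execOrder parts)) φ)
  | choice (N : PetriNet Pl Tr) (G₀ G : Set (Set Tr)) (n : ℕ) (parts : Fin n → Set Tr)
      (Ns : Fin n → PetriNet Pl Tr) (φ : Fin n → Term Tr)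
      (not_base : ¬ ∃ t, N.IsBase t)
      (hG₀ : N.PartitionPO G₀) (rejects : ¬ AcceptsPO lab N G₀)
      (hG : N.PartitionCG G) (accepts : AcceptsCG lab N G)
      (hparts : Indexes parts G)
      (hproj : ∀ i, ProjCG lab N (parts i) (Ns i))
      (hrec : ∀ i, Converts lab (Ns i) (φ i)) :
      Converts lab N (.choice n (N.ExecFlow parts) φ)

end PetriNet

end POWL

/-!
The conversion is correct because both kinds of accepted partitions cut a safe and sound net into
blocks that interact with the rest of the net like single transitions. This needs only soundness,
safeness and the conflict-hiding or concurrency-hiding conditions; how the partition was found is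
irrelevant. The induction on the run of the algorithm uses `IsWorkflow N s e`, the safeness and
soundness of `N` between two places `s` and `e`, which may have additional arcs. Normalization turns
such a system into a workflow net and preserves its language (`IsWorkflow.normalize`), so that it
remains to be shown that the projections before normalization are such systems, and how their
languages compose.

*Concurrency-hiding partitions.* Each part has one entry place and one exit place, and projections
are subnets. The crucial fact is `IsSingleEntryExit.eq_exit`: a part that is started with one token
and marks its exit place leaves no other token behind. Otherwise, the tokens left inside the part
could neither leave it nor vanish before the part is entered again, and entering it again would
double them. Hence exactly one part is running at any time (`IsSingleEntryExit.exists_running`),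
and a firing sequence from the source to the sink is a path of the choice graph together with
complete firing sequences of the projections on its nodes.

*Conflict-hiding partitions.* A place between two parts is an exit of one of them and an entry of
the other one, and all entry places of a part, as well as all its exit places, behave alike. So a
marking of the net is composed of markings of the projections (`Glue`): the tokens in a place
between two parts are those which the first part has delivered minus those which the second one has
consumed. Every firing sequence of the net projects to the parts
(`IsConflictHidingFamily.exists_projects`), and at the end of a complete firing sequence every part
has ended (`IsConflictHidingFamily.eq_single_exit_of_glue`), since otherwise its successors would
not have been able to deliver a token to the sink. A part starts only after its predecessors have
delivered their tokens, and by proper completion these predecessors have then ended; so all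
transitions of a part precede those of its successors in the execution order
(`IsConflictHidingFamily.notMem_of_transGen`). As every part contributes to a complete firing
sequence, the execution order is acyclic. Conversely, order-preserving shuffles of words of the
projections are realized letter by letter (`IsConflictHidingFamily.exists_run_of_shuffle`).
-/

namespace POWL
namespace PetriNet

variable {Pl Tr A : Type*}

/-! ### Firing sequences -/

theorem single_self (p : Pl) : single p p = 1 := by simp [single]

theorem single_of_ne {p q : Pl} (h : q ≠ p) : single p q = 0 := by simp [single, h]

theorem eq_of_one_le_single {p q : Pl} (h : 1 ≤ single p q) : q = p := by
  by_contra hne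
  rw [single_of_ne hne] at h
  omega

theorem eq_single_of {m : Marking Pl} {p : Pl} (h1 : m p = 1) (h0 : ∀ q, q ≠ p → m q = 0) :
    m = single p := by
  funext q
  by_cases h : q = p
  · subst h; rw [h1, single_self]
  · rw [h0 q h, single_of_ne h]

theorem single_add_sub {m : Marking Pl} {p : Pl} (h : 1 ≤ m p) : single p + (m - single p) = m := by
  funext q
  by_cases hq : q = p
  · subst hq; simp only [Pi.add_apply, Pi.sub_apply, single_self]; omega
  · simp only [Pi.add_apply, Pi.sub_apply, single_of_ne hq]; omega

theorem exists_one_le_of_ne_single {X : Marking Pl} {p : Pl} (h : single p + X ≠ single p) :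
    ∃ x, 1 ≤ X x := by
  by_contra hX
  push Not at hX
  exact h (funext fun x => by have := hX x; simp only [Pi.add_apply]; omega)

variable {N C : PetriNet Pl Tr}

/-- The effect of a transition on a place, by cases on the arcs between them. -/
theorem fires_iff {M M' : Marking Pl} {t : Tr} : N.Fires M t M' ↔ N.Enabled M t ∧
    ∀ p, (N.pt p t → N.tp t p → M' p = M p) ∧ (N.pt p t → ¬ N.tp t p → M' p + 1 = M p) ∧
      (¬ N.pt p t → N.tp t p → M' p = M p + 1) ∧ (¬ N.pt p t → ¬ N.tp t p → M' p = M p) := by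
  refine and_congr_right fun hen => forall_congr' fun p => ?_
  by_cases h1 : N.pt p t <;> by_cases h2 : N.tp t p <;> simp [h1, h2]

theorem Fires.add {M M' : Marking Pl} {t : Tr} (h : N.Fires M t M') (Z : Marking Pl) :
    N.Fires (M + Z) t (M' + Z) := by
  refine ⟨⟨h.1.1, fun p hp => ?_⟩, fun p => ?_⟩
  · have := h.1.2 p hp
    simp only [Pi.add_apply]; omega
  · have := h.2 p
    simp only [Pi.add_apply]; omega

open Classical in
theorem Enabled.exists_fires {M : Marking Pl} {t : Tr} (h : N.Enabled M t) :
    ∃ M', N.Fires M t M' := by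
  refine ⟨fun p => M p + (if N.tp t p then 1 else 0) - (if N.pt p t then 1 else 0), h, fun p => ?_⟩
  by_cases hp : N.pt p t
  · have := h.2 p hp
    simp only [hp, if_true]; omega
  · simp [hp]

theorem Fires.unique {M M' M'' : Marking Pl} {t : Tr} (h : N.Fires M t M') (h' : N.Fires M t M'') :
    M' = M'' := by
  funext p
  have h1 := h.2 p
  have h2 := h'.2 p
  omega

/-- If the summand `X` of a marking already enables `t`, then `t` acts on `X` alone. -/
theorem Fires.of_add {X Y M : Marking Pl} {t : Tr} (h : N.Fires (X + Y) t M)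
    (hX : N.Enabled X t) : ∃ X', N.Fires X t X' ∧ M = X' + Y := by
  obtain ⟨X', hX'⟩ := hX.exists_fires
  exact ⟨X', hX', h.unique (hX'.add Y)⟩

theorem Fires.one_le_of_tp {M M' : Marking Pl} {t : Tr} (h : N.Fires M t M') {p : Pl}
    (hp : N.tp t p) : 1 ≤ M' p := by
  have h2 := h.2 p
  by_cases h3 : N.pt p t
  · have := h.1.2 p h3
    simp only [hp, h3, if_true] at h2; omega
  · simp only [hp, h3, if_true, if_false] at h2; omega

/-- A token present after firing `t` was already there or has been produced by `t`. -/
theorem Fires.one_le_or_tp {M M' : Marking Pl} {t : Tr} (h : N.Fires M t M') {p : Pl}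
    (hp : 1 ≤ M' p) : 1 ≤ M p ∨ N.tp t p := by
  by_contra hc
  push Not at hc
  have h2 := h.2 p
  simp only [hc.2, if_false] at h2
  omega

theorem fires_congr {M M' : Marking Pl} {t : Tr} (hpt : ∀ p, N.pt p t ↔ C.pt p t)
    (htp : ∀ p, N.tp t p ↔ C.tp t p) (hT : t ∈ N.T ↔ t ∈ C.T) :
    N.Fires M t M' ↔ C.Fires M t M' := by
  simp only [fires_iff, Enabled, hpt, htp, hT]

theorem Run.add {M M' : Marking Pl} {σ : List Tr} (h : N.Run M σ M') (Z : Marking Pl) :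
    N.Run (M + Z) σ (M' + Z) := by
  induction h with
  | nil M => exact .nil _
  | cons h _ ih => exact .cons (h.add Z) ih

theorem Run.append {M M' M'' : Marking Pl} {σ τ : List Tr} (h : N.Run M σ M')
    (h' : N.Run M' τ M'') : N.Run M (σ ++ τ) M'' := by
  induction h with
  | nil M => exact h'
  | cons h _ ih => exact .cons h (ih h')

theorem Run.snoc {M M' M'' : Marking Pl} {σ : List Tr} {t : Tr} (h : N.Run M σ M')
    (h' : N.Fires M' t M'') : N.Run M (σ ++ [t]) M'' :=
  h.append (.cons h' (.nil _))

theorem Run.of_append {M M'' : Marking Pl} {σ τ : List Tr} (h : N.Run M (σ ++ τ) M'') :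
    ∃ M', N.Run M σ M' ∧ N.Run M' τ M'' := by
  induction σ generalizing M with
  | nil => exact ⟨M, .nil _, h⟩
  | cons t σ ih =>
    cases h with
    | cons h hr =>
      obtain ⟨M', h1, h2⟩ := ih hr
      exact ⟨M', .cons h h1, h2⟩

theorem Run.eq_of_nil {M M' : Marking Pl} (h : N.Run M [] M') : M = M' := by
  cases h; rfl

theorem Run.of_snoc {M M'' : Marking Pl} {σ : List Tr} {t : Tr} (h : N.Run M (σ ++ [t]) M'') :
    ∃ M', N.Run M σ M' ∧ N.Fires M' t M'' := by
  obtain ⟨M', h1, h2⟩ := h.of_append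
  cases h2 with
  | cons h hr => exact ⟨M', h1, hr.eq_of_nil ▸ h⟩

theorem Run.unique {M M' M'' : Marking Pl} {σ : List Tr} (h : N.Run M σ M')
    (h' : N.Run M σ M'') : M' = M'' := by
  induction h with
  | nil M => exact h'.eq_of_nil
  | cons h _ ih =>
    cases h' with
    | cons h2 hr2 =>
      obtain rfl := h.unique h2
      exact ih hr2

/-- Induction on a firing sequence that extends it at its end. -/
theorem Run.induction_snoc {M : Marking Pl} {motive : List Tr → Marking Pl → Prop}
    (nil : motive [] M)
    (snoc : ∀ σ t M' M'', N.Run M σ M' → motive σ M' → N.Fires M' t M'' → motive (σ ++ [t]) M'')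
    {σ : List Tr} {M' : Marking Pl} (h : N.Run M σ M') : motive σ M' := by
  induction σ using List.reverseRecOn generalizing M' with
  | nil => exact h.eq_of_nil ▸ nil
  | append_singleton σ t ih =>
    obtain ⟨M₁, h1, h2⟩ := h.of_snoc
    exact snoc σ t M₁ M' h1 (ih h1) h2

theorem Run.mem_T {M M' : Marking Pl} {σ : List Tr} (h : N.Run M σ M') : ∀ t ∈ σ, t ∈ N.T := by
  induction h with
  | nil => simp
  | cons h _ ih =>
    intro u hu
    rcases List.mem_cons.1 hu with rfl | hu
    · exact h.1.1
    · exact ih u hu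

theorem Run.reachable {M M' : Marking Pl} {σ : List Tr} (h : N.Run M σ M') : N.Reachable M M' :=
  ⟨σ, h⟩

theorem Reachable.refl (M : Marking Pl) : N.Reachable M M := ⟨[], .nil M⟩

theorem Reachable.trans {M M' M'' : Marking Pl} (h : N.Reachable M M') (h' : N.Reachable M' M'') :
    N.Reachable M M'' := by
  obtain ⟨σ, h⟩ := h
  obtain ⟨τ, h'⟩ := h'
  exact ⟨σ ++ τ, h.append h'⟩

theorem Reachable.fires {M M' M'' : Marking Pl} {t : Tr} (h : N.Reachable M M')
    (h' : N.Fires M' t M'') : N.Reachable M M'' :=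
  h.trans ⟨[t], .cons h' (.nil _)⟩

theorem Reachable.add {M M' : Marking Pl} (h : N.Reachable M M') (Z : Marking Pl) :
    N.Reachable (M + Z) (M' + Z) := by
  obtain ⟨σ, h⟩ := h
  exact ⟨σ, h.add Z⟩

theorem Reachable.eq_zero_of_notMem {M M' : Marking Pl} (h : N.Reachable M M') {p : Pl}
    (hp : p ∉ N.P) (hM : M p = 0) : M' p = 0 := by
  obtain ⟨σ, h⟩ := h
  induction h with
  | nil => exact hM
  | cons h _ ih =>
    apply ih
    by_contra h0
    rcases h.one_le_or_tp (Nat.one_le_iff_ne_zero.2 h0) with h1 | h1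
    · omega
    · exact hp (N.tp_mem _ p h1).2

/-- If a safe net reaches a marking that has its initial marking as a part, then there are no
further tokens: otherwise they could be doubled. -/
theorem eq_single_of_safe {s : Pl} (hsafe : ∀ M, N.Reachable (single s) M → ∀ p, M p ≤ 1)
    {M : Marking Pl} (hM : N.Reachable (single s) M) (hs : 1 ≤ M s) : M = single s := by
  obtain ⟨X, rfl⟩ : ∃ X, M = single s + X := ⟨_, (single_add_sub hs).symm⟩
  by_contra hne
  obtain ⟨x, hx⟩ := exists_one_le_of_ne_single hne
  have := hsafe _ (hM.trans (hM.add X)) x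
  simp only [Pi.add_apply] at this
  omega

/-! ### Workflow systems -/

/-- The net `N`, started with one token in `s` and expected to end with one token in `e`, is a
safe and sound workflow system. Unlike for workflow nets, `s` may have incoming and `e` outgoing
arcs, and `s = e` is possible: this is the situation of a projection before normalization. -/
structure IsWorkflow (N : PetriNet Pl Tr) (s e : Pl) : Prop where
  start_mem : s ∈ N.P
  end_mem : e ∈ N.P
  path_place : ∀ p ∈ N.P, Relation.ReflTransGen N.Flow (Sum.inl s) (Sum.inl p) ∧
      Relation.ReflTransGen N.Flow (Sum.inl p) (Sum.inl e)
  path_trans : ∀ t ∈ N.T, Relation.ReflTransGen N.Flow (Sum.inl s) (Sum.inr t) ∧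
      Relation.ReflTransGen N.Flow (Sum.inr t) (Sum.inl e)
  safe : ∀ M, N.Reachable (single s) M → ∀ p, M p ≤ 1
  live : ∀ t ∈ N.T, ∃ M, N.Reachable (single s) M ∧ N.Enabled M t
  complete : ∀ M, N.Reachable (single s) M → N.Reachable M (single e)
  proper : ∀ M, N.Reachable (single s) M → 1 ≤ M e → M = single e

/-- The visible words of the firing sequences from one token in `s` to one token in `e`. -/
def langBetween (lab : Tr → Option A) (N : PetriNet Pl Tr) (s e : Pl) : Language A :=
  {w | ∃ σ, N.Run (single s) σ (single e) ∧ w = σ.filterMap lab}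

theorem IsSource.mem {s : Pl} (h : N.IsSource s) : s ∈ N.P :=
  (h ▸ Set.mem_singleton s : s ∈ {p ∈ N.P | N.preP p = ∅}).1

theorem IsSource.preP_eq {s : Pl} (h : N.IsSource s) : N.preP s = ∅ :=
  (h ▸ Set.mem_singleton s : s ∈ {p ∈ N.P | N.preP p = ∅}).2

theorem IsSink.mem {e : Pl} (h : N.IsSink e) : e ∈ N.P :=
  (h ▸ Set.mem_singleton e : e ∈ {p ∈ N.P | N.postP p = ∅}).1

theorem IsSink.postP_eq {e : Pl} (h : N.IsSink e) : N.postP e = ∅ :=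
  (h ▸ Set.mem_singleton e : e ∈ {p ∈ N.P | N.postP p = ∅}).2

theorem IsSource.not_tp {s : Pl} (h : N.IsSource s) (t : Tr) : ¬ N.tp t s := fun ht =>
  (Set.ext_iff.1 h.preP_eq t).1 ht

theorem IsSink.not_pt {e : Pl} (h : N.IsSink e) (t : Tr) : ¬ N.pt e t := fun ht =>
  (Set.ext_iff.1 h.postP_eq t).1 ht

theorem IsSource.unique {s s' : Pl} (h : N.IsSource s) (h' : N.IsSource s') : s = s' :=
  Set.singleton_injective (h.symm.trans h')

theorem IsSink.unique {e e' : Pl} (h : N.IsSink e) (h' : N.IsSink e') : e = e' :=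
  Set.singleton_injective (h.symm.trans h')

theorem lang_eq_langBetween (lab : Tr → Option A) {s e : Pl} (hs : N.IsSource s)
    (he : N.IsSink e) : N.lang lab = N.langBetween lab s e := by
  ext w
  constructor
  · rintro ⟨s', e', σ, hs', he', h⟩
    obtain rfl := hs.unique hs'
    obtain rfl := he.unique he'
    exact ⟨σ, h⟩
  · rintro ⟨σ, h⟩
    exact ⟨s, e, σ, hs, he, h⟩

theorem isWorkflow_of_wfNet (h : N.IsWFNet) (hsafe : N.IsSafe) (hsound : N.IsSound) :
    ∃ s e, N.IsSource s ∧ N.IsSink e ∧ N.IsWorkflow s e := by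
  obtain ⟨s, e, hs, he, hP, hT⟩ := h
  obtain ⟨h1, h2, h3⟩ := hsound s e hs he
  exact ⟨s, e, hs, he, hs.mem, he.mem, hP, hT, hsafe s hs, h1, h2, h3⟩

namespace IsWorkflow

variable {s e : Pl}

theorem exists_pt (h : N.IsWorkflow s e) {t : Tr} (ht : t ∈ N.T) : ∃ p, N.pt p t := by
  rcases Relation.ReflTransGen.cases_tail (h.path_trans t ht).1 with h1 | ⟨_, -, h1⟩
  · cases h1
  · cases h1 with
    | pt p _ h => exact ⟨p, h⟩

theorem exists_tp (h : N.IsWorkflow s e) {t : Tr} (ht : t ∈ N.T) : ∃ p, N.tp t p := by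
  rcases Relation.ReflTransGen.cases_head (h.path_trans t ht).2 with h1 | ⟨_, h1, -⟩
  · cases h1
  · cases h1 with
    | tp _ p h => exact ⟨p, h⟩

theorem eq_start_or_exists_tp (h : N.IsWorkflow s e) {p : Pl} (hp : p ∈ N.P) :
    p = s ∨ ∃ t, N.tp t p := by
  rcases Relation.ReflTransGen.cases_tail (h.path_place p hp).1 with h1 | ⟨_, -, h1⟩
  · exact Or.inl (Sum.inl_injective h1)
  · cases h1 with
    | tp t _ h => exact Or.inr ⟨t, h⟩

theorem eq_end_or_exists_pt (h : N.IsWorkflow s e) {p : Pl} (hp : p ∈ N.P) :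
    p = e ∨ ∃ t, N.pt p t := by
  rcases Relation.ReflTransGen.cases_head (h.path_place p hp).2 with h1 | ⟨_, h1, -⟩
  · exact Or.inl (Sum.inl_injective h1)
  · cases h1 with
    | pt _ t h => exact Or.inr ⟨t, h⟩

theorem isSource (h : N.IsWorkflow s e) (hs : N.preP s = ∅) : N.IsSource s := by
  ext p
  constructor
  · rintro ⟨hp, h0⟩
    rcases h.eq_start_or_exists_tp hp with rfl | ⟨t, ht⟩
    · rfl
    · exact absurd ht ((Set.ext_iff.1 h0 t).1)
  · rintro rfl
    exact ⟨h.start_mem, hs⟩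

theorem isSink (h : N.IsWorkflow s e) (he : N.postP e = ∅) : N.IsSink e := by
  ext p
  constructor
  · rintro ⟨hp, h0⟩
    rcases h.eq_end_or_exists_pt hp with rfl | ⟨t, ht⟩
    · rfl
    · exact absurd ht ((Set.ext_iff.1 h0 t).1)
  · rintro rfl
    exact ⟨h.end_mem, he⟩

theorem exists_one_le_of_fires (h : N.IsWorkflow s e) {M M' : Marking Pl} {t : Tr}
    (hf : N.Fires M t M') : ∃ p, 1 ≤ M' p := by
  obtain ⟨p, hp⟩ := h.exists_tp hf.1.1
  exact ⟨p, hf.one_le_of_tp hp⟩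

end IsWorkflow

/-! ### Normalization -/

theorem flow_addStart {p₀ : Pl} {t₀ : Tr} {ps : Pl} (hps : ps ∈ N.P) {x y : Pl ⊕ Tr}
    (h : N.Flow x y) : (N.addStart p₀ t₀ ps hps).Flow x y := by
  cases h with
  | pt p t h => exact .pt p t (Or.inl h)
  | tp t p h => exact .tp t p (Or.inl h)

theorem flow_addEnd {p₀ : Pl} {t₀ : Tr} {pe : Pl} (hpe : pe ∈ N.P) {x y : Pl ⊕ Tr}
    (h : N.Flow x y) : (N.addEnd pe t₀ p₀ hpe).Flow x y := by
  cases h with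
  | pt p t h => exact .pt p t (Or.inl h)
  | tp t p h => exact .tp t p (Or.inl h)

theorem fires_addStart {p₀ : Pl} {t₀ : Tr} {ps : Pl} (hps : ps ∈ N.P) {t : Tr} (ht : t ≠ t₀)
    {M M' : Marking Pl} : (N.addStart p₀ t₀ ps hps).Fires M t M' ↔ N.Fires M t M' :=
  fires_congr (by simp [addStart, ht]) (by simp [addStart, ht]) (by simp [addStart, ht])

theorem fires_addEnd {p₀ : Pl} {t₀ : Tr} {pe : Pl} (hpe : pe ∈ N.P) {t : Tr} (ht : t ≠ t₀)
    {M M' : Marking Pl} : (N.addEnd pe t₀ p₀ hpe).Fires M t M' ↔ N.Fires M t M' :=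
  fires_congr (by simp [addEnd, ht]) (by simp [addEnd, ht]) (by simp [addEnd, ht])

theorem run_addStart_of_run {p₀ : Pl} {t₀ : Tr} {ps : Pl} (hps : ps ∈ N.P) (ht₀ : t₀ ∉ N.T)
    {M M' : Marking Pl} {σ : List Tr} (h : N.Run M σ M') :
    (N.addStart p₀ t₀ ps hps).Run M σ M' := by
  induction h with
  | nil => exact .nil _
  | @cons _ _ _ t _ h _ ih =>
    have ht : t ≠ t₀ := by
      rintro rfl
      exact ht₀ h.1.1
    exact .cons ((fires_addStart hps ht).2 h) ih

theorem run_addEnd_of_run {p₀ : Pl} {t₀ : Tr} {pe : Pl} (hpe : pe ∈ N.P) (ht₀ : t₀ ∉ N.T)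
    {M M' : Marking Pl} {σ : List Tr} (h : N.Run M σ M') :
    (N.addEnd pe t₀ p₀ hpe).Run M σ M' := by
  induction h with
  | nil => exact .nil _
  | @cons _ _ _ t _ h _ ih =>
    have ht : t ≠ t₀ := by
      rintro rfl
      exact ht₀ h.1.1
    exact .cons ((fires_addEnd hpe ht).2 h) ih

theorem run_of_run_addStart {p₀ : Pl} {t₀ : Tr} {ps : Pl} (hps : ps ∈ N.P) (hp₀ : p₀ ∉ N.P)
    {M M' : Marking Pl} {σ : List Tr} (h : (N.addStart p₀ t₀ ps hps).Run M σ M')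
    (hM : M p₀ = 0) : N.Run M σ M' := by
  induction h with
  | nil => exact .nil _
  | @cons M M' M'' t σ h _ ih =>
    have ht : t ≠ t₀ := by
      rintro rfl
      have := h.1.2 p₀ (Or.inr ⟨rfl, rfl⟩)
      omega
    have h' := (fires_addStart hps ht).1 h
    exact .cons h' (ih ((Reachable.refl M).fires h' |>.eq_zero_of_notMem hp₀ hM))

theorem fires_addStart_start {p₀ : Pl} {t₀ : Tr} {ps : Pl} (hps : ps ∈ N.P) (hp₀ : p₀ ∉ N.P)
    (ht₀ : t₀ ∉ N.T) : (N.addStart p₀ t₀ ps hps).Fires (single p₀) t₀ (single ps) := by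
  have hne : p₀ ≠ ps := fun h => hp₀ (h ▸ hps)
  have h1 : ∀ p, N.pt p t₀ ↔ False := fun p => iff_false_intro fun h => ht₀ (N.pt_mem p t₀ h).2
  have h2 : ∀ p, N.tp t₀ p ↔ False := fun p => iff_false_intro fun h => ht₀ (N.tp_mem t₀ p h).1
  refine fires_iff.2 ⟨⟨Or.inl rfl, ?_⟩, fun p => ?_⟩
  · rintro p (h | ⟨rfl, -⟩)
    · exact ((h1 p).1 h).elim
    · rw [single_self]
  · simp only [addStart, h1, h2, false_or, and_true, true_and]
    by_cases hp : p = p₀ <;> by_cases hp' : p = ps <;> simp_all [single]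

theorem fires_addEnd_end {p₀ : Pl} {t₀ : Tr} {pe : Pl} (hpe : pe ∈ N.P)
    (ht₀ : t₀ ∉ N.T) : (N.addEnd pe t₀ p₀ hpe).Fires (single pe) t₀ (single p₀) := by
  have h1 : ∀ p, N.pt p t₀ ↔ False := fun p => iff_false_intro fun h => ht₀ (N.pt_mem p t₀ h).2
  have h2 : ∀ p, N.tp t₀ p ↔ False := fun p => iff_false_intro fun h => ht₀ (N.tp_mem t₀ p h).1
  refine fires_iff.2 ⟨⟨Or.inl rfl, ?_⟩, fun p => ?_⟩
  · rintro p (h | ⟨rfl, -⟩)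
    · exact ((h1 p).1 h).elim
    · rw [single_self]
  · simp only [addEnd, h1, h2, false_or, and_true, true_and]
    by_cases hp : p = pe <;> by_cases hp' : p = p₀ <;> simp_all [single]

theorem IsWorkflow.run_addStart_iff {s e : Pl} (h : N.IsWorkflow s e) {p₀ : Pl} {t₀ : Tr}
    (hp₀ : p₀ ∉ N.P) (ht₀ : t₀ ∉ N.T) {M : Marking Pl} {σ : List Tr} :
    (N.addStart p₀ t₀ s h.start_mem).Run (single p₀) σ M ↔
      (σ = [] ∧ M = single p₀) ∨ ∃ σ', σ = t₀ :: σ' ∧ N.Run (single s) σ' M := by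
  have hf := fires_addStart_start h.start_mem hp₀ ht₀
  have hne : p₀ ≠ s := fun hc => hp₀ (hc ▸ h.start_mem)
  constructor
  · intro hr
    cases hr with
    | nil => exact Or.inl ⟨rfl, rfl⟩
    | @cons _ M' _ t σ' h1 hr =>
      have ht : t = t₀ := by
        by_contra ht
        have h2 := (fires_addStart h.start_mem ht).1 h1
        obtain ⟨p, hp⟩ := h.exists_pt h2.1.1
        have := eq_of_one_le_single (h2.1.2 p hp)
        exact hp₀ (this ▸ (N.pt_mem p t hp).1)
      subst ht
      obtain rfl := h1.unique hf
      exact Or.inr ⟨σ', rfl, run_of_run_addStart h.start_mem hp₀ hr (single_of_ne hne)⟩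
  · rintro (⟨rfl, rfl⟩ | ⟨σ', rfl, hr⟩)
    · exact .nil _
    · exact .cons hf (run_addStart_of_run _ ht₀ hr)

theorem IsWorkflow.run_addEnd_iff {s e : Pl} (h : N.IsWorkflow s e) {p₀ : Pl} {t₀ : Tr}
    (hp₀ : p₀ ∉ N.P) (ht₀ : t₀ ∉ N.T) {M : Marking Pl} {σ : List Tr} :
    (N.addEnd e t₀ p₀ h.end_mem).Run (single s) σ M ↔
      N.Run (single s) σ M ∨
        (M = single p₀ ∧ ∃ σ', σ = σ' ++ [t₀] ∧ N.Run (single s) σ' (single e)) := by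
  have hf := fires_addEnd_end (p₀ := p₀) h.end_mem ht₀
  constructor
  · intro hr
    refine Run.induction_snoc (motive := fun σ M => N.Run (single s) σ M ∨
      (M = single p₀ ∧ ∃ σ', σ = σ' ++ [t₀] ∧ N.Run (single s) σ' (single e)))
      (Or.inl (.nil _)) ?_ hr
    · intro σ t M' M'' _ ih h1
      by_cases ht : t = t₀
      · subst ht
        have hM' : 1 ≤ M' e := h1.1.2 e (Or.inr ⟨rfl, rfl⟩)
        rcases ih with hr | ⟨rfl, -⟩
        · obtain rfl := h.proper M' ⟨_, hr⟩ hM'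
          exact Or.inr ⟨h1.unique hf, σ, rfl, hr⟩
        · exact absurd (eq_of_one_le_single hM' ▸ h.end_mem) hp₀
      · have h2 := (fires_addEnd h.end_mem ht).1 h1
        rcases ih with hr | ⟨rfl, -⟩
        · exact Or.inl (hr.snoc h2)
        · obtain ⟨p, hp⟩ := h.exists_pt h2.1.1
          exact absurd (eq_of_one_le_single (h2.1.2 p hp) ▸ (N.pt_mem p t hp).1) hp₀
  · rintro (hr | ⟨rfl, σ', rfl, hr⟩)
    · exact run_addEnd_of_run _ ht₀ hr
    · exact (run_addEnd_of_run _ ht₀ hr).snoc hf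

theorem IsWorkflow.addStart {s e : Pl} (h : N.IsWorkflow s e) {p₀ : Pl} {t₀ : Tr}
    (hp₀ : p₀ ∉ N.P) (ht₀ : t₀ ∉ N.T) : (N.addStart p₀ t₀ s h.start_mem).IsWorkflow p₀ e := by
  have hf := fires_addStart_start h.start_mem hp₀ ht₀
  have mono : ∀ {x y}, Relation.ReflTransGen N.Flow x y →
      Relation.ReflTransGen (N.addStart p₀ t₀ s h.start_mem).Flow x y :=
    fun hr => Relation.ReflTransGen.mono (fun _ _ hxy => flow_addStart h.start_mem hxy) _ _ hr
  have f1 : (N.addStart p₀ t₀ s h.start_mem).Flow (Sum.inl p₀) (Sum.inr t₀) :=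
    .pt _ _ (Or.inr ⟨rfl, rfl⟩)
  have f2 : (N.addStart p₀ t₀ s h.start_mem).Flow (Sum.inr t₀) (Sum.inl s) :=
    .tp _ _ (Or.inr ⟨rfl, rfl⟩)
  have r2 := (Relation.ReflTransGen.single f1).tail f2
  have rs := mono (h.path_place s h.start_mem).2
  have cases_reach : ∀ M, (N.addStart p₀ t₀ s h.start_mem).Reachable (single p₀) M →
      M = single p₀ ∨ N.Reachable (single s) M := by
    rintro M ⟨σ, hr⟩
    rcases (h.run_addStart_iff hp₀ ht₀).1 hr with ⟨-, rfl⟩ | ⟨σ', -, hr⟩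
    · exact Or.inl rfl
    · exact Or.inr ⟨σ', hr⟩
  have lift : ∀ {M M'}, N.Reachable M M' →
      (N.addStart p₀ t₀ s h.start_mem).Reachable M M' := by
    rintro M M' ⟨σ, hr⟩
    exact ⟨σ, run_addStart_of_run _ ht₀ hr⟩
  have hstart : (N.addStart p₀ t₀ s h.start_mem).Reachable (single p₀) (single s) :=
    (Reachable.refl _).fires hf
  refine ⟨Or.inl rfl, Or.inr h.end_mem, ?_, ?_, ?_, ?_, ?_, ?_⟩
  · rintro p (rfl | hp)
    · exact ⟨.refl, r2.trans rs⟩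
    · exact ⟨r2.trans (mono (h.path_place p hp).1), mono (h.path_place p hp).2⟩
  · rintro t (rfl | ht)
    · exact ⟨.single f1, rs.head f2⟩
    · exact ⟨r2.trans (mono (h.path_trans t ht).1), mono (h.path_trans t ht).2⟩
  · intro M hM p
    rcases cases_reach M hM with rfl | hM
    · simp only [single]; split_ifs <;> omega
    · exact h.safe M hM p
  · rintro t (rfl | ht)
    · exact ⟨_, .refl _, hf.1⟩
    · obtain ⟨M, hM, hen⟩ := h.live t ht
      refine ⟨M, hstart.trans (lift hM), Or.inr ht, ?_⟩
      rintro p (hp | ⟨-, rfl⟩)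
      · exact hen.2 p hp
      · exact absurd ht ht₀
  · intro M hM
    rcases cases_reach M hM with rfl | hM
    · exact hstart.trans (lift (h.complete _ (.refl _)))
    · exact lift (h.complete M hM)
  · intro M hM he
    rcases cases_reach M hM with rfl | hM
    · exact absurd (eq_of_one_le_single he ▸ h.end_mem) hp₀
    · exact h.proper M hM he

theorem IsWorkflow.addEnd {s e : Pl} (h : N.IsWorkflow s e) {p₀ : Pl} {t₀ : Tr}
    (hp₀ : p₀ ∉ N.P) (ht₀ : t₀ ∉ N.T) : (N.addEnd e t₀ p₀ h.end_mem).IsWorkflow s p₀ := by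
  have hf := fires_addEnd_end (p₀ := p₀) h.end_mem ht₀
  have mono : ∀ {x y}, Relation.ReflTransGen N.Flow x y →
      Relation.ReflTransGen (N.addEnd e t₀ p₀ h.end_mem).Flow x y :=
    fun hr => Relation.ReflTransGen.mono (fun _ _ hxy => flow_addEnd h.end_mem hxy) _ _ hr
  have f1 : (N.addEnd e t₀ p₀ h.end_mem).Flow (Sum.inl e) (Sum.inr t₀) :=
    .pt _ _ (Or.inr ⟨rfl, rfl⟩)
  have f2 : (N.addEnd e t₀ p₀ h.end_mem).Flow (Sum.inr t₀) (Sum.inl p₀) :=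
    .tp _ _ (Or.inr ⟨rfl, rfl⟩)
  have r2 := (Relation.ReflTransGen.single f1).tail f2
  have rs := mono (h.path_place e h.end_mem).1
  have cases_reach : ∀ M, (N.addEnd e t₀ p₀ h.end_mem).Reachable (single s) M →
      M = single p₀ ∨ N.Reachable (single s) M := by
    rintro M ⟨σ, hr⟩
    rcases (h.run_addEnd_iff hp₀ ht₀).1 hr with hr | ⟨rfl, -⟩
    · exact Or.inr ⟨σ, hr⟩
    · exact Or.inl rfl
  have lift : ∀ {M M'}, N.Reachable M M' → (N.addEnd e t₀ p₀ h.end_mem).Reachable M M' := by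
    rintro M M' ⟨σ, hr⟩
    exact ⟨σ, run_addEnd_of_run _ ht₀ hr⟩
  refine ⟨Or.inr h.start_mem, Or.inl rfl, ?_, ?_, ?_, ?_, ?_, ?_⟩
  · rintro p (rfl | hp)
    · exact ⟨rs.trans r2, .refl⟩
    · exact ⟨mono (h.path_place p hp).1, (mono (h.path_place p hp).2).trans r2⟩
  · rintro t (rfl | ht)
    · exact ⟨rs.tail f1, .single f2⟩
    · exact ⟨mono (h.path_trans t ht).1, (mono (h.path_trans t ht).2).trans r2⟩
  · intro M hM p
    rcases cases_reach M hM with rfl | hM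
    · simp only [single]; split_ifs <;> omega
    · exact h.safe M hM p
  · rintro t (rfl | ht)
    · exact ⟨_, lift (h.complete _ (.refl _)), hf.1⟩
    · obtain ⟨M, hM, hen⟩ := h.live t ht
      refine ⟨M, lift hM, Or.inr ht, ?_⟩
      rintro p (hp | ⟨-, rfl⟩)
      · exact hen.2 p hp
      · exact absurd ht ht₀
  · intro M hM
    rcases cases_reach M hM with rfl | hM
    · exact .refl _
    · exact (lift (h.complete M hM)).fires hf
  · intro M hM he
    rcases cases_reach M hM with rfl | hM
    · rfl
    · have := hM.eq_zero_of_notMem hp₀ (single_of_ne fun hc => hp₀ (hc ▸ h.start_mem))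
      omega

theorem IsWorkflow.langBetween_addStart {s e : Pl} (h : N.IsWorkflow s e) {p₀ : Pl} {t₀ : Tr}
    (hp₀ : p₀ ∉ N.P) (ht₀ : t₀ ∉ N.T) {lab : Tr → Option A} (hlab : lab t₀ = none) :
    (N.addStart p₀ t₀ s h.start_mem).langBetween lab p₀ e = N.langBetween lab s e := by
  ext w
  constructor
  · rintro ⟨σ, hr, rfl⟩
    rcases (h.run_addStart_iff hp₀ ht₀).1 hr with ⟨-, hc⟩ | ⟨σ', rfl, hr'⟩
    · have : 1 ≤ single p₀ e := by rw [← hc, single_self]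
      exact absurd (eq_of_one_le_single this ▸ h.end_mem) hp₀
    · exact ⟨σ', hr', by simp [hlab]⟩
  · rintro ⟨σ, hr, rfl⟩
    exact ⟨t₀ :: σ, (h.run_addStart_iff hp₀ ht₀).2 (Or.inr ⟨σ, rfl, hr⟩), by simp [hlab]⟩

theorem IsWorkflow.langBetween_addEnd {s e : Pl} (h : N.IsWorkflow s e) {p₀ : Pl} {t₀ : Tr}
    (hp₀ : p₀ ∉ N.P) (ht₀ : t₀ ∉ N.T) {lab : Tr → Option A} (hlab : lab t₀ = none) :
    (N.addEnd e t₀ p₀ h.end_mem).langBetween lab s p₀ = N.langBetween lab s e := by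
  ext w
  constructor
  · rintro ⟨σ, hr, rfl⟩
    rcases (h.run_addEnd_iff hp₀ ht₀).1 hr with hr | ⟨-, σ', rfl, hr'⟩
    · have h0 := hr.reachable.eq_zero_of_notMem hp₀
        (single_of_ne fun hc => hp₀ (hc ▸ h.start_mem))
      rw [single_self] at h0
      omega
    · exact ⟨σ', hr', by simp [hlab]⟩
  · rintro ⟨σ, hr, rfl⟩
    exact ⟨σ ++ [t₀], (h.run_addEnd_iff hp₀ ht₀).2 (Or.inr ⟨rfl, σ, rfl, hr⟩), by simp [hlab]⟩

/-- Normalization turns a workflow system into a workflow net with the same language. -/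
theorem IsWorkflow.normalize {s e : Pl} (h : N.IsWorkflow s e) {lab : Tr → Option A}
    {N' : PetriNet Pl Tr} (hN : Normalize lab N s e N') :
    ∃ s' e', N'.IsSource s' ∧ N'.IsSink e' ∧ N'.IsWorkflow s' e' ∧
      N'.langBetween lab s' e' = N.langBetween lab s e := by
  obtain ⟨N₁, hS, hE⟩ := hN
  obtain ⟨s', h1, hpre, hl1⟩ : ∃ s', N₁.IsWorkflow s' e ∧ N₁.preP s' = ∅ ∧
      N₁.langBetween lab s' e = N.langBetween lab s e := by
    rcases hS with ⟨h0, rfl⟩ | ⟨-, p₀, t₀, hps, hp₀, ht₀, hlab, rfl⟩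
    · exact ⟨s, h, h0, rfl⟩
    · refine ⟨p₀, h.addStart hp₀ ht₀, ?_, h.langBetween_addStart hp₀ ht₀ hlab⟩
      refine Set.eq_empty_iff_forall_notMem.2 ?_
      rintro t (ht | ⟨-, rfl⟩)
      · exact hp₀ (N.tp_mem _ _ ht).2
      · exact hp₀ hps
  rcases hE with ⟨h0, rfl⟩ | ⟨-, p₀, t₀, hpe, hp₀, ht₀, hlab, rfl⟩
  · exact ⟨s', e, h1.isSource hpre, h1.isSink h0, h1, hl1⟩
  · have h2 := h1.addEnd hp₀ ht₀
    refine ⟨s', p₀, h2.isSource ?_, h2.isSink ?_, h2,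
      (h1.langBetween_addEnd hp₀ ht₀ hlab).trans hl1⟩
    · refine Set.eq_empty_iff_forall_notMem.2 ?_
      rintro t (ht | ⟨-, rfl⟩)
      · exact (Set.ext_iff.1 hpre t).1 ht
      · exact hp₀ h1.start_mem
    · refine Set.eq_empty_iff_forall_notMem.2 ?_
      rintro t (ht | ⟨rfl, -⟩)
      · exact hp₀ (N₁.pt_mem _ _ ht).1
      · exact hp₀ hpe

end PetriNet
end POWL

namespace POWL

/-! ### Order-preserving shuffles -/

section Shuffle

variable {A : Type*} {n : ℕ}

/-- Order-preserving shuffles generated letter by letter: the first letter of the shuffle is the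
first letter of some word `s i`, and it may be taken only if all `r`-predecessors of `i` are
exhausted. -/
def IsShuffle (r : Fin n → Fin n → Prop) : (Fin n → List A) → List A → Prop
  | s, [] => ∀ i, s i = []
  | s, a :: w => ∃ i rest, s i = a :: rest ∧ (∀ j, r j i → s j = []) ∧
      IsShuffle r (Function.update s i rest) w

/-- `F i k` is the position in `w` of the `k`-th letter of `s i`, in an order-preserving shuffle.
The values of `F i` beyond the length of `s i` are irrelevant. This is a bijection as in the
definition of `shuffle`, without its dependent types. -/
structure IsPositions (r : Fin n → Fin n → Prop) (s : Fin n → List A) (w : List A)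
    (F : Fin n → ℕ → ℕ) : Prop where
  lt : ∀ j k, k < (s j).length → F j k < w.length
  letter : ∀ j k, k < (s j).length → w[F j k]? = (s j)[k]?
  inj : ∀ j k j' k', k < (s j).length → k' < (s j').length → F j k = F j' k' → j = j' ∧ k = k'
  surj : ∀ x, x < w.length → ∃ j k, k < (s j).length ∧ F j k = x
  mono : ∀ j k j' k', k < (s j).length → k' < (s j').length →
    (r j j' ∨ (j = j' ∧ k < k')) → F j k < F j' k'

theorem mem_shuffle_iff_exists_positions {r : Fin n → Fin n → Prop} {s : Fin n → List A}
    {w : List A} : w ∈ shuffle r s ↔ ∃ F, IsPositions r s w F := by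
  constructor
  · rintro ⟨f, hl, hm⟩
    let F : Fin n → ℕ → ℕ := fun j k => if h : k < (s j).length then f ⟨j, ⟨k, h⟩⟩ else 0
    have hF : ∀ j k (h : k < (s j).length), F j k = f ⟨j, ⟨k, h⟩⟩ := fun j k h => dif_pos h
    refine ⟨F, ?_, ?_, ?_, ?_, ?_⟩
    · intro j k h
      rw [hF j k h]; exact (f _).2
    · intro j k h
      have := hl ⟨j, ⟨k, h⟩⟩
      simp only [List.get_eq_getElem] at this
      rw [hF j k h, List.getElem?_eq_getElem (f _).2, List.getElem?_eq_getElem h, this]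
    · intro j k j' k' h h' he
      rw [hF j k h, hF j' k' h'] at he
      have := f.injective (Fin.ext he)
      simp only [Sigma.mk.injEq] at this
      obtain ⟨rfl, h2⟩ := this
      exact ⟨rfl, Fin.mk.inj_iff.1 (eq_of_heq h2)⟩
    · intro x hx
      obtain ⟨⟨j, k⟩, h⟩ := f.surjective ⟨x, hx⟩
      exact ⟨j, k, k.2, by rw [hF j k k.2, h]⟩
    · intro j k j' k' h h' hr
      rw [hF j k h, hF j' k' h']
      exact hm ⟨j, ⟨k, h⟩⟩ ⟨j', ⟨k', h'⟩⟩ hr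
  · rintro ⟨F, hF⟩
    let g : (Σ j : Fin n, Fin (s j).length) → Fin w.length :=
      fun x => ⟨F x.1 x.2, hF.lt _ _ x.2.2⟩
    have hg : Function.Bijective g := by
      constructor
      · rintro ⟨j, k⟩ ⟨j', k'⟩ h
        obtain ⟨h1, h2⟩ := hF.inj j k j' k' k.2 k'.2 (Fin.mk.inj_iff.1 h)
        subst h1
        rw [Fin.ext h2]
      · rintro ⟨x, hx⟩
        obtain ⟨j, k, hk, h⟩ := hF.surj x hx
        exact ⟨⟨j, ⟨k, hk⟩⟩, Fin.ext h⟩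
    refine ⟨Equiv.ofBijective g hg, ?_, ?_⟩
    · rintro ⟨j, k⟩
      have := hF.letter j k k.2
      rw [List.getElem?_eq_getElem (hF.lt _ _ k.2), List.getElem?_eq_getElem k.2] at this
      simpa [g] using this
    · rintro ⟨j, k⟩ ⟨j', k'⟩ hr
      exact hF.mono j k j' k' k.2 k'.2 hr

theorem IsPositions.cons {r : Fin n → Fin n → Prop} {s : Fin n → List A} {w : List A}
    {F : Fin n → ℕ → ℕ} {a : A} {i : Fin n} {rest : List A} (hi : s i = a :: rest)
    (hr : ∀ j, r j i → s j = []) (hF : IsPositions r (Function.update s i rest) w F) :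
    IsPositions r s (a :: w)
      (fun j k => if j = i then (if k = 0 then 0 else F i (k - 1) + 1) else F j k + 1) := by
  have hself : Function.update s i rest i = rest := Function.update_self ..
  have hne : ∀ {j}, j ≠ i → Function.update s i rest j = s j := fun h => Function.update_of_ne h ..
  have hlen : ∀ {k}, k + 1 < (s i).length → k < (Function.update s i rest i).length := by
    intro k hk
    rw [hself]; rw [hi] at hk; simpa using hk
  have hlen' : ∀ {j k}, j ≠ i → k < (s j).length → k < (Function.update s i rest j).length := by
    intro j k hj hk
    rwa [hne hj]
  refine ⟨?_, ?_, ?_, ?_, ?_⟩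
  · intro j k hk
    by_cases hj : j = i
    · subst hj
      rcases k with _ | k
      · simp
      · simpa using hF.lt j k (hlen hk)
    · simpa [hj] using hF.lt j k (hlen' hj hk)
  · intro j k hk
    by_cases hj : j = i
    · subst hj
      rcases k with _ | k
      · simp [hi]
      · have := hF.letter j k (hlen hk)
        rw [hself] at this
        simpa [hi] using this
    · have := hF.letter j k (hlen' hj hk)
      rw [hne hj] at this
      simpa [hj] using this
  · intro j k j' k' hk hk' he
    by_cases hj : j = i <;> by_cases hj' : j' = i
    · subst hj; subst hj'
      rcases k with _ | k <;> rcases k' with _ | k' <;> simp at he ⊢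
      exact (hF.inj j' k j' k' (hlen hk) (hlen hk') he).2
    · subst hj
      rcases k with _ | k <;> simp [hj'] at he
      exact absurd (hF.inj j k j' k' (hlen hk) (hlen' hj' hk') he).1 (Ne.symm hj')
    · subst hj'
      rcases k' with _ | k' <;> simp [hj] at he
      exact absurd (hF.inj j k j' k' (hlen' hj hk) (hlen hk') he).1 hj
    · simp [hj, hj'] at he
      exact hF.inj j k j' k' (hlen' hj hk) (hlen' hj' hk') he
  · intro x hx
    rcases x with _ | x
    · exact ⟨i, 0, by simp [hi], by simp⟩
    · obtain ⟨j, k, hk, h⟩ := hF.surj x (by simpa using hx)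
      by_cases hj : j = i
      · subst hj
        rw [hself] at hk
        exact ⟨j, k + 1, by simpa [hi] using hk, by simp [h]⟩
      · rw [hne hj] at hk
        exact ⟨j, k, hk, by simp [hj, h]⟩
  · intro j k j' k' hk hk' h
    by_cases hj' : j' = i
    · subst hj'
      rcases h with h | ⟨rfl, h⟩
      · simp [hr j h] at hk
      · rcases k' with _ | k'
        · omega
        · rcases k with _ | k
          · simp
          · simpa using hF.mono j k j k' (hlen hk) (hlen hk') (Or.inr ⟨rfl, by omega⟩)
    · by_cases hj : j = i
      · subst hj
        rcases k with _ | k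
        · simp [hj']
        · have h : r j j' ∨ (j = j' ∧ k < k') := by
            rcases h with h | ⟨h, -⟩
            · exact Or.inl h
            · exact absurd h.symm hj'
          simpa [hj'] using hF.mono j k j' k' (hlen hk) (hlen' hj' hk') h
      · simpa [hj, hj'] using hF.mono j k j' k' (hlen' hj hk) (hlen' hj' hk') h

theorem IsPositions.exists_tail {r : Fin n → Fin n → Prop} {s : Fin n → List A} {w : List A}
    {F : Fin n → ℕ → ℕ} {a : A} (hF : IsPositions r s (a :: w) F) :
    ∃ i rest, s i = a :: rest ∧ (∀ j, r j i → s j = []) ∧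
      ∃ F', IsPositions r (Function.update s i rest) w F' := by
  obtain ⟨i, k, hk, h0⟩ := hF.surj 0 (by simp)
  obtain rfl : k = 0 := by
    by_contra hk0
    have := hF.mono i 0 i k (by omega) hk (Or.inr ⟨rfl, by omega⟩)
    omega
  obtain ⟨b, rest, hi⟩ := List.exists_cons_of_length_pos hk
  have hl := hF.letter i 0 hk
  rw [h0, hi] at hl
  obtain rfl : a = b := by simpa using hl
  have hself : Function.update s i rest i = rest := Function.update_self ..
  have hne : ∀ {j}, j ≠ i → Function.update s i rest j = s j := fun h => Function.update_of_ne h ..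
  -- All letters but the first one of `s i` sit at positive positions.
  have hpos : ∀ j k, k < (s j).length → (j ≠ i ∨ k ≠ 0) → 0 < F j k := by
    intro j k hk' h
    by_contra hc
    have := hF.inj j k i 0 hk' hk (by omega)
    omega
  -- The index in `s j` of the `k`-th letter of the shortened word.
  let c : Fin n → ℕ → ℕ := fun j k => if j = i then k + 1 else k
  have hc : ∀ {j k}, k < (Function.update s i rest j).length →
      c j k < (s j).length ∧ (j ≠ i ∨ c j k ≠ 0) ∧
        (s j)[c j k]? = (Function.update s i rest j)[k]? := by
    intro j k hk'
    by_cases hj : j = i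
    · subst hj
      rw [hself] at hk' ⊢
      simpa [c, hi] using hk'
    · rw [hne hj] at hk' ⊢
      simpa [c, hj] using hk'
  refine ⟨i, rest, hi, ?_, fun j k => F j (c j k) - 1, ?_, ?_, ?_, ?_, ?_⟩
  · intro j hj
    by_contra hs
    have := hF.mono j 0 i 0 (List.length_pos_of_ne_nil hs) hk (Or.inl hj)
    omega
  · intro j k hk'
    obtain ⟨h1, h2, -⟩ := hc hk'
    have := hF.lt _ _ h1
    have := hpos _ _ h1 h2
    simp only [List.length_cons] at *
    omega
  · intro j k hk'
    obtain ⟨h1, h2, h3⟩ := hc hk'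
    have h4 := hF.letter _ _ h1
    have := hpos _ _ h1 h2
    obtain ⟨x, hx⟩ : ∃ x, F j (c j k) = x + 1 := ⟨_, (Nat.succ_pred_eq_of_pos this).symm⟩
    rw [hx, List.getElem?_cons_succ] at h4
    rw [← h3, ← h4, hx, Nat.add_sub_cancel]
  · intro j k j' k' hk hk' he
    obtain ⟨h1, h2, -⟩ := hc hk
    obtain ⟨h1', h2', -⟩ := hc hk'
    have := hpos _ _ h1 h2
    have := hpos _ _ h1' h2'
    obtain ⟨rfl, h⟩ := hF.inj _ _ _ _ h1 h1' (by omega)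
    refine ⟨rfl, ?_⟩
    by_cases hj : j = i <;> simp only [c, hj, if_true, if_false] at h <;> omega
  · intro x hx
    obtain ⟨j, k, hk', h⟩ := hF.surj (x + 1) (by simpa using hx)
    by_cases hj : j = i
    · subst hj
      rcases k with _ | k
      · omega
      · refine ⟨j, k, ?_, by simp [c, h]⟩
        rw [hself]; rw [hi] at hk'; simpa using hk'
    · exact ⟨j, k, by rwa [hne hj], by simp [c, hj, h]⟩
  · intro j k j' k' hk hk' h
    obtain ⟨h1, h2, -⟩ := hc hk
    obtain ⟨h1', h2', -⟩ := hc hk'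
    have := hpos _ _ h1 h2
    have h5 : r j j' ∨ (j = j' ∧ c j k < c j' k') := by
      rcases h with h | ⟨rfl, h⟩
      · exact Or.inl h
      · refine Or.inr ⟨rfl, ?_⟩
        by_cases hj : j = i <;> simp only [c, hj, if_true, if_false] <;> omega
    have := hF.mono _ _ _ _ h1 h1' h5
    omega

theorem mem_shuffle_iff {r : Fin n → Fin n → Prop} {s : Fin n → List A} {w : List A} :
    w ∈ shuffle r s ↔ IsShuffle r s w := by
  rw [mem_shuffle_iff_exists_positions]
  induction w generalizing s with
  | nil =>
    constructor
    · rintro ⟨F, hF⟩ i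
      by_contra hs
      have := hF.lt i 0 (List.length_pos_of_ne_nil hs)
      simp at this
    · intro h
      have h : ∀ i, s i = [] := h
      exact ⟨fun _ _ => 0, by simp [h], by simp [h], by simp [h], by simp, by simp [h]⟩
  | cons a w ih =>
    constructor
    · rintro ⟨F, hF⟩
      obtain ⟨i, rest, hi, hr, F', hF'⟩ := hF.exists_tail
      exact ⟨i, rest, hi, hr, ih.1 ⟨F', hF'⟩⟩
    · rintro ⟨i, rest, hi, hr, h⟩
      obtain ⟨F, hF⟩ := ih.2 h
      exact ⟨_, hF.cons hi hr⟩

end Shuffle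

end POWL

namespace POWL
namespace PetriNet

variable {Pl Tr A : Type*} {N C : PetriNet Pl Tr} {n : ℕ}

/-! ### Families of parts -/

/-- The sets `parts i` form a partition of the transitions of `N`. -/
structure IsPartFamily (N : PetriNet Pl Tr) (parts : Fin n → Set Tr) : Prop where
  cover : ∀ t ∈ N.T, ∃ i, t ∈ parts i
  subset : ∀ i, parts i ⊆ N.T
  nonempty : ∀ i, (parts i).Nonempty
  disjoint : ∀ {i j t}, t ∈ parts i → t ∈ parts j → i = j

theorem IsPartition.isPartFamily {G : Set (Set Tr)} {parts : Fin n → Set Tr}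
    (h : N.IsPartition G) (hparts : Indexes parts G) : N.IsPartFamily parts := by
  obtain ⟨h1, h2, h3⟩ := h
  obtain ⟨hinj, rfl⟩ := hparts
  refine ⟨?_, ?_, ?_, ?_⟩
  · intro t ht
    rw [← h1] at ht
    obtain ⟨_, ⟨i, rfl⟩, hi⟩ := ht
    exact ⟨i, hi⟩
  · intro i t ht
    rw [← h1]
    exact ⟨_, ⟨i, rfl⟩, ht⟩
  · intro i
    exact Set.nonempty_iff_ne_empty.2 fun h => h2 ⟨i, h⟩
  · intro i j t hi hj
    by_contra hne
    exact Set.disjoint_left.1 (h3 ⟨i, rfl⟩ ⟨j, rfl⟩ fun h => hne (hinj h)) hi hj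

theorem Indexes.two_le {G : Set (Set Tr)} {parts : Fin n → Set Tr} (h : Indexes parts G)
    (hG : 1 < G.encard) : 2 ≤ n := by
  obtain ⟨hinj, rfl⟩ := h
  rw [← Set.image_univ, hinj.encard_image, Set.encard_univ, ENat.card_eq_coe_fintype_card,
    Fintype.card_fin] at hG
  exact_mod_cast hG

theorem mem_Pre_of_tp {S : Set Tr} {t u : Tr} {x : Pl} (ht : N.tp t x) (htS : t ∉ S)
    (hu : N.pt x u) (huS : u ∈ S) : x ∈ N.Pre S :=
  ⟨(N.tp_mem t x ht).2, ⟨u, huS, hu⟩, Or.inr ⟨t, ⟨(N.tp_mem t x ht).1, htS⟩, ht⟩⟩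

theorem mem_Post_of_pt {S : Set Tr} {t u : Tr} {x : Pl} (ht : N.tp t x) (htS : t ∈ S)
    (hu : N.pt x u) (huS : u ∉ S) : x ∈ N.Post S :=
  ⟨(N.tp_mem t x ht).2, ⟨t, htS, ht⟩, Or.inr ⟨u, ⟨(N.pt_mem x u hu).2, huS⟩, hu⟩⟩

theorem IsSource.mem_Pre {S : Set Tr} {u : Tr} {s : Pl} (hs : N.IsSource s) (hu : N.pt s u)
    (huS : u ∈ S) : s ∈ N.Pre S :=
  ⟨hs.mem, ⟨u, huS, hu⟩, Or.inl hs⟩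

theorem IsSink.mem_Post {S : Set Tr} {t : Tr} {e : Pl} (he : N.IsSink e) (ht : N.tp t e)
    (htS : t ∈ S) : e ∈ N.Post S :=
  ⟨he.mem, ⟨t, htS, ht⟩, Or.inl he⟩

theorem IsPartFamily.mem_Pre_and_mem_Post {parts : Fin n → Set Tr} (h : N.IsPartFamily parts)
    {i j : Fin n} {t u : Tr} {x : Pl} (ht : N.tp t x) (hti : t ∈ parts i) (hu : N.pt x u)
    (huj : u ∈ parts j) (hij : i ≠ j) : x ∈ N.Post (parts i) ∧ x ∈ N.Pre (parts j) :=
  ⟨mem_Post_of_pt ht hti hu fun hc => hij (h.disjoint hc huj),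
    mem_Pre_of_tp ht (fun hc => hij (h.disjoint hti hc)) hu huj⟩

theorem IsSource.ne_sink {s e : Pl} (hs : N.IsSource s) (hw : N.IsWorkflow s e)
    (hT : N.T.Nonempty) : s ≠ e := by
  rintro rfl
  obtain ⟨t, ht⟩ := hT
  rcases Relation.ReflTransGen.cases_tail (hw.path_trans t ht).2 with h1 | ⟨_, -, h1⟩
  · cases h1
  · cases h1 with
    | tp u _ h => exact hs.not_tp u h

/-- Paths in a net `C` that arises from the transitions `S` of `N` by renaming (and possibly
identifying) places along `g`, where all entry places become `ps` and all exit places `pe`: a path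
of `N` from the source to a transition of `S` enters `S` for the last time through an entry place,
and symmetrically for exit places. -/
theorem IsWorkflow.paths_quotient {s e : Pl} (hw : N.IsWorkflow s e) (hs : N.IsSource s)
    (he : N.IsSink e) {S : Set Tr} {g : Pl → Pl} {ps pe : Pl}
    (hpt : ∀ x, ∀ t ∈ S, N.pt x t → C.Flow (Sum.inl (g x)) (Sum.inr t))
    (htp : ∀ x, ∀ t ∈ S, N.tp t x → C.Flow (Sum.inr t) (Sum.inl (g x)))
    (hpre : ∀ x ∈ N.Pre S, g x = ps) (hpost : ∀ x ∈ N.Post S, g x = pe) :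
    (∀ t ∈ S, t ∈ N.T → Relation.ReflTransGen C.Flow (Sum.inl ps) (Sum.inr t) ∧
      Relation.ReflTransGen C.Flow (Sum.inr t) (Sum.inl pe)) ∧
    (∀ x, (∃ t ∈ S, N.pt x t ∨ N.tp t x) →
      Relation.ReflTransGen C.Flow (Sum.inl ps) (Sum.inl (g x)) ∧
      Relation.ReflTransGen C.Flow (Sum.inl (g x)) (Sum.inl pe)) := by
  have fwd : ∀ y, Relation.ReflTransGen N.Flow (Sum.inl s) y →
      (∀ t ∈ S, y = Sum.inr t → Relation.ReflTransGen C.Flow (Sum.inl ps) (Sum.inr t)) ∧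
      (∀ x, ∀ t ∈ S, N.pt x t → y = Sum.inl x →
        Relation.ReflTransGen C.Flow (Sum.inl ps) (Sum.inl (g x))) := by
    intro y hy
    induction hy with
    | refl =>
      refine ⟨by simp, ?_⟩
      rintro x t ht hxt hx
      obtain rfl := Sum.inl_injective hx
      rw [hpre _ (hs.mem_Pre hxt ht)]
    | tail _ hf ih =>
      cases hf with
      | pt x t hxt =>
        refine ⟨?_, by simp⟩
        rintro u hu he
        obtain rfl := Sum.inr_injective he
        exact (ih.2 x t hu hxt rfl).tail (hpt x t hu hxt)
      | tp t x htx =>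
        refine ⟨by simp, ?_⟩
        rintro x' u hu hxu he
        obtain rfl := Sum.inl_injective he
        by_cases htS : t ∈ S
        · exact (ih.1 t htS rfl).tail (htp x t htS htx)
        · rw [hpre x (mem_Pre_of_tp htx htS hxu hu)]
  have bwd : ∀ y, Relation.ReflTransGen N.Flow y (Sum.inl e) →
      (∀ t ∈ S, y = Sum.inr t → Relation.ReflTransGen C.Flow (Sum.inr t) (Sum.inl pe)) ∧
      (∀ x, ∀ t ∈ S, N.tp t x → y = Sum.inl x →
        Relation.ReflTransGen C.Flow (Sum.inl (g x)) (Sum.inl pe)) := by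
    intro y hy
    induction hy using Relation.ReflTransGen.head_induction_on with
    | refl =>
      refine ⟨by simp, ?_⟩
      rintro x t ht htx hx
      obtain rfl := Sum.inl_injective hx
      rw [hpost _ (he.mem_Post htx ht)]
    | head hf _ ih =>
      cases hf with
      | tp t x htx =>
        refine ⟨?_, by simp⟩
        rintro u hu he
        obtain rfl := Sum.inr_injective he
        exact (ih.2 x t hu htx rfl).head (htp x t hu htx)
      | pt x t hxt =>
        refine ⟨by simp, ?_⟩
        rintro x' u hu hux he
        obtain rfl := Sum.inl_injective he
        by_cases htS : t ∈ S
        · exact (ih.1 t htS rfl).head (hpt x t htS hxt)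
        · rw [hpost x (mem_Post_of_pt hux hu hxt htS)]
  have trans : ∀ t ∈ S, t ∈ N.T → Relation.ReflTransGen C.Flow (Sum.inl ps) (Sum.inr t) ∧
      Relation.ReflTransGen C.Flow (Sum.inr t) (Sum.inl pe) := fun t ht htT =>
    ⟨(fwd _ (hw.path_trans t htT).1).1 t ht rfl, (bwd _ (hw.path_trans t htT).2).1 t ht rfl⟩
  refine ⟨trans, ?_⟩
  rintro x ⟨t, ht, hx | hx⟩
  · have hm := N.pt_mem x t hx
    exact ⟨(fwd _ (hw.path_place x hm.1).1).2 x t ht hx rfl,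
      (trans t ht hm.2).2.head (hpt x t ht hx)⟩
  · have hm := N.tp_mem t x hx
    exact ⟨(trans t ht hm.1).1.tail (htp x t ht hx),
      (bwd _ (hw.path_place x hm.2).2).2 x t ht hx rfl⟩

/-- A reachable marking of a safe system cannot evolve into itself plus further tokens. -/
theorem IsWorkflow.eq_zero_of_pump {s e : Pl} (hw : N.IsWorkflow s e) {M X : Marking Pl}
    (hM : N.Reachable (single s) M) (hX : N.Reachable M (M + X)) (x : Pl) : X x = 0 := by
  have := hw.safe _ ((hM.trans hX).trans (hX.add X)) x
  simp only [Pi.add_apply] at this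
  omega

/-! ### Concurrency-hiding partitions -/

/-- A workflow net with a partition of its transitions into parts that have a single entry place
`p i` and a single exit place `q i`. -/
structure IsSingleEntryExit (N : PetriNet Pl Tr) (s e : Pl) (parts : Fin n → Set Tr)
    (p q : Fin n → Pl) : Prop extends N.IsWorkflow s e, N.IsPartFamily parts where
  source : N.IsSource s
  sink : N.IsSink e
  pre_eq : ∀ i, N.Pre (parts i) = {p i}
  post_eq : ∀ i, N.Post (parts i) = {q i}

theorem fires_coreCG_iff {S : Set Tr} {M M' : Marking Pl} {t : Tr} :
    (N.coreCG S).Fires M t M' ↔ t ∈ S ∧ N.Fires M t M' := by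
  have key : t ∈ S → ((N.coreCG S).Fires M t M' ↔ N.Fires M t M') := by
    intro ht
    refine fires_congr (fun x => ?_) (fun x => ?_) ?_
    · constructor
      · exact fun h => h.2.2
      · intro h
        have hm := N.pt_mem x t h
        exact ⟨⟨hm.1, t, Or.inr h, ht⟩, ⟨hm.2, ht⟩, h⟩
    · constructor
      · exact fun h => h.2.2
      · intro h
        have hm := N.tp_mem t x h
        exact ⟨⟨hm.2, t, Or.inl h, ht⟩, ⟨hm.1, ht⟩, h⟩
    · exact ⟨fun h => h.1, fun h => ⟨h, ht⟩⟩
  constructor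
  · intro h
    have ht : t ∈ S := h.1.1.2
    exact ⟨ht, (key ht).1 h⟩
  · rintro ⟨ht, h⟩
    exact (key ht).2 h

theorem Run.of_coreCG {S : Set Tr} {M M' : Marking Pl} {σ : List Tr}
    (h : (N.coreCG S).Run M σ M') : N.Run M σ M' := by
  induction h with
  | nil => exact .nil _
  | cons h _ ih => exact .cons (fires_coreCG_iff.1 h).2 ih

theorem Reachable.of_coreCG {S : Set Tr} {M M' : Marking Pl}
    (h : (N.coreCG S).Reachable M M') : N.Reachable M M' := by
  obtain ⟨σ, h⟩ := h
  exact ⟨σ, h.of_coreCG⟩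

namespace IsSingleEntryExit

variable {s e : Pl} {parts : Fin n → Set Tr} {p q : Fin n → Pl} {i j : Fin n}
  {t u : Tr} {x : Pl} {m M : Marking Pl} {α : List Tr}

theorem exit_and_entry (h : N.IsSingleEntryExit s e parts p q) (ht : N.tp t x)
    (hti : t ∈ parts i) (hu : N.pt x u) (huj : u ∈ parts j) (hij : i ≠ j) :
    x = q i ∧ x = p j := by
  have := h.mem_Pre_and_mem_Post ht hti hu huj hij
  rwa [h.pre_eq, h.post_eq] at this

theorem entry_eq_source (h : N.IsSingleEntryExit s e parts p q) (hu : N.pt s u)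
    (huj : u ∈ parts j) : s = p j := by
  have := h.source.mem_Pre hu huj
  rwa [h.pre_eq] at this

theorem exit_eq_sink (h : N.IsSingleEntryExit s e parts p q) (ht : N.tp t e)
    (hti : t ∈ parts i) : e = q i := by
  have := h.sink.mem_Post ht hti
  rwa [h.post_eq] at this

theorem entry_mem_Pre (h : N.IsSingleEntryExit s e parts p q) (i : Fin n) :
    p i ∈ N.Pre (parts i) := by
  rw [h.pre_eq]; rfl

theorem exit_mem_Post (h : N.IsSingleEntryExit s e parts p q) (i : Fin n) :
    q i ∈ N.Post (parts i) := by
  rw [h.post_eq]; rfl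

/-- Each part can be started by one token in its entry place: this is true of the first transition
of the part that occurs in a firing sequence, as the other places it could consume from receive
tokens only from the part itself. -/
theorem exists_starter (h : N.IsSingleEntryExit s e parts p q) (j : Fin n) :
    ∃ t ∈ parts j, ∀ x, N.pt x t → x = p j := by
  by_contra hc
  push Not at hc
  have key : ∀ σ M, N.Run (single s) σ M →
      ∀ x, 1 ≤ M x → x = s ∨ ∃ k, k ≠ j ∧ ∃ u ∈ parts k, N.tp u x := by
    intro σ M hr
    refine Run.induction_snoc (motive := fun _ M => ∀ x, 1 ≤ M x →
      x = s ∨ ∃ k, k ≠ j ∧ ∃ u ∈ parts k, N.tp u x) ?_ ?_ hr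
    · exact fun x hx => Or.inl (eq_of_one_le_single hx)
    · intro σ t M M' _ ih hf x hx
      rcases hf.one_le_or_tp hx with hx | hx
      · exact ih x hx
      · obtain ⟨k, hk⟩ := h.cover t hf.1.1
        by_cases hkj : k = j
        · subst hkj
          obtain ⟨y, hy, hyp⟩ := hc t hk
          rcases ih y (hf.1.2 y hy) with rfl | ⟨l, hl, u, hu, huy⟩
          · exact absurd (h.entry_eq_source hy hk) hyp
          · exact absurd (h.exit_and_entry huy hu hy hk hl).2 hyp
        · exact Or.inr ⟨k, hkj, t, hk, hx⟩
  obtain ⟨t, ht⟩ := h.nonempty j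
  obtain ⟨M, ⟨σ, hr⟩, hen⟩ := h.live t (h.subset j ht)
  obtain ⟨y, hy, hyp⟩ := hc t ht
  rcases key σ M hr y (hen.2 y hy) with rfl | ⟨l, hl, u, hu, huy⟩
  · exact hyp (h.entry_eq_source hy ht)
  · exact hyp (h.exit_and_entry huy hu hy ht hl).2

theorem eq_entry_or_tp (hr : (N.coreCG (parts i)).Run (single (p i)) α m) (hx : 1 ≤ m x) :
    x = p i ∨ ∃ u ∈ parts i, N.tp u x := by
  revert x
  refine Run.induction_snoc (motive := fun _ m => ∀ {x}, 1 ≤ m x →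
    x = p i ∨ ∃ u ∈ parts i, N.tp u x) ?_ ?_ hr
  · exact fun hx => Or.inl (eq_of_one_le_single hx)
  · intro σ t M M' _ ih hf x hx
    rw [fires_coreCG_iff] at hf
    rcases hf.2.one_le_or_tp hx with hx | hx
    · exact ih hx
    · exact Or.inr ⟨t, hf.1, hx⟩

theorem eq_entry (h : N.IsSingleEntryExit s e parts p q)
    (hp : N.Reachable (single s) (single (p i)))
    (hm : (N.coreCG (parts i)).Reachable (single (p i)) m) (hx : 1 ≤ m (p i)) :
    m = single (p i) := by
  have hX := single_add_sub hx
  have := h.eq_zero_of_pump hp (X := m - single (p i)) (hX.symm ▸ hm.of_coreCG)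
  rw [← hX]
  funext x
  simp only [Pi.add_apply, this x, add_zero]

/-- Once a part that was started by one token marks its exit place, none of its other places is
marked. Otherwise let `X ≠ 0` be the marking of these other places. The token in the exit place
starts some other part, and the tokens `Y` descending from it never meet those descending from `X`:
for this they would have to reach the entry place of the part again, which then could produce a
second copy of `X`. So tokens descending from `X` remain inside the part forever, and the marking
with one token in the sink is out of reach. -/
theorem eq_exit (h : N.IsSingleEntryExit s e parts p q)
    (hp : N.Reachable (single s) (single (p i)))
    (hm : (N.coreCG (parts i)).Reachable (single (p i)) m) (hq : 1 ≤ m (q i)) :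
    m = single (q i) := by
  by_contra hne
  have hmN := hp.trans hm.of_coreCG
  have no_entry : ∀ {X' : Marking Pl}, single (q i) + X' = single (p i) → p i = q i := by
    intro X' he
    have : 1 ≤ single (p i) (q i) := by rw [← he, Pi.add_apply, single_self]; omega
    exact (eq_of_one_le_single this).symm
  have hpq : p i ≠ q i := by
    intro hpq
    rw [← hpq] at hq hne
    exact hne (h.eq_entry hp hm hq)
  have hqe : q i ≠ e := by
    intro hqe
    rw [hqe] at hq hne
    exact hne (h.proper m hmN hq)
  obtain ⟨-, ⟨v, hvi, hv⟩, hsink | ⟨t', ⟨ht'T, ht'i⟩, ht'⟩⟩ := h.exit_mem_Post i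
  · exact hqe (hsink.unique h.sink)
  obtain ⟨j, hj⟩ := h.cover t' ht'T
  have hij : i ≠ j := by
    rintro rfl
    exact ht'i hj
  have hpj : q i = p j := (h.exit_and_entry hv hvi ht' hj hij).2
  obtain ⟨t, htj, ht⟩ := h.exists_starter j
  obtain ⟨X, rfl⟩ : ∃ X, m = single (q i) + X := ⟨_, (single_add_sub hq).symm⟩
  obtain ⟨x₀, hx₀⟩ := exists_one_le_of_ne_single hne
  obtain ⟨Y₀, hY₀⟩ : ∃ Y₀, N.Fires (single (q i)) t Y₀ := by
    refine Enabled.exists_fires ⟨h.subset j htj, fun x hx => ?_⟩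
    rw [ht x hx, hpj, single_self]
  have hpt : N.pt (q i) t := by
    obtain ⟨x, hx⟩ := h.exists_pt (h.subset j htj)
    rwa [hpj, ← ht x hx]
  obtain ⟨ρ, hρ⟩ := h.complete _ (hmN.fires (hY₀.add X))
  have inv : ∃ X' Y', single e = Y' + X' ∧
      (N.coreCG (parts i)).Reachable (single (p i)) (single (q i) + X') ∧ (∃ x, 1 ≤ X' x) ∧
      N.Reachable (single (q i)) Y' ∧
      ∀ x, 1 ≤ Y' x → ∃ k, k ≠ i ∧ ∃ u ∈ parts k, N.tp u x := by
    refine Run.induction_snoc (motive := fun _ M => ∃ X' Y', M = Y' + X' ∧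
      (N.coreCG (parts i)).Reachable (single (p i)) (single (q i) + X') ∧ (∃ x, 1 ≤ X' x) ∧
      N.Reachable (single (q i)) Y' ∧
      ∀ x, 1 ≤ Y' x → ∃ k, k ≠ i ∧ ∃ u ∈ parts k, N.tp u x) ?_ ?_ hρ
    · refine ⟨X, Y₀, rfl, hm, ⟨x₀, hx₀⟩, (Reachable.refl _).fires hY₀, fun x hx => ?_⟩
      refine ⟨j, hij.symm, t, htj, ?_⟩
      rcases hY₀.one_le_or_tp hx with h1 | h1
      · obtain rfl := eq_of_one_le_single h1
        by_contra hc
        have h2 := ((fires_iff.1 hY₀).2 (q i)).2.1 hpt hc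
        rw [single_self] at h2
        omega
      · exact h1
    · rintro σ u _ M'' - ⟨X', Y', rfl, hX', ⟨x₁, hx₁⟩, hY', hYs⟩ hf
      have hXp : X' (p i) = 0 := by
        by_contra hc
        exact hpq (no_entry (h.eq_entry hp hX' (by simp only [Pi.add_apply]; omega)))
      by_cases hui : u ∈ parts i
      · have hYu : ∀ x, N.pt x u → Y' x = 0 := by
          intro x hx
          by_contra hc
          obtain ⟨k, hk, v, hv, hvx⟩ := hYs x (by omega)
          obtain rfl := (h.exit_and_entry hvx hv hx hui hk).2
          obtain ⟨Z, rfl⟩ : ∃ Z, Y' = single (p i) + Z :=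
            ⟨_, (single_add_sub (Nat.one_le_iff_ne_zero.2 hc)).symm⟩
          -- The part is started again beside `X`, and a second copy of `X` arises.
          have h1 := ((hmN.trans (hY'.add X)).trans ((hm.of_coreCG.add Z).add X))
          have h2 := h.safe _ h1 x₀
          simp only [Pi.add_apply] at h2
          omega
        have hen : N.Enabled X' u := by
          refine ⟨hf.1.1, fun x hx => ?_⟩
          have h1 := hf.1.2 x hx
          simp only [Pi.add_apply, hYu x hx] at h1
          omega
        rw [add_comm] at hf
        obtain ⟨X'', hX'', rfl⟩ := hf.of_add hen
        refine ⟨X'', Y', add_comm _ _, hX'.fires (t := u) ?_, h.exists_one_le_of_fires hX'', hY', hYs⟩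
        rw [add_comm _ X', add_comm _ X'']
        exact fires_coreCG_iff.2 ⟨hui, hX''.add _⟩
      · obtain ⟨k, hk⟩ := h.cover u hf.1.1
        have hik : i ≠ k := by
          rintro rfl
          exact hui hk
        have hen : N.Enabled Y' u := by
          refine ⟨hf.1.1, fun x hx => ?_⟩
          have h1 := hf.1.2 x hx
          have h2 : X' x = 0 := by
            by_contra hc
            obtain ⟨σ', hσ'⟩ := hX'
            rcases eq_entry_or_tp (x := x) hσ' (by simp only [Pi.add_apply]; omega) with
              rfl | ⟨v, hv, hvx⟩
            · exact hc hXp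
            · obtain rfl := (h.exit_and_entry hvx hv hx hk hik).1
              have h3 := h.safe _ (hp.trans hσ'.of_coreCG.reachable) (q i)
              simp only [Pi.add_apply, single_self] at h3
              omega
          simp only [Pi.add_apply] at h1
          omega
        obtain ⟨Y'', hY'', rfl⟩ := hf.of_add hen
        refine ⟨X', Y'', rfl, hX', ⟨x₁, hx₁⟩, hY'.fires hY'', fun x hx => ?_⟩
        rcases hY''.one_le_or_tp hx with h1 | h1
        · exact hYs x h1
        · exact ⟨k, hik.symm, u, hk, h1⟩
  obtain ⟨X', Y', he, ⟨σ, hσ⟩, ⟨x, hx⟩, -, -⟩ := inv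
  have hxe : x = e := by
    refine eq_of_one_le_single ?_
    rw [he, Pi.add_apply]
    omega
  subst hxe
  rcases eq_entry_or_tp (x := x) hσ (by simp only [Pi.add_apply]; omega) with h1 | ⟨v, hv, hvx⟩
  · obtain ⟨-, ⟨v, -, hv⟩, -⟩ := h.entry_mem_Pre i
    rw [← h1] at hv
    exact h.sink.not_pt v hv
  · exact hqe (h.exit_eq_sink hvx hv).symm

theorem exists_tp_of_run (h : N.IsSingleEntryExit s e parts p q)
    (hp : N.Reachable (single s) (single (p i)))
    (hr : (N.coreCG (parts i)).Run (single (p i)) α m) (hα : α ≠ []) (hx : 1 ≤ m x) :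
    ∃ u ∈ parts i, N.tp u x := by
  rcases eq_entry_or_tp hr hx with rfl | h1
  · have hm := h.eq_entry hp hr.reachable hx
    obtain ⟨α', u, rfl⟩ := List.eq_nil_or_concat α |>.resolve_left hα
    rw [List.concat_eq_append] at hr
    obtain ⟨M', -, hf⟩ := hr.of_snoc
    rw [fires_coreCG_iff] at hf
    obtain ⟨y, hy⟩ := h.exists_tp hf.2.1.1
    have hy1 := hf.2.one_le_of_tp hy
    rw [hm] at hy1
    exact ⟨u, hf.1, eq_of_one_le_single hy1 ▸ hy⟩
  · exact h1

/-- While a part is running, another part can start only if the first one has ended. -/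
theorem eq_exit_of_enabled (h : N.IsSingleEntryExit s e parts p q)
    (hp : N.Reachable (single s) (single (p i)))
    (hr : (N.coreCG (parts i)).Run (single (p i)) α m) (hα : α ≠ [])
    (ht : t ∈ parts j) (hij : i ≠ j) (hen : N.Enabled m t) :
    m = single (q i) ∧ p j = q i := by
  obtain ⟨x, hx⟩ := h.exists_pt hen.1
  have hmx := hen.2 x hx
  obtain ⟨u, hu, hux⟩ := h.exists_tp_of_run hp hr hα hmx
  obtain ⟨h1, h2⟩ := h.exit_and_entry hux hu hx ht hij
  rw [h1] at hmx
  exact ⟨h.eq_exit hp hr.reachable hmx, h2.symm.trans h1⟩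

theorem eq_entry_of_enabled_source (h : N.IsSingleEntryExit s e parts p q) (ht : t ∈ parts j)
    (hen : N.Enabled (single s) t) : s = p j := by
  obtain ⟨x, hx⟩ := h.exists_pt hen.1
  obtain rfl := eq_of_one_le_single (hen.2 x hx)
  exact h.entry_eq_source hx ht

/-- In every reachable marking but the initial one, exactly one part is running. -/
theorem exists_running (h : N.IsSingleEntryExit s e parts p q) (hM : N.Reachable (single s) M) :
    M = single s ∨ ∃ i α, α ≠ [] ∧ N.Reachable (single s) (single (p i)) ∧
      (N.coreCG (parts i)).Run (single (p i)) α M := by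
  obtain ⟨σ, hr⟩ := hM
  refine Run.induction_snoc (motive := fun _ M => M = single s ∨ ∃ i α, α ≠ [] ∧
    N.Reachable (single s) (single (p i)) ∧ (N.coreCG (parts i)).Run (single (p i)) α M)
    (Or.inl rfl) ?_ hr
  intro σ t M M' hr ih hf
  obtain ⟨j, hj⟩ := h.cover t hf.1.1
  right
  rcases ih with rfl | ⟨i, α, hα, hp, hi⟩
  · have := h.eq_entry_of_enabled_source hj hf.1
    refine ⟨j, [t], by simp, this ▸ .refl _, ?_⟩
    rw [← this]
    exact .cons (fires_coreCG_iff.2 ⟨hj, hf⟩) (.nil _)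
  · by_cases hij : i = j
    · subst hij
      exact ⟨i, α ++ [t], by simp, hp, hi.snoc (fires_coreCG_iff.2 ⟨hj, hf⟩)⟩
    · obtain ⟨rfl, h2⟩ := h.eq_exit_of_enabled hp hi hα hj hij hf.1
      refine ⟨j, [t], by simp, h2.symm ▸ hr.reachable, ?_⟩
      rw [h2]
      exact .cons (fires_coreCG_iff.2 ⟨hj, hf⟩) (.nil _)

theorem reachable_of_enabled (h : N.IsSingleEntryExit s e parts p q)
    (hM : N.Reachable (single s) M) (hj : t ∈ parts j) (hen : N.Enabled M t) :
    N.Reachable (single s) (single (p j)) ∧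
      (N.coreCG (parts j)).Reachable (single (p j)) M := by
  rcases h.exists_running hM with rfl | ⟨i, α, hα, hp, hi⟩
  · have := h.eq_entry_of_enabled_source hj hen
    rw [← this]
    exact ⟨.refl _, .refl _⟩
  · by_cases hij : i = j
    · subst hij
      exact ⟨hp, hi.reachable⟩
    · obtain ⟨rfl, h2⟩ := h.eq_exit_of_enabled hp hi hα hj hij hen
      rw [h2]
      exact ⟨hM, .refl _⟩

theorem reachable_entry (h : N.IsSingleEntryExit s e parts p q) (i : Fin n) :
    N.Reachable (single s) (single (p i)) := by
  obtain ⟨t, ht⟩ := h.nonempty i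
  obtain ⟨M, hM, hen⟩ := h.live t (h.subset i ht)
  exact (h.reachable_of_enabled hM ht hen).1

theorem reachable_exit_of_run (h : N.IsSingleEntryExit s e parts p q) {ρ : List Tr}
    (hr : (N.coreCG (parts i)).Run (single (p i)) α m) (hα : α ≠ [])
    (hρ : N.Run m ρ (single e)) : (N.coreCG (parts i)).Reachable m (single (q i)) := by
  have hp := h.reachable_entry i
  induction ρ generalizing α m with
  | nil =>
    obtain rfl := hρ.eq_of_nil
    obtain ⟨u, hu, hue⟩ := h.exists_tp_of_run hp hr hα (x := e) (by rw [single_self])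
    rw [h.exit_eq_sink hue hu]
    exact .refl _
  | cons t ρ ih =>
    cases hρ with
    | cons hf hρ =>
      obtain ⟨j, hj⟩ := h.cover t hf.1.1
      by_cases hij : i = j
      · subst hij
        have hf' := fires_coreCG_iff.2 ⟨hj, hf⟩
        exact Reachable.trans ⟨[t], .cons hf' (.nil _)⟩ (ih (hr.snoc hf') (by simp) hρ)
      · obtain ⟨rfl, -⟩ := h.eq_exit_of_enabled hp hr hα hj hij hf.1
        exact .refl _

/-- The projections of a sound net on the parts of a concurrency-hiding partition are sound. -/
theorem isWorkflow_coreCG (h : N.IsSingleEntryExit s e parts p q) (i : Fin n) :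
    (N.coreCG (parts i)).IsWorkflow (p i) (q i) := by
  have hp := h.reachable_entry i
  have mem : ∀ x, (∃ t ∈ parts i, N.pt x t ∨ N.tp t x) → x ∈ N.projP (parts i) := by
    rintro x ⟨t, ht, hx | hx⟩
    · exact ⟨(N.pt_mem x t hx).1, t, Or.inr hx, ht⟩
    · exact ⟨(N.tp_mem t x hx).2, t, Or.inl hx, ht⟩
  obtain ⟨h1, h2⟩ := h.paths_quotient (C := N.coreCG (parts i)) (S := parts i) (g := id)
    (ps := p i) (pe := q i) h.source h.sink
    (fun x t ht hx => .pt _ _ ⟨mem x ⟨t, ht, Or.inl hx⟩, ⟨h.subset i ht, ht⟩, hx⟩)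
    (fun x t ht hx => .tp _ _ ⟨mem x ⟨t, ht, Or.inr hx⟩, ⟨h.subset i ht, ht⟩, hx⟩)
    (fun x hx => by rwa [h.pre_eq] at hx) (fun x hx => by rwa [h.post_eq] at hx)
  refine ⟨?_, ?_, ?_, ?_, ?_, ?_, ?_, ?_⟩
  · obtain ⟨-, ⟨t, ht, htx⟩, -⟩ := h.entry_mem_Pre i
    exact mem _ ⟨t, ht, Or.inl htx⟩
  · obtain ⟨-, ⟨t, ht, htx⟩, -⟩ := h.exit_mem_Post i
    exact mem _ ⟨t, ht, Or.inr htx⟩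
  · rintro x ⟨-, t, htx, ht⟩
    exact h2 x ⟨t, ht, htx.symm⟩
  · exact fun t ht => h1 t ht.2 ht.1
  · exact fun M hM => h.safe M (hp.trans hM.of_coreCG)
  · rintro t ⟨htT, ht⟩
    obtain ⟨M, hM, hen⟩ := h.live t htT
    exact ⟨M, (h.reachable_of_enabled hM ht hen).2, ⟨htT, ht⟩, fun x hx => hen.2 x hx.2.2⟩
  · rintro M ⟨α, hM⟩
    by_cases hα : α = []
    · subst hα
      obtain rfl := hM.eq_of_nil
      obtain ⟨t, ht, htx⟩ := h.exists_starter i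
      obtain ⟨M', hf⟩ : ∃ M', N.Fires (single (p i)) t M' :=
        Enabled.exists_fires ⟨h.subset i ht, fun x hx => by rw [htx x hx, single_self]⟩
      have hr := (Run.nil (N := N.coreCG (parts i)) _).snoc (fires_coreCG_iff.2 ⟨ht, hf⟩)
      obtain ⟨ρ, hρ⟩ := h.complete M' (hp.trans hr.of_coreCG.reachable)
      exact hr.reachable.trans (h.reachable_exit_of_run hr (by simp) hρ)
    · obtain ⟨ρ, hρ⟩ := h.complete M (hp.trans hM.of_coreCG.reachable)
      exact h.reachable_exit_of_run hM hα hρ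
  · exact fun M hM hq => h.eq_exit hp hM hq

theorem exists_path_of_run (h : N.IsSingleEntryExit s e parts p q) (lab : Tr → Option A)
    {ρ : List Tr} (hr : (N.coreCG (parts i)).Run (single (p i)) α m) (hα : α ≠ [])
    (hρ : N.Run m ρ (single e)) :
    ∃ l : List (Fin n), List.IsChain (N.ExecFlow parts)
      (CGNode.node i :: (l.map CGNode.node ++ [CGNode.finish])) ∧
      (α ++ ρ).filterMap lab ∈
        ((i :: l).map fun k => (N.coreCG (parts k)).langBetween lab (p k) (q k)).prod := by
  induction ρ generalizing α m i with
  | nil =>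
    obtain rfl := hρ.eq_of_nil
    obtain ⟨u, hu, hue⟩ :=
      h.exists_tp_of_run (h.reachable_entry i) hr hα (x := e) (by rw [single_self])
    refine ⟨[], ?_, ?_⟩
    · simpa using ExecFlow.leave i e h.sink (h.sink.mem_Post hue hu)
    · rw [h.exit_eq_sink hue hu] at hr
      simpa using ⟨α, hr, rfl⟩
  | cons t ρ ih =>
    cases hρ with
    | cons hf hρ =>
      obtain ⟨j, hj⟩ := h.cover t hf.1.1
      by_cases hij : i = j
      · subst hij
        have := ih (hr.snoc (fires_coreCG_iff.2 ⟨hj, hf⟩)) (by simp) hρ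
        simpa using this
      · obtain ⟨rfl, h2⟩ := h.eq_exit_of_enabled (h.reachable_entry i) hr hα hj hij hf.1
        rw [← h2] at hf
        obtain ⟨l, hl, hw⟩ := ih ((Run.nil _).snoc (fires_coreCG_iff.2 ⟨hj, hf⟩)) (by simp) hρ
        refine ⟨j :: l, ?_, ?_⟩
        · refine List.isChain_cons_cons.2 ⟨.inner i j ⟨q i, h.exit_mem_Post i, ?_⟩, hl⟩
          rw [← h2]
          exact h.entry_mem_Pre j
        · rw [List.filterMap_append, List.map_cons, List.prod_cons]
          exact Language.append_mem_mul ⟨α, hr, rfl⟩ hw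

theorem exists_run_of_path (h : N.IsSingleEntryExit s e parts p q) (lab : Tr → Option A)
    {l : List (Fin n)} {w : List A} (hl : List.IsChain (N.ExecFlow parts)
      (CGNode.node i :: (l.map CGNode.node ++ [CGNode.finish])))
    (hw : w ∈ ((i :: l).map fun k => (N.coreCG (parts k)).langBetween lab (p k) (q k)).prod) :
    ∃ ρ, N.Run (single (p i)) ρ (single e) ∧ w = ρ.filterMap lab := by
  induction l generalizing i w with
  | nil =>
    have hE : N.ExecFlow parts (CGNode.node i) CGNode.finish := by simpa using hl
    have hw : w ∈ (N.coreCG (parts i)).langBetween lab (p i) (q i) := by simpa using hw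
    obtain ⟨ρ, hρ, rfl⟩ := hw
    cases hE with
    | leave _ e' he' hm =>
      obtain rfl := h.sink.unique he'
      rw [h.post_eq] at hm
      rw [← Set.mem_singleton_iff.1 hm] at hρ
      exact ⟨ρ, hρ.of_coreCG, rfl⟩
  | cons j l ih =>
    obtain ⟨hE, hl⟩ := List.isChain_cons_cons.1 hl
    rw [List.map_cons, List.prod_cons] at hw
    obtain ⟨_, ⟨ρ₁, hρ₁, rfl⟩, w₂, hw₂, rfl⟩ := Language.mem_mul.1 hw
    obtain ⟨ρ₂, hρ₂, rfl⟩ := ih hl hw₂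
    cases hE with
    | inner _ _ hm =>
      obtain ⟨x, hx1, hx2⟩ := hm
      rw [h.post_eq] at hx1
      rw [h.pre_eq] at hx2
      rw [← Set.mem_singleton_iff.1 hx2, Set.mem_singleton_iff.1 hx1] at hρ₂
      exact ⟨ρ₁ ++ ρ₂, hρ₁.of_coreCG.append hρ₂, by simp⟩

theorem langBetween_eq (h : N.IsSingleEntryExit s e parts p q) (lab : Tr → Option A)
    (hT : N.T.Nonempty) : N.langBetween lab s e = {w | ∃ l ∈ cgPaths (N.ExecFlow parts),
      w ∈ (l.map fun k => (N.coreCG (parts k)).langBetween lab (p k) (q k)).prod} := by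
  ext w
  constructor
  · rintro ⟨ρ, hρ, rfl⟩
    cases ρ with
    | nil =>
      have hse : 1 ≤ single e s := by rw [← hρ.eq_of_nil, single_self]
      exact absurd (eq_of_one_le_single hse) (h.source.ne_sink h.toIsWorkflow hT)
    | cons t ρ =>
      cases hρ with
      | cons hf hρ =>
        obtain ⟨j, hj⟩ := h.cover t hf.1.1
        have hsj := h.eq_entry_of_enabled_source hj hf.1
        rw [hsj] at hf
        obtain ⟨l, hl, hw⟩ := h.exists_path_of_run lab
          ((Run.nil _).snoc (fires_coreCG_iff.2 ⟨hj, hf⟩)) (by simp) hρ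
        refine ⟨j :: l, ?_, hw⟩
        exact List.isChain_cons_cons.2
          ⟨.enter j s h.source (hsj ▸ h.entry_mem_Pre j), hl⟩
  · rintro ⟨l, hl, hw⟩
    cases l with
    | nil =>
      have : N.ExecFlow parts CGNode.start CGNode.finish := by simpa [cgPaths] using hl
      cases this
    | cons i l =>
      obtain ⟨hE, hl⟩ := List.isChain_cons_cons.1 hl
      obtain ⟨ρ, hρ, rfl⟩ := h.exists_run_of_path lab hl hw
      cases hE with
      | enter _ s' hs' hm =>
        obtain rfl := h.source.unique hs'
        rw [h.pre_eq] at hm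
        rw [← Set.mem_singleton_iff.1 hm] at hρ
        exact ⟨ρ, hρ, rfl⟩

theorem exists_edge_to (h : N.IsSingleEntryExit s e parts p q) (j : Fin n) :
    ∃ y, N.ExecFlow parts y (CGNode.node j) := by
  obtain ⟨-, ⟨u, hu, hxu⟩, hs | ⟨t, ⟨htT, htj⟩, ht⟩⟩ := h.entry_mem_Pre j
  · exact ⟨_, .enter j _ hs (h.entry_mem_Pre j)⟩
  · obtain ⟨i, hi⟩ := h.cover t htT
    have hij : i ≠ j := by
      rintro rfl
      exact htj hi
    exact ⟨_, .inner i j ⟨_, h.mem_Pre_and_mem_Post ht hi hxu hu hij⟩⟩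

theorem exists_edge_from (h : N.IsSingleEntryExit s e parts p q) (i : Fin n) :
    ∃ y, N.ExecFlow parts (CGNode.node i) y := by
  obtain ⟨-, ⟨t, ht, htx⟩, he | ⟨u, ⟨huT, hui⟩, hu⟩⟩ := h.exit_mem_Post i
  · exact ⟨_, .leave i _ he (h.exit_mem_Post i)⟩
  · obtain ⟨j, hj⟩ := h.cover u huT
    have hij : i ≠ j := by
      rintro rfl
      exact hui hj
    exact ⟨_, .inner i j ⟨_, h.mem_Pre_and_mem_Post htx ht hu hj hij⟩⟩

theorem reflTransGen_start (h : N.IsSingleEntryExit s e parts p q) (i : Fin n) :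
    Relation.ReflTransGen (N.ExecFlow parts) CGNode.start (CGNode.node i) := by
  have key : ∀ y, Relation.ReflTransGen N.Flow (Sum.inl s) y →
      (∀ t, y = Sum.inr t → ∀ k, t ∈ parts k →
        Relation.ReflTransGen (N.ExecFlow parts) CGNode.start (CGNode.node k)) ∧
      (∀ x, y = Sum.inl x → ∀ t, N.pt x t → ∀ k, t ∈ parts k →
        Relation.ReflTransGen (N.ExecFlow parts) CGNode.start (CGNode.node k)) := by
    intro y hy
    induction hy with
    | refl =>
      refine ⟨by simp, fun x hx t ht k hk => ?_⟩
      obtain rfl := Sum.inl_injective hx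
      exact .single (.enter k s h.source (h.source.mem_Pre ht hk))
    | tail _ hf ih =>
      cases hf with
      | pt x t hxt =>
        refine ⟨fun u hu k hk => ?_, by simp⟩
        obtain rfl := Sum.inr_injective hu
        exact ih.2 x rfl t hxt k hk
      | tp t x htx =>
        refine ⟨by simp, fun x' hx u hu k hk => ?_⟩
        obtain rfl := Sum.inl_injective hx
        obtain ⟨l, hl⟩ := h.cover t (N.tp_mem t x htx).1
        have := ih.1 t rfl l hl
        by_cases hlk : l = k
        · exact hlk ▸ this
        · exact this.tail (.inner l k ⟨x, h.mem_Pre_and_mem_Post htx hl hu hk hlk⟩)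
  obtain ⟨t, ht⟩ := h.nonempty i
  exact (key _ (h.path_trans t (h.subset i ht)).1).1 t rfl i ht

theorem reflTransGen_finish (h : N.IsSingleEntryExit s e parts p q) (i : Fin n) :
    Relation.ReflTransGen (N.ExecFlow parts) (CGNode.node i) CGNode.finish := by
  have key : ∀ y, Relation.ReflTransGen N.Flow y (Sum.inl e) →
      (∀ t, y = Sum.inr t → ∀ k, t ∈ parts k →
        Relation.ReflTransGen (N.ExecFlow parts) (CGNode.node k) CGNode.finish) ∧
      (∀ x, y = Sum.inl x → ∀ t, N.tp t x → ∀ k, t ∈ parts k →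
        Relation.ReflTransGen (N.ExecFlow parts) (CGNode.node k) CGNode.finish) := by
    intro y hy
    induction hy using Relation.ReflTransGen.head_induction_on with
    | refl =>
      refine ⟨by simp, fun x hx t ht k hk => ?_⟩
      obtain rfl := Sum.inl_injective hx
      exact .single (.leave k e h.sink (h.sink.mem_Post ht hk))
    | head hf _ ih =>
      cases hf with
      | tp t x htx =>
        refine ⟨fun u hu k hk => ?_, by simp⟩
        obtain rfl := Sum.inr_injective hu
        exact ih.2 x rfl t htx k hk
      | pt x t hxt =>
        refine ⟨by simp, fun x' hx u hu k hk => ?_⟩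
        obtain rfl := Sum.inl_injective hx
        obtain ⟨l, hl⟩ := h.cover t (N.pt_mem x t hxt).2
        have := ih.1 t rfl l hl
        by_cases hlk : l = k
        · exact hlk ▸ this
        · exact this.head (.inner k l ⟨x, h.mem_Pre_and_mem_Post hu hk hxt hl (Ne.symm hlk)⟩)
  obtain ⟨t, ht⟩ := h.nonempty i
  exact (key _ (h.path_trans t (h.subset i ht)).2).1 t rfl i ht

theorem isChoiceGraph (h : N.IsSingleEntryExit s e parts p q) (hn : 0 < n) :
    IsChoiceGraph (N.ExecFlow parts) := by
  have i₀ : Fin n := ⟨0, hn⟩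
  have hsf := (h.reflTransGen_start i₀).trans (h.reflTransGen_finish i₀)
  refine ⟨?_, ?_, ?_⟩
  · ext x
    constructor
    · intro hx
      rcases x with _ | _ | j
      · rfl
      · rcases Relation.ReflTransGen.cases_tail hsf with h1 | ⟨y, -, h1⟩
        · cases h1
        · exact absurd h1 (hx y)
      · obtain ⟨y, hy⟩ := h.exists_edge_to j
        exact absurd hy (hx y)
    · rintro rfl y hy
      cases hy
  · ext x
    constructor
    · intro hx
      rcases x with _ | _ | j
      · rcases Relation.ReflTransGen.cases_head hsf with h1 | ⟨y, h1, -⟩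
        · cases h1
        · exact absurd h1 (hx y)
      · rfl
      · obtain ⟨y, hy⟩ := h.exists_edge_from j
        exact absurd hy (hx y)
    · rintro rfl y hy
      cases hy
  · rintro (_ | _ | j)
    · exact ⟨.refl, hsf⟩
    · exact ⟨hsf, .refl⟩
    · exact ⟨h.reflTransGen_start j, h.reflTransGen_finish j⟩

end IsSingleEntryExit

/-! ### Conflict-hiding partitions -/

/-- A workflow net with a conflict-hiding partition of its transitions, and fresh places `ps i`,
`pe i` for the projections on its parts. -/
structure IsConflictHidingFamily (N : PetriNet Pl Tr) (s e : Pl) (parts : Fin n → Set Tr)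
    (ps pe : Fin n → Pl) : Prop extends N.IsWorkflow s e, N.IsPartFamily parts where
  source : N.IsSource s
  sink : N.IsSink e
  pre_unique : ∀ {i j x}, x ∈ N.Pre (parts i) → x ∈ N.Pre (parts j) → i = j
  post_unique : ∀ {i j x}, x ∈ N.Post (parts i) → x ∈ N.Post (parts j) → i = j
  entry_equiv : ∀ {i x y}, x ∈ N.Pre (parts i) → y ∈ N.Pre (parts i) →
    N.PlaceEquiv (parts i) x y
  exit_equiv : ∀ {i x y}, x ∈ N.Post (parts i) → y ∈ N.Post (parts i) →
    N.PlaceEquiv (parts i) x y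
  ps_notMem : ∀ i, ps i ∉ N.P
  pe_notMem : ∀ i, pe i ∉ N.P
  ps_ne_pe : ∀ i, ps i ≠ pe i

theorem PlaceEquiv.pt_iff {S : Set Tr} {x y : Pl} {t : Tr} (h : N.PlaceEquiv S x y) (ht : t ∈ S) :
    N.pt x t ↔ N.pt y t :=
  ⟨fun hx => (h.2.subset ⟨hx, ht⟩).1, fun hy => (h.2.superset ⟨hy, ht⟩).1⟩

theorem PlaceEquiv.tp_iff {S : Set Tr} {x y : Pl} {t : Tr} (h : N.PlaceEquiv S x y) (ht : t ∈ S) :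
    N.tp t x ↔ N.tp t y :=
  ⟨fun hx => (h.1.subset ⟨hx, ht⟩).1, fun hy => (h.1.superset ⟨hy, ht⟩).1⟩

open Classical in
/-- The place of the partial order projection on `S` that represents the place `x` of `N`. -/
noncomputable def collapse (N : PetriNet Pl Tr) (S : Set Tr) (ps pe x : Pl) : Pl :=
  if x ∈ N.Pre S then ps else if x ∈ N.Post S then pe else x

open Classical in
/-- The marking of `N` that corresponds to a marking of the partial order projection on `S`: the
tokens of `ps` and `pe` are put into all entry places and all exit places, respectively. -/
noncomputable def embed (N : PetriNet Pl Tr) (S : Set Tr) (ps pe : Pl) (m : Marking Pl) :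
    Marking Pl :=
  fun x => if x ∈ N.projP S then m (N.collapse S ps pe x) else 0

/-- The place `x` belongs to the interior of `S`. -/
def IsInner (N : PetriNet Pl Tr) (S : Set Tr) (x : Pl) : Prop :=
  x ∈ N.projP S \ (N.Pre S ∪ N.Post S)

/-- The marking `M` of `N` is composed of the markings `m i` of the projections. A place between
two parts is marked if the first one has delivered its token and the second one has not yet
consumed it, which gives the equation in `between`. -/
structure Glue (N : PetriNet Pl Tr) (s e : Pl) (parts : Fin n → Set Tr) (ps pe : Fin n → Pl)
    (M : Marking Pl) (m : Fin n → Marking Pl) : Prop where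
  inner : ∀ {i x}, N.IsInner (parts i) x → M x = m i x
  between : ∀ {i j x}, x ∈ N.Post (parts i) → x ∈ N.Pre (parts j) →
    M x + 1 = m i (pe i) + m j (ps j)
  source : ∀ {i}, s ∈ N.Pre (parts i) → M s = m i (ps i)
  sink : ∀ {i}, e ∈ N.Post (parts i) → M e = m i (pe i)
  outside : ∀ {x}, x ∉ N.P → M x = 0

section

variable {S : Set Tr} {ps pe x : Pl} {t : Tr}

theorem mem_projP_of_pt (h : N.pt x t) (ht : t ∈ S) : x ∈ N.projP S :=
  ⟨(N.pt_mem x t h).1, t, Or.inr h, ht⟩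

theorem mem_projP_of_tp (h : N.tp t x) (ht : t ∈ S) : x ∈ N.projP S :=
  ⟨(N.tp_mem t x h).2, t, Or.inl h, ht⟩

theorem mem_projP_of_mem_Pre (hx : x ∈ N.Pre S) : x ∈ N.projP S := by
  obtain ⟨-, ⟨t, ht, hxt⟩, -⟩ := hx
  exact mem_projP_of_pt hxt ht

theorem mem_projP_of_mem_Post (hx : x ∈ N.Post S) : x ∈ N.projP S := by
  obtain ⟨-, ⟨t, ht, hxt⟩, -⟩ := hx
  exact mem_projP_of_tp hxt ht

theorem collapse_of_mem_Pre (hx : x ∈ N.Pre S) : N.collapse S ps pe x = ps := if_pos hx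

theorem collapse_of_mem_Post (hx : x ∈ N.Post S) (hx' : x ∉ N.Pre S) :
    N.collapse S ps pe x = pe := by
  rw [collapse, if_neg hx', if_pos hx]

theorem collapse_of_isInner (hx : N.IsInner S x) : N.collapse S ps pe x = x := by
  rw [collapse, if_neg fun h => hx.2 (Or.inl h), if_neg fun h => hx.2 (Or.inr h)]

theorem embed_of_mem {m : Marking Pl} (hx : x ∈ N.projP S) :
    N.embed S ps pe m x = m (N.collapse S ps pe x) := if_pos hx

theorem embed_of_notMem {m : Marking Pl} (hx : x ∉ N.projP S) :
    N.embed S ps pe m x = 0 := if_neg hx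

theorem embed_add (m m' : Marking Pl) :
    N.embed S ps pe (m + m') = N.embed S ps pe m + N.embed S ps pe m' := by
  funext x
  by_cases hx : x ∈ N.projP S
  · simp only [Pi.add_apply, embed_of_mem hx]
  · simp only [Pi.add_apply, embed_of_notMem hx]

theorem Fires.add_eq_add {M M' m m' : Marking Pl} {y : Pl} (h : N.Fires M t M')
    (h' : C.Fires m t m') (hpt : C.pt y t ↔ N.pt x t) (htp : C.tp t y ↔ N.tp t x) :
    M' x + m y = M x + m' y := by
  have h1 := (fires_iff.1 h).2 x
  have h2 := (fires_iff.1 h').2 y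
  rw [hpt, htp] at h2
  by_cases hp : N.pt x t <;> by_cases ht : N.tp t x
  · have := h1.1 hp ht
    have := h2.1 hp ht
    omega
  · have := h1.2.1 hp ht
    have := h2.2.1 hp ht
    omega
  · have := h1.2.2.1 hp ht
    have := h2.2.2.1 hp ht
    omega
  · have := h1.2.2.2 hp ht
    have := h2.2.2.2 hp ht
    omega

/-- A nonempty set of transitions of a workflow net has an exit place. -/
theorem IsWorkflow.exists_mem_Post {s e : Pl} (hw : N.IsWorkflow s e) (he : N.IsSink e)
    (ht : t ∈ S) (htT : t ∈ N.T) : ∃ x, x ∈ N.Post S := by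
  have key : ∀ y, Relation.ReflTransGen N.Flow y (Sum.inl e) →
      (∀ t ∈ S, y = Sum.inr t → ∃ x, x ∈ N.Post S) ∧
      (∀ x, ∀ t ∈ S, N.tp t x → y = Sum.inl x → ∃ x, x ∈ N.Post S) := by
    intro y hy
    induction hy using Relation.ReflTransGen.head_induction_on with
    | refl =>
      refine ⟨by simp, fun x t ht htx hx => ?_⟩
      obtain rfl := Sum.inl_injective hx
      exact ⟨_, he.mem_Post htx ht⟩
    | head hf _ ih =>
      cases hf with
      | tp t x htx =>
        refine ⟨fun u hu he => ?_, by simp⟩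
        obtain rfl := Sum.inr_injective he
        exact ih.2 x t hu htx rfl
      | pt x t hxt =>
        refine ⟨by simp, fun x' u hu hux he => ?_⟩
        obtain rfl := Sum.inl_injective he
        by_cases htS : t ∈ S
        · exact ih.1 t htS rfl
        · exact ⟨x, mem_Post_of_pt hux hu hxt htS⟩
  exact (key _ (hw.path_trans t htT).2).1 t ht rfl

end

namespace IsConflictHidingFamily

variable {s e : Pl} {parts : Fin n → Set Tr} {ps pe : Fin n → Pl} {i j k : Fin n}
  {t u : Tr} {x : Pl} {M M' m' : Marking Pl} {m : Fin n → Marking Pl}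

theorem notMem_Post_of_mem_Pre (h : N.IsConflictHidingFamily s e parts ps pe)
    (hx : x ∈ N.Pre (parts i)) : x ∉ N.Post (parts i) := by
  rintro hx'
  obtain ⟨-, ⟨u, hu, hxu⟩, hs | ⟨t, ⟨htT, hti⟩, ht⟩⟩ := hx
  · obtain ⟨-, ⟨v, -, hv⟩, -⟩ := hx'
    exact hs.not_tp v hv
  · obtain ⟨k, hk⟩ := h.cover t htT
    have hki : k ≠ i := by
      rintro rfl
      exact hti hk
    exact hki (h.post_unique (h.mem_Pre_and_mem_Post ht hk hxu hu hki).1 hx')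

theorem ne_of_mem (h : N.IsConflictHidingFamily s e parts ps pe) (hi : x ∈ N.Post (parts i))
    (hj : x ∈ N.Pre (parts j)) : i ≠ j := by
  rintro rfl
  exact h.notMem_Post_of_mem_Pre hj hi

theorem eq_or_eq_of_pt (h : N.IsConflictHidingFamily s e parts ps pe)
    (hi : x ∈ N.Post (parts i)) (hj : x ∈ N.Pre (parts j)) (hu : N.pt x u) (huk : u ∈ parts k) :
    k = i ∨ k = j := by
  by_contra hc
  push Not at hc
  obtain ⟨-, ⟨t, ht, htx⟩, -⟩ := hi
  exact hc.2 (h.pre_unique (h.mem_Pre_and_mem_Post htx ht hu huk hc.1.symm).2 hj)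

theorem eq_or_eq_of_tp (h : N.IsConflictHidingFamily s e parts ps pe)
    (hi : x ∈ N.Post (parts i)) (hj : x ∈ N.Pre (parts j)) (hu : N.tp u x) (huk : u ∈ parts k) :
    k = i ∨ k = j := by
  by_contra hc
  push Not at hc
  obtain ⟨-, ⟨t, ht, htx⟩, -⟩ := hj
  exact hc.1 (h.post_unique (h.mem_Pre_and_mem_Post hu huk htx ht hc.2).1 hi)

/-- A place between two parts is not both an internal loop of the first and of the second one. -/
theorem not_pt_of_tp (h : N.IsConflictHidingFamily s e parts ps pe)
    (hi : x ∈ N.Post (parts i)) (hj : x ∈ N.Pre (parts j)) (ht : N.tp t x) (htj : t ∈ parts j)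
    (hu : u ∈ parts i) : ¬ N.pt x u := fun hxu =>
  h.notMem_Post_of_mem_Pre hj (h.mem_Pre_and_mem_Post ht htj hxu hu (h.ne_of_mem hi hj).symm).1

theorem eq_source_or_mem_Post (h : N.IsConflictHidingFamily s e parts ps pe)
    (hx : x ∈ N.Pre (parts j)) : x = s ∨ ∃ i, x ∈ N.Post (parts i) := by
  obtain ⟨-, ⟨u, hu, hxu⟩, hs | ⟨t, ⟨htT, htj⟩, ht⟩⟩ := hx
  · exact Or.inl (hs.unique h.source)
  · obtain ⟨i, hi⟩ := h.cover t htT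
    have hij : i ≠ j := by
      rintro rfl
      exact htj hi
    exact Or.inr ⟨i, (h.mem_Pre_and_mem_Post ht hi hxu hu hij).1⟩

theorem eq_sink_or_mem_Pre (h : N.IsConflictHidingFamily s e parts ps pe)
    (hx : x ∈ N.Post (parts i)) : x = e ∨ ∃ j, x ∈ N.Pre (parts j) := by
  obtain ⟨-, ⟨t, ht, htx⟩, he | ⟨u, ⟨huT, hui⟩, hu⟩⟩ := hx
  · exact Or.inl (he.unique h.sink)
  · obtain ⟨j, hj⟩ := h.cover u huT
    have hij : i ≠ j := by
      rintro rfl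
      exact hui hj
    exact Or.inr ⟨j, (h.mem_Pre_and_mem_Post htx ht hu hj hij).2⟩

theorem ne_source_of_isInner (h : N.IsConflictHidingFamily s e parts ps pe)
    (hx : N.IsInner (parts i) x) : x ≠ s := by
  rintro rfl
  obtain ⟨⟨-, t, ht | ht, hti⟩, hn⟩ := hx
  · exact h.source.not_tp t ht
  · exact hn (Or.inl (h.source.mem_Pre ht hti))

theorem ne_sink_of_isInner (h : N.IsConflictHidingFamily s e parts ps pe)
    (hx : N.IsInner (parts i) x) : x ≠ e := by
  rintro rfl
  obtain ⟨⟨-, t, ht | ht, hti⟩, hn⟩ := hx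
  · exact hn (Or.inr (h.sink.mem_Post ht hti))
  · exact h.sink.not_pt t ht

/-- An inner place of a part is adjacent to transitions of this part only. -/
theorem eq_of_isInner (h : N.IsConflictHidingFamily s e parts ps pe)
    (hx : N.IsInner (parts i) x) (ht : N.pt x t ∨ N.tp t x) (htk : t ∈ parts k) : k = i := by
  have hxP := hx.1.1
  obtain ⟨⟨-, v, hv, hvi⟩, hn⟩ := hx
  have hn1 : x ∉ N.Pre (parts i) := fun hc => hn (Or.inl hc)
  have hn2 : x ∉ N.Post (parts i) := fun hc => hn (Or.inr hc)
  -- Producers outside the part would make `x` an entry, consumers outside an exit.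
  have hout : ∀ {l w}, N.tp w x → w ∈ parts l → ∀ {u}, N.pt x u → u ∈ parts i → l = i := by
    intro l w hw hwl u hu hui
    by_contra hli
    exact hn1 (h.mem_Pre_and_mem_Post hw hwl hu hui hli).2
  have hin : ∀ {l w}, N.pt x w → w ∈ parts l → ∀ {u}, N.tp u x → u ∈ parts i → l = i := by
    intro l w hw hwl u hu hui
    by_contra hli
    exact hn2 (h.mem_Pre_and_mem_Post hu hui hw hwl (Ne.symm hli)).1
  have hne := h.ne_source_of_isInner (x := x) (i := i) ⟨⟨hxP, v, hv, hvi⟩, hn⟩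
  have hne' := h.ne_sink_of_isInner (x := x) (i := i) ⟨⟨hxP, v, hv, hvi⟩, hn⟩
  obtain ⟨a, ha⟩ := (h.eq_start_or_exists_tp hxP).resolve_left hne
  obtain ⟨b, hb⟩ := (h.eq_end_or_exists_pt hxP).resolve_left hne'
  obtain ⟨la, hla⟩ := h.cover a (N.tp_mem a x ha).1
  obtain ⟨lb, hlb⟩ := h.cover b (N.pt_mem x b hb).2
  have hboth : a ∈ parts i ∧ b ∈ parts i := by
    rcases hv with hv | hv
    · have hb' : b ∈ parts i := hin hb hlb hv hvi ▸ hlb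
      exact ⟨hout ha hla hb hb' ▸ hla, hb'⟩
    · have ha' : a ∈ parts i := hout ha hla hv hvi ▸ hla
      exact ⟨ha', hin hb hlb ha ha' ▸ hlb⟩
  rcases ht with ht | ht
  · exact hin ht htk ha hboth.1
  · exact hout ht htk hb hboth.2

theorem exists_role (h : N.IsConflictHidingFamily s e parts ps pe) (hT : N.T.Nonempty)
    (hx : x ∈ N.P) :
    ∃ i, N.IsInner (parts i) x ∨ x ∈ N.Pre (parts i) ∨ x ∈ N.Post (parts i) := by
  have key : ∀ t, N.pt x t ∨ N.tp t x → t ∈ N.T →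
      ∃ i, N.IsInner (parts i) x ∨ x ∈ N.Pre (parts i) ∨ x ∈ N.Post (parts i) := by
    intro t ht htT
    obtain ⟨i, hi⟩ := h.cover t htT
    refine ⟨i, ?_⟩
    by_cases hc : x ∈ N.Pre (parts i) ∪ N.Post (parts i)
    · exact Or.inr hc
    · exact Or.inl ⟨⟨hx, t, ht.symm, hi⟩, hc⟩
  rcases h.eq_start_or_exists_tp hx with rfl | ⟨t, ht⟩
  · rcases h.eq_end_or_exists_pt hx with hc | ⟨t, ht⟩
    · exact absurd hc (h.source.ne_sink h.toIsWorkflow hT)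
    · exact key t (Or.inl ht) (N.pt_mem x t ht).2
  · exact key t (Or.inr ht) (N.tp_mem t x ht).1

/-! ### Projections on the parts of a conflict-hiding partition -/

theorem mem_T (h : N.IsConflictHidingFamily s e parts ps pe) (ht : t ∈ parts i) :
    t ∈ (N.corePO (parts i) (ps i) (pe i)).T := ⟨h.subset i ht, ht⟩

theorem collapse_of_exit (h : N.IsConflictHidingFamily s e parts ps pe)
    (hx : x ∈ N.Post (parts i)) : N.collapse (parts i) (ps i) (pe i) x = pe i :=
  collapse_of_mem_Post hx fun hc => h.notMem_Post_of_mem_Pre hc hx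

theorem pt_collapse_iff (h : N.IsConflictHidingFamily s e parts ps pe) (ht : t ∈ parts i)
    (hx : x ∈ N.projP (parts i)) :
    (N.corePO (parts i) (ps i) (pe i)).pt (N.collapse (parts i) (ps i) (pe i) x) t ↔
      N.pt x t := by
  by_cases hpre : x ∈ N.Pre (parts i)
  · rw [collapse_of_mem_Pre hpre]
    constructor
    · rintro ⟨-, ⟨hc, -⟩ | ⟨-, y, hy, hyt⟩ | ⟨hc, -⟩⟩
      · exact absurd hc.1.1 (h.ps_notMem i)
      · exact ((h.entry_equiv hpre hy).pt_iff ht).2 hyt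
      · exact absurd hc (h.ps_ne_pe i)
    · exact fun hxt => ⟨h.mem_T ht, Or.inr (Or.inl ⟨rfl, x, hpre, hxt⟩)⟩
  by_cases hpost : x ∈ N.Post (parts i)
  · rw [h.collapse_of_exit hpost]
    constructor
    · rintro ⟨-, ⟨hc, -⟩ | ⟨hc, -⟩ | ⟨-, y, hy, hyt⟩⟩
      · exact absurd hc.1.1 (h.pe_notMem i)
      · exact absurd hc.symm (h.ps_ne_pe i)
      · exact ((h.exit_equiv hpost hy).pt_iff ht).2 hyt
    · exact fun hxt => ⟨h.mem_T ht, Or.inr (Or.inr ⟨rfl, x, hpost, hxt⟩)⟩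
  · have hin : N.IsInner (parts i) x := ⟨hx, not_or.2 ⟨hpre, hpost⟩⟩
    rw [collapse_of_isInner hin]
    constructor
    · rintro ⟨-, ⟨-, hc⟩ | ⟨rfl, -⟩ | ⟨rfl, -⟩⟩
      · exact hc
      · exact absurd hx.1 (h.ps_notMem i)
      · exact absurd hx.1 (h.pe_notMem i)
    · exact fun hxt => ⟨h.mem_T ht, Or.inl ⟨hin, hxt⟩⟩

theorem tp_collapse_iff (h : N.IsConflictHidingFamily s e parts ps pe) (ht : t ∈ parts i)
    (hx : x ∈ N.projP (parts i)) :
    (N.corePO (parts i) (ps i) (pe i)).tp t (N.collapse (parts i) (ps i) (pe i) x) ↔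
      N.tp t x := by
  by_cases hpre : x ∈ N.Pre (parts i)
  · rw [collapse_of_mem_Pre hpre]
    constructor
    · rintro ⟨-, ⟨hc, -⟩ | ⟨-, y, hy, hyt⟩ | ⟨hc, -⟩⟩
      · exact absurd hc.1.1 (h.ps_notMem i)
      · exact ((h.entry_equiv hpre hy).tp_iff ht).2 hyt
      · exact absurd hc (h.ps_ne_pe i)
    · exact fun hxt => ⟨h.mem_T ht, Or.inr (Or.inl ⟨rfl, x, hpre, hxt⟩)⟩
  by_cases hpost : x ∈ N.Post (parts i)
  · rw [h.collapse_of_exit hpost]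
    constructor
    · rintro ⟨-, ⟨hc, -⟩ | ⟨hc, -⟩ | ⟨-, y, hy, hyt⟩⟩
      · exact absurd hc.1.1 (h.pe_notMem i)
      · exact absurd hc.symm (h.ps_ne_pe i)
      · exact ((h.exit_equiv hpost hy).tp_iff ht).2 hyt
    · exact fun hxt => ⟨h.mem_T ht, Or.inr (Or.inr ⟨rfl, x, hpost, hxt⟩)⟩
  · have hin : N.IsInner (parts i) x := ⟨hx, not_or.2 ⟨hpre, hpost⟩⟩
    rw [collapse_of_isInner hin]
    constructor
    · rintro ⟨-, ⟨-, hc⟩ | ⟨rfl, -⟩ | ⟨rfl, -⟩⟩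
      · exact hc
      · exact absurd hx.1 (h.ps_notMem i)
      · exact absurd hx.1 (h.pe_notMem i)
    · exact fun hxt => ⟨h.mem_T ht, Or.inl ⟨hin, hxt⟩⟩

theorem pt_entry_iff (h : N.IsConflictHidingFamily s e parts ps pe) (ht : t ∈ parts i)
    (hx : x ∈ N.Pre (parts i)) : (N.corePO (parts i) (ps i) (pe i)).pt (ps i) t ↔ N.pt x t := by
  rw [← h.pt_collapse_iff ht (mem_projP_of_mem_Pre hx), collapse_of_mem_Pre hx]

theorem tp_entry_iff (h : N.IsConflictHidingFamily s e parts ps pe) (ht : t ∈ parts i)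
    (hx : x ∈ N.Pre (parts i)) : (N.corePO (parts i) (ps i) (pe i)).tp t (ps i) ↔ N.tp t x := by
  rw [← h.tp_collapse_iff ht (mem_projP_of_mem_Pre hx), collapse_of_mem_Pre hx]

theorem pt_exit_iff (h : N.IsConflictHidingFamily s e parts ps pe) (ht : t ∈ parts i)
    (hx : x ∈ N.Post (parts i)) : (N.corePO (parts i) (ps i) (pe i)).pt (pe i) t ↔ N.pt x t := by
  rw [← h.pt_collapse_iff ht (mem_projP_of_mem_Post hx), h.collapse_of_exit hx]

theorem tp_exit_iff (h : N.IsConflictHidingFamily s e parts ps pe) (ht : t ∈ parts i)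
    (hx : x ∈ N.Post (parts i)) : (N.corePO (parts i) (ps i) (pe i)).tp t (pe i) ↔ N.tp t x := by
  rw [← h.tp_collapse_iff ht (mem_projP_of_mem_Post hx), h.collapse_of_exit hx]

theorem fires_embed (h : N.IsConflictHidingFamily s e parts ps pe) {m m' : Marking Pl}
    (hf : (N.corePO (parts i) (ps i) (pe i)).Fires m t m') :
    N.Fires (N.embed (parts i) (ps i) (pe i) m) t (N.embed (parts i) (ps i) (pe i) m') := by
  have ht : t ∈ parts i := hf.1.1.2
  refine fires_iff.2 ⟨⟨hf.1.1.1, fun x hx => ?_⟩, fun x => ?_⟩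
  · have hxm := mem_projP_of_pt hx ht
    rw [embed_of_mem hxm]
    exact hf.1.2 _ ((h.pt_collapse_iff ht hxm).2 hx)
  · by_cases hxm : x ∈ N.projP (parts i)
    · have := (fires_iff.1 hf).2 (N.collapse (parts i) (ps i) (pe i) x)
      rw [h.pt_collapse_iff ht hxm, h.tp_collapse_iff ht hxm] at this
      rw [embed_of_mem hxm, embed_of_mem hxm]
      exact this
    · have h1 : ¬ N.pt x t := fun hc => hxm (mem_projP_of_pt hc ht)
      have h2 : ¬ N.tp t x := fun hc => hxm (mem_projP_of_tp hc ht)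
      simp [embed_of_notMem hxm, h1, h2]

theorem run_embed (h : N.IsConflictHidingFamily s e parts ps pe) {m m' : Marking Pl}
    {σ : List Tr} (hr : (N.corePO (parts i) (ps i) (pe i)).Run m σ m') :
    N.Run (N.embed (parts i) (ps i) (pe i) m) σ (N.embed (parts i) (ps i) (pe i) m') := by
  induction hr with
  | nil => exact .nil _
  | cons hf _ ih => exact .cons (h.fires_embed hf) ih

/-- Each part `i` has an entry place, and all its entry places are marked after some firing sequence
without transitions of the part: before its first transition fires, the part has not put tokens
into any place, so this transition consumes from an entry place, and hence from all of them. -/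
theorem exists_entries_marked (h : N.IsConflictHidingFamily s e parts ps pe) (i : Fin n) :
    (N.Pre (parts i)).Nonempty ∧ ∃ σ M, (∀ t ∈ σ, t ∉ parts i) ∧ N.Run (single s) σ M ∧
      ∀ x ∈ N.Pre (parts i), 1 ≤ M x := by
  by_contra hc
  have key : ∀ σ M, N.Run (single s) σ M → (∀ t ∈ σ, t ∉ parts i) →
      (∀ x, 1 ≤ M x → x = s ∨ ∃ u, u ∉ parts i ∧ N.tp u x) →
      ∀ t ∈ parts i, ¬ N.Enabled M t := by
    intro σ M hr hσ hM t ht hen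
    have hpre : ∀ x, N.pt x t → x ∈ N.Pre (parts i) := by
      intro x hx
      rcases hM x (hen.2 x hx) with rfl | ⟨u, hu, hux⟩
      · exact h.source.mem_Pre hx ht
      · exact mem_Pre_of_tp hux hu hx ht
    obtain ⟨x, hx⟩ := h.exists_pt hen.1
    exact hc ⟨⟨x, hpre x hx⟩, σ, M, hσ, hr, fun y hy =>
      hen.2 y (((h.entry_equiv (hpre x hx) hy).pt_iff ht).1 hx)⟩
  have inv : ∀ σ M, N.Run (single s) σ M → (∀ t ∈ σ, t ∉ parts i) ∧
      (∀ x, 1 ≤ M x → x = s ∨ ∃ u, u ∉ parts i ∧ N.tp u x) := by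
    intro σ M hr
    refine Run.induction_snoc (motive := fun σ M => (∀ t ∈ σ, t ∉ parts i) ∧
      (∀ x, 1 ≤ M x → x = s ∨ ∃ u, u ∉ parts i ∧ N.tp u x)) ?_ ?_ hr
    · exact ⟨by simp, fun x hx => Or.inl (eq_of_one_le_single hx)⟩
    · rintro σ t M M' hr ⟨h1, h2⟩ hf
      have ht : t ∉ parts i := fun ht => key σ M hr h1 h2 t ht hf.1
      refine ⟨fun u hu => ?_, fun x hx => ?_⟩
      · rcases List.mem_append.1 hu with hu | hu
        · exact h1 u hu
        · rwa [List.mem_singleton.1 hu]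
      · rcases hf.one_le_or_tp hx with hx | hx
        · exact h2 x hx
        · exact Or.inr ⟨t, ht, hx⟩
  obtain ⟨t, ht⟩ := h.nonempty i
  obtain ⟨M, ⟨σ, hr⟩, hen⟩ := h.live t (h.subset i ht)
  obtain ⟨h1, h2⟩ := inv σ M hr
  exact key σ M hr h1 h2 t ht hen

theorem exists_mem_Pre (h : N.IsConflictHidingFamily s e parts ps pe) (i : Fin n) :
    ∃ x, x ∈ N.Pre (parts i) := (h.exists_entries_marked i).1

theorem exists_exit (h : N.IsConflictHidingFamily s e parts ps pe) (i : Fin n) :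
    ∃ x, x ∈ N.Post (parts i) := by
  obtain ⟨t, ht⟩ := h.nonempty i
  exact h.toIsWorkflow.exists_mem_Post h.sink ht (h.subset i ht)

theorem exists_context (h : N.IsConflictHidingFamily s e parts ps pe) (i : Fin n) :
    ∃ σ R, (∀ t ∈ σ, t ∉ parts i) ∧
      N.Run (single s) σ (N.embed (parts i) (ps i) (pe i) (single (ps i)) + R) := by
  obtain ⟨-, σ, M, hσ, hr, hM⟩ := h.exists_entries_marked i
  refine ⟨σ, M - N.embed (parts i) (ps i) (pe i) (single (ps i)), hσ, ?_⟩
  convert hr using 1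
  funext x
  simp only [Pi.add_apply, Pi.sub_apply]
  refine Nat.add_sub_cancel' ?_
  by_cases hx : x ∈ N.projP (parts i)
  · rw [embed_of_mem hx]
    by_cases hpre : x ∈ N.Pre (parts i)
    · rw [collapse_of_mem_Pre hpre, single_self]
      exact hM x hpre
    · rw [single_of_ne]
      · exact Nat.zero_le _
      · rw [collapse, if_neg hpre]
        split_ifs
        · exact (h.ps_ne_pe i).symm
        · exact fun hc => h.ps_notMem i (hc ▸ hx.1)
  · rw [embed_of_notMem hx]
    exact Nat.zero_le _

theorem le_of_embed_le (h : N.IsConflictHidingFamily s e parts ps pe) {X : Marking Pl}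
    {c : ℕ} (hX : ∀ x, N.embed (parts i) (ps i) (pe i) X x ≤ c) {y : Pl}
    (hy : y ∈ (N.corePO (parts i) (ps i) (pe i)).P) : X y ≤ c := by
  rcases hy with hy | rfl | rfl
  · have := hX y
    rwa [embed_of_mem hy.1, collapse_of_isInner hy] at this
  · obtain ⟨x, hx⟩ := h.exists_mem_Pre i
    have := hX x
    rwa [embed_of_mem (mem_projP_of_mem_Pre hx), collapse_of_mem_Pre hx] at this
  · obtain ⟨x, hx⟩ := h.exists_exit i
    have := hX x
    rwa [embed_of_mem (mem_projP_of_mem_Post hx), h.collapse_of_exit hx] at this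

theorem eq_zero_of_notMem_core {m : Marking Pl}
    (hm : (N.corePO (parts i) (ps i) (pe i)).Reachable (single (ps i)) m) {y : Pl}
    (hy : y ∉ (N.corePO (parts i) (ps i) (pe i)).P) : m y = 0 := by
  refine hm.eq_zero_of_notMem hy (single_of_ne ?_)
  rintro rfl
  exact hy (Or.inr (Or.inl rfl))

theorem core_safe (h : N.IsConflictHidingFamily s e parts ps pe) (m : Marking Pl)
    (hm : (N.corePO (parts i) (ps i) (pe i)).Reachable (single (ps i)) m) (y : Pl) :
    m y ≤ 1 := by
  by_cases hy : y ∈ (N.corePO (parts i) (ps i) (pe i)).P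
  · obtain ⟨σ, R, -, hr⟩ := h.exists_context i
    obtain ⟨α, hα⟩ := hm
    refine h.le_of_embed_le (fun x => ?_) hy
    have := h.safe _ (hr.append ((h.run_embed hα).add R)).reachable x
    simp only [Pi.add_apply] at this
    omega
  · rw [eq_zero_of_notMem_core hm hy]
    exact Nat.zero_le 1

/-! ### Composition of markings -/

theorem glue_init (h : N.IsConflictHidingFamily s e parts ps pe) (hT : N.T.Nonempty) :
    N.Glue s e parts ps pe (single s) (fun i => single (ps i)) := by
  refine ⟨?_, ?_, ?_, ?_, ?_⟩
  · intro i x hx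
    rw [single_of_ne (h.ne_source_of_isInner hx),
      single_of_ne (by rintro rfl; exact h.ps_notMem i hx.1.1)]
  · intro i j x hi hj
    have hxs : x ≠ s := by
      rintro rfl
      obtain ⟨-, ⟨t, -, ht⟩, -⟩ := hi
      exact h.source.not_tp t ht
    rw [single_of_ne hxs, single_of_ne (h.ps_ne_pe i).symm, single_self]
  · intro i _
    rw [single_self, single_self]
  · intro i _
    rw [single_of_ne (h.source.ne_sink h.toIsWorkflow hT).symm, single_of_ne (h.ps_ne_pe i).symm]
  · intro x hx
    exact single_of_ne fun hc => hx (hc ▸ h.start_mem)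

theorem glue_fires (h : N.IsConflictHidingFamily s e parts ps pe)
    (hg : N.Glue s e parts ps pe M m) (hf : N.Fires M t M')
    (hf' : (N.corePO (parts i) (ps i) (pe i)).Fires (m i) t m') :
    N.Glue s e parts ps pe M' (Function.update m i m') := by
  have ht : t ∈ parts i := hf'.1.1.2
  have same : ∀ {x}, ¬ N.pt x t → ¬ N.tp t x → M' x = M x := fun h1 h2 =>
    ((fires_iff.1 hf).2 _).2.2.2 h1 h2
  refine ⟨?_, ?_, ?_, ?_, ?_⟩
  · intro k x hx
    have h0 := hg.inner hx
    by_cases hk : k = i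
    · subst hk
      rw [Function.update_self]
      have h1 := h.pt_collapse_iff ht hx.1
      have h2 := h.tp_collapse_iff ht hx.1
      rw [collapse_of_isInner hx] at h1 h2
      have := hf.add_eq_add hf' h1 h2
      omega
    · rw [Function.update_of_ne hk, same _ _, h0]
      · exact fun hc => hk (h.eq_of_isInner hx (Or.inl hc) ht).symm
      · exact fun hc => hk (h.eq_of_isInner hx (Or.inr hc) ht).symm
  · intro k j x hk hj
    have h0 := hg.between hk hj
    have hkj := h.ne_of_mem hk hj
    by_cases hki : k = i
    · subst hki
      rw [Function.update_self, Function.update_of_ne hkj.symm]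
      have := hf.add_eq_add hf' (h.pt_exit_iff ht hk) (h.tp_exit_iff ht hk)
      omega
    by_cases hji : j = i
    · subst hji
      rw [Function.update_self, Function.update_of_ne hkj]
      have := hf.add_eq_add hf' (h.pt_entry_iff ht hj) (h.tp_entry_iff ht hj)
      omega
    · rw [Function.update_of_ne hki, Function.update_of_ne hji, same _ _, h0]
      · intro hc
        rcases h.eq_or_eq_of_pt hk hj hc ht with rfl | rfl
        · exact hki rfl
        · exact hji rfl
      · intro hc
        rcases h.eq_or_eq_of_tp hk hj hc ht with rfl | rfl
        · exact hki rfl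
        · exact hji rfl
  · intro k hk
    have h0 := hg.source hk
    by_cases hki : k = i
    · subst hki
      rw [Function.update_self]
      have := hf.add_eq_add hf' (h.pt_entry_iff ht hk) (h.tp_entry_iff ht hk)
      omega
    · rw [Function.update_of_ne hki, same _ (h.source.not_tp t), h0]
      exact fun hc => hki (h.pre_unique hk (h.source.mem_Pre hc ht))
  · intro k hk
    have h0 := hg.sink hk
    by_cases hki : k = i
    · subst hki
      rw [Function.update_self]
      have := hf.add_eq_add hf' (h.pt_exit_iff ht hk) (h.tp_exit_iff ht hk)
      omega
    · rw [Function.update_of_ne hki, same (h.sink.not_pt t) _, h0]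
      exact fun hc => hki (h.post_unique hk (h.sink.mem_Post hc ht))
  · intro x hx
    rw [same (fun hc => hx (N.pt_mem x t hc).1) (fun hc => hx (N.tp_mem t x hc).2), hg.outside hx]

theorem core_enabled (h : N.IsConflictHidingFamily s e parts ps pe)
    (hg : N.Glue s e parts ps pe M m)
    (hm : ∀ k, (N.corePO (parts k) (ps k) (pe k)).Reachable (single (ps k)) (m k))
    (ht : t ∈ parts i) (hen : N.Enabled M t) :
    (N.corePO (parts i) (ps i) (pe i)).Enabled (m i) t := by
  refine ⟨h.mem_T ht, ?_⟩
  rintro y ⟨-, ⟨hy, hyt⟩ | ⟨rfl, x, hx, hxt⟩ | ⟨rfl, x, hx, hxt⟩⟩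
  · rw [← hg.inner hy]
    exact hen.2 y hyt
  · have h1 := hen.2 x hxt
    rcases h.eq_source_or_mem_Post hx with rfl | ⟨j, hj⟩
    · rwa [hg.source hx] at h1
    · have := hg.between hj hx
      have := h.core_safe _ (hm j) (pe j)
      omega
  · have h1 := hen.2 x hxt
    rcases h.eq_sink_or_mem_Pre hx with rfl | ⟨j, hj⟩
    · rwa [hg.sink hx] at h1
    · have := hg.between hx hj
      have := h.core_safe _ (hm j) (ps j)
      omega

open Classical in
/-- The firing sequence `σ` from the source to `M` induces firing sequences of the projections,
which lead to the markings `m i` that compose `M`. -/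
structure Projects (N : PetriNet Pl Tr) (s e : Pl) (parts : Fin n → Set Tr) (ps pe : Fin n → Pl)
    (σ : List Tr) (M : Marking Pl) (m : Fin n → Marking Pl) : Prop where
  glue : N.Glue s e parts ps pe M m
  run : ∀ i, (N.corePO (parts i) (ps i) (pe i)).Run (single (ps i))
    (σ.filter (· ∈ parts i)) (m i)

theorem Projects.reachable {σ : List Tr} (hp : Projects N s e parts ps pe σ M m) (i : Fin n) :
    (N.corePO (parts i) (ps i) (pe i)).Reachable (single (ps i)) (m i) := (hp.run i).reachable

theorem projects_nil (h : N.IsConflictHidingFamily s e parts ps pe) (hT : N.T.Nonempty) :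
    Projects N s e parts ps pe [] (single s) (fun i => single (ps i)) :=
  ⟨h.glue_init hT, fun _ => .nil _⟩

theorem Projects.snoc (h : N.IsConflictHidingFamily s e parts ps pe) {σ : List Tr}
    (hp : Projects N s e parts ps pe σ M m) (ht : t ∈ parts i) (hf : N.Fires M t M') :
    ∃ m', (N.corePO (parts i) (ps i) (pe i)).Fires (m i) t m' ∧
      Projects N s e parts ps pe (σ ++ [t]) M' (Function.update m i m') := by
  obtain ⟨m', hf'⟩ := (h.core_enabled hp.glue hp.reachable ht hf.1).exists_fires
  refine ⟨m', hf', h.glue_fires hp.glue hf hf', fun k => ?_⟩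
  by_cases hk : k = i
  · subst hk
    simpa [List.filter_append, ht] using (hp.run k).snoc hf'
  · have htk : t ∉ parts k := fun hc => hk (h.disjoint hc ht)
    simpa [List.filter_append, htk, hk] using hp.run k

theorem exists_projects (h : N.IsConflictHidingFamily s e parts ps pe) (hT : N.T.Nonempty)
    {σ : List Tr} (hr : N.Run (single s) σ M) : ∃ m, Projects N s e parts ps pe σ M m := by
  refine Run.induction_snoc (motive := fun σ M => ∃ m, Projects N s e parts ps pe σ M m)
    ⟨_, h.projects_nil hT⟩ ?_ hr
  rintro σ t M M' - ⟨m, hp⟩ hf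
  obtain ⟨i, hi⟩ := h.cover t hf.1.1
  obtain ⟨m', -, hp'⟩ := hp.snoc h hi hf
  exact ⟨_, hp'⟩

/-- When the net has ended, each of its parts has ended. A part that has not delivered its token
leaves its successors without input, and they do not deliver tokens without input, so that no token
would arrive in the sink. -/
theorem eq_single_exit_of_glue (h : N.IsConflictHidingFamily s e parts ps pe)
    (hg : N.Glue s e parts ps pe (single e) m)
    (hm : ∀ k, (N.corePO (parts k) (ps k) (pe k)).Reachable (single (ps k)) (m k))
    (i : Fin n) : m i = single (pe i) := by
  have hps : ∀ k, m k (pe k) = 1 → m k (ps k) = 0 := by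
    intro k hk
    by_contra hc
    rw [eq_single_of_safe h.core_safe (hm k) (by omega),
      single_of_ne (h.ps_ne_pe k).symm] at hk
    omega
  have key : ∀ y, Relation.ReflTransGen N.Flow y (Sum.inl e) →
      (∀ t, y = Sum.inr t → ∀ k, t ∈ parts k → m k (pe k) = 1) ∧
      (∀ x, y = Sum.inl x → ∀ t, N.tp t x → ∀ k, t ∈ parts k → m k (pe k) = 1) := by
    intro y hy
    induction hy using Relation.ReflTransGen.head_induction_on with
    | refl =>
      refine ⟨by simp, fun x hx t ht k hk => ?_⟩
      obtain rfl := Sum.inl_injective hx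
      rw [← hg.sink (h.sink.mem_Post ht hk), single_self]
    | head hf _ ih =>
      cases hf with
      | tp t x htx =>
        refine ⟨fun u hu k hk => ?_, by simp⟩
        obtain rfl := Sum.inr_injective hu
        exact ih.2 x rfl t htx k hk
      | pt x t hxt =>
        refine ⟨by simp, fun x' hx u hu k hk => ?_⟩
        obtain rfl := Sum.inl_injective hx
        obtain ⟨l, hl⟩ := h.cover t (N.pt_mem x t hxt).2
        have h1 := ih.1 t rfl l hl
        by_cases hkl : k = l
        · rw [hkl, h1]
        · obtain ⟨h2, h3⟩ := h.mem_Pre_and_mem_Post hu hk hxt hl hkl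
          have h4 := hg.between h2 h3
          rw [single_of_ne (by rintro rfl; exact h.sink.not_pt t hxt), hps l h1] at h4
          omega
  have hpe : m i (pe i) = 1 := by
    obtain ⟨t, ht⟩ := h.nonempty i
    exact (key _ (h.path_trans t (h.subset i ht)).2).1 t rfl i ht
  refine eq_single_of hpe fun y hy => ?_
  by_cases hyP : y ∈ (N.corePO (parts i) (ps i) (pe i)).P
  · rcases hyP with hin | rfl | rfl
    · rw [← hg.inner hin, single_of_ne (h.ne_sink_of_isInner hin)]
    · exact hps i hpe
    · exact absurd rfl hy
  · exact eq_zero_of_notMem_core (hm i) hyP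

theorem eq_single_sink_of_glue (h : N.IsConflictHidingFamily s e parts ps pe)
    (hT : N.T.Nonempty) (hg : N.Glue s e parts ps pe M fun i => single (pe i)) :
    M = single e := by
  have hpre : ∀ {i x}, x ∈ N.Pre (parts i) → M x = 0 := by
    intro i x hx
    rcases h.eq_source_or_mem_Post hx with rfl | ⟨j, hj⟩
    · rw [hg.source hx, single_of_ne (h.ps_ne_pe i)]
    · have := hg.between hj hx
      rw [single_self, single_of_ne (h.ps_ne_pe i)] at this
      omega
  refine eq_single_of ?_ fun x hx => ?_
  · obtain ⟨i, hi | hi | hi⟩ := h.exists_role hT h.end_mem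
    · exact absurd rfl (h.ne_sink_of_isInner hi)
    · obtain ⟨-, ⟨t, -, ht⟩, -⟩ := hi
      exact absurd ht (h.sink.not_pt t)
    · rw [hg.sink hi, single_self]
  · by_cases hxP : x ∈ N.P
    · obtain ⟨i, hi | hi | hi⟩ := h.exists_role hT hxP
      · rw [hg.inner hi, single_of_ne (by rintro rfl; exact h.pe_notMem i hxP)]
      · exact hpre hi
      · obtain ⟨j, hj⟩ := (h.eq_sink_or_mem_Pre hi).resolve_left hx
        exact hpre hj
    · exact hg.outside hxP

/-! ### Soundness of the projections -/

theorem core_complete (h : N.IsConflictHidingFamily s e parts ps pe) (hT : N.T.Nonempty)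
    {m : Marking Pl}
    (hm : (N.corePO (parts i) (ps i) (pe i)).Reachable (single (ps i)) m) :
    (N.corePO (parts i) (ps i) (pe i)).Reachable m (single (pe i)) := by
  classical
  obtain ⟨σ, R, hσ, hr⟩ := h.exists_context i
  obtain ⟨α, hα⟩ := hm
  have h1 := hr.append ((h.run_embed hα).add R)
  obtain ⟨ρ, hρ⟩ := h.complete _ h1.reachable
  obtain ⟨μ, hμ⟩ := h.exists_projects hT (h1.append hρ)
  have h2 := hμ.run i
  have hσ' : σ.filter (· ∈ parts i) = [] := by
    rw [List.filter_eq_nil_iff]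
    simpa using hσ
  have hα' : α.filter (· ∈ parts i) = α := by
    rw [List.filter_eq_self]
    intro t ht
    simpa using (hα.mem_T t ht).2
  rw [h.eq_single_exit_of_glue hμ.glue hμ.reachable i] at h2
  rw [List.filter_append, List.filter_append, hσ', hα', List.nil_append] at h2
  obtain ⟨m₁, h4, h5⟩ := h2.of_append
  obtain rfl := hα.unique h4
  exact h5.reachable

/-- If a part delivers its token, nothing remains in the part: the rest of the net can
complete without the part, and then the remaining tokens would be left beside the one in the sink. -/
theorem core_proper (h : N.IsConflictHidingFamily s e parts ps pe) (hT : N.T.Nonempty)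
    {m : Marking Pl}
    (hm : (N.corePO (parts i) (ps i) (pe i)).Reachable (single (ps i)) m) (hpe : 1 ≤ m (pe i)) :
    m = single (pe i) := by
  obtain ⟨X, rfl⟩ : ∃ X, m = single (pe i) + X := ⟨_, (single_add_sub hpe).symm⟩
  obtain ⟨σ, R, -, hr⟩ := h.exists_context i
  have reach : ∀ {m}, (N.corePO (parts i) (ps i) (pe i)).Reachable (single (ps i)) m →
      N.Reachable (single s) (N.embed (parts i) (ps i) (pe i) m + R) := by
    rintro m ⟨α, hα⟩
    exact (hr.append ((h.run_embed hα).add R)).reachable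
  have h1 := h.complete _ (reach (h.core_complete hT (.refl _)))
  have h2 := reach hm
  rw [embed_add, add_right_comm] at h2
  have h3 := h.proper _ (h2.trans (h1.add _))
    (by simp only [Pi.add_apply, single_self]; omega)
  have hX : ∀ x, N.embed (parts i) (ps i) (pe i) X x ≤ 0 := by
    intro x
    have := congrFun h3 x
    simp only [Pi.add_apply] at this
    omega
  funext y
  have hy : X y = 0 := by
    by_cases hyP : y ∈ (N.corePO (parts i) (ps i) (pe i)).P
    · exact Nat.le_zero.1 (h.le_of_embed_le hX hyP)
    · have := eq_zero_of_notMem_core hm hyP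
      simp only [Pi.add_apply] at this
      omega
  simp only [Pi.add_apply, hy, add_zero]

/-- The projections of a sound net on the parts of a conflict-hiding partition are sound. -/
theorem isWorkflow_corePO (h : N.IsConflictHidingFamily s e parts ps pe) (hT : N.T.Nonempty)
    (i : Fin n) : (N.corePO (parts i) (ps i) (pe i)).IsWorkflow (ps i) (pe i) := by
  obtain ⟨h1, h2⟩ := h.paths_quotient (C := N.corePO (parts i) (ps i) (pe i)) (S := parts i)
    (g := N.collapse (parts i) (ps i) (pe i)) (ps := ps i) (pe := pe i) h.source h.sink
    (fun x t ht hx => .pt _ _ ((h.pt_collapse_iff ht (mem_projP_of_pt hx ht)).2 hx))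
    (fun x t ht hx => .tp _ _ ((h.tp_collapse_iff ht (mem_projP_of_tp hx ht)).2 hx))
    (fun x hx => collapse_of_mem_Pre hx) (fun x hx => h.collapse_of_exit hx)
  have h3 : ∀ x ∈ N.projP (parts i), Relation.ReflTransGen
      (N.corePO (parts i) (ps i) (pe i)).Flow (Sum.inl (ps i))
        (Sum.inl (N.collapse (parts i) (ps i) (pe i) x)) ∧
      Relation.ReflTransGen (N.corePO (parts i) (ps i) (pe i)).Flow
        (Sum.inl (N.collapse (parts i) (ps i) (pe i) x)) (Sum.inl (pe i)) := by
    rintro x ⟨-, t, htx, ht⟩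
    exact h2 x ⟨t, ht, htx.symm⟩
  refine ⟨Or.inr (Or.inl rfl), Or.inr (Or.inr rfl), ?_, ?_, h.core_safe, ?_, ?_, ?_⟩
  · rintro y (hy | rfl | rfl)
    · have := h3 y hy.1
      rwa [collapse_of_isInner hy] at this
    · obtain ⟨x, hx⟩ := h.exists_mem_Pre i
      have := h3 x (mem_projP_of_mem_Pre hx)
      rwa [collapse_of_mem_Pre hx] at this
    · obtain ⟨x, hx⟩ := h.exists_exit i
      have := h3 x (mem_projP_of_mem_Post hx)
      rwa [h.collapse_of_exit hx] at this
  · exact fun t ht => h1 t ht.2 ht.1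
  · rintro t ⟨htT, ht⟩
    obtain ⟨M, ⟨σ, hr⟩, hen⟩ := h.live t htT
    obtain ⟨m, hp⟩ := h.exists_projects hT hr
    exact ⟨m i, hp.reachable i, h.core_enabled hp.glue hp.reachable ht hen⟩
  · exact fun m hm => h.core_complete hT hm
  · exact fun m hm => h.core_proper hT hm

end IsConflictHidingFamily

/-! ### The execution order of the parts -/

namespace IsConflictHidingFamily

variable {s e : Pl} {parts : Fin n → Set Tr} {ps pe : Fin n → Pl} {i j k : Fin n}
  {t u : Tr} {x : Pl} {M M' m' : Marking Pl} {m : Fin n → Marking Pl} {σ : List Tr}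

theorem core_exists_pt (h : N.IsConflictHidingFamily s e parts ps pe) (ht : t ∈ parts i) :
    ∃ y, (N.corePO (parts i) (ps i) (pe i)).pt y t := by
  obtain ⟨x, hx⟩ := h.exists_pt (h.subset i ht)
  exact ⟨_, (h.pt_collapse_iff ht (mem_projP_of_pt hx ht)).2 hx⟩

/-- A part that has ended can only take its token back as long as the next part has not consumed
it. -/
theorem not_enabled_of_ended (h : N.IsConflictHidingFamily s e parts ps pe)
    (hp : Projects N s e parts ps pe σ M m) (hi : x ∈ N.Post (parts i))
    (hj : x ∈ N.Pre (parts j)) (hm : m i = single (pe i))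
    (ho : m j (ps j) = 0 ∨ ∀ u ∈ parts i, ¬ N.pt x u) (ht : t ∈ parts i) :
    ¬ N.Enabled M t := by
  intro hen
  have hen' := h.core_enabled hp.glue hp.reachable ht hen
  obtain ⟨y, hy⟩ := h.core_exists_pt ht
  have h1 := hen'.2 y hy
  rw [hm] at h1
  obtain rfl := eq_of_one_le_single h1
  have hxt := (h.pt_exit_iff ht hi).1 hy
  rcases ho with ho | ho
  · have h2 := hp.glue.between hi hj
    have h3 := hen.2 x hxt
    rw [hm, single_self, ho] at h2
    omega
  · exact ho t ht hxt

/-- Once a part `j` has started, a part `i` directly before it has ended, and cannot continue: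
either `j` keeps the place `x` between them empty, or `i` does not consume from it. -/
theorem ended_of_started (h : N.IsConflictHidingFamily s e parts ps pe) (hT : N.T.Nonempty)
    (hi : x ∈ N.Post (parts i)) (hj : x ∈ N.Pre (parts j)) (hr : N.Run (single s) σ M) :
    ∃ m, Projects N s e parts ps pe σ M m ∧ ((∃ t ∈ σ, t ∈ parts j) →
      m i = single (pe i) ∧ (m j (ps j) = 0 ∨ ∀ u ∈ parts i, ¬ N.pt x u)) := by
  have hij := h.ne_of_mem hi hj
  refine Run.induction_snoc (motive := fun σ M => ∃ m, Projects N s e parts ps pe σ M m ∧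
    ((∃ t ∈ σ, t ∈ parts j) →
      m i = single (pe i) ∧ (m j (ps j) = 0 ∨ ∀ u ∈ parts i, ¬ N.pt x u)))
    ⟨_, h.projects_nil hT, by simp⟩ ?_ hr
  rintro σ t M M' - ⟨m, hp, hI⟩ hf
  obtain ⟨k, hk⟩ := h.cover t hf.1.1
  obtain ⟨m', hf', hp'⟩ := hp.snoc h hk hf
  refine ⟨_, hp', ?_⟩
  rintro ⟨v, hv, hvj⟩
  by_cases hkj : k = j
  · subst hkj
    rw [Function.update_of_ne hij, Function.update_self]
    have hprod : (N.corePO (parts k) (ps k) (pe k)).tp t (ps k) →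
        ∀ u ∈ parts i, ¬ N.pt x u := fun htp u hu =>
      h.not_pt_of_tp hi hj ((h.tp_entry_iff hk hj).1 htp) hk hu
    by_cases hst : ∃ t ∈ σ, t ∈ parts k
    · obtain ⟨h1, h2⟩ := hI hst
      refine ⟨h1, ?_⟩
      by_cases h3 : m' (ps k) = 0
      · exact Or.inl h3
      · rcases hf'.one_le_or_tp (Nat.one_le_iff_ne_zero.2 h3) with h4 | h4
        · exact Or.inr (h2.resolve_left (by omega))
        · exact Or.inr (hprod h4)
    · -- The first transition of the part consumes the token of its entry places.
      have hm : m k = single (ps k) := by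
        classical
        have h1 := hp.run k
        rw [List.filter_eq_nil_iff.2 (by simpa using hst)] at h1
        exact h1.eq_of_nil.symm
      have hpt : (N.corePO (parts k) (ps k) (pe k)).pt (ps k) t := by
        obtain ⟨y, hy⟩ := h.core_exists_pt hk
        have h1 := hf'.1.2 y hy
        rw [hm] at h1
        exact eq_of_one_le_single h1 ▸ hy
      have h1 := hf.1.2 x ((h.pt_entry_iff hk hj).1 hpt)
      have h2 := hp.glue.between hi hj
      have h3 := h.core_safe _ (hp.reachable k) (ps k)
      refine ⟨h.core_proper hT (hp.reachable i) (by omega), ?_⟩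
      by_cases htp : (N.corePO (parts k) (ps k) (pe k)).tp t (ps k)
      · exact Or.inr (hprod htp)
      · have h4 := ((fires_iff.1 hf').2 (ps k)).2.1 hpt htp
        exact Or.inl (by omega)
  · have hst : ∃ t ∈ σ, t ∈ parts j := by
      rcases List.mem_append.1 hv with hv | hv
      · exact ⟨v, hv, hvj⟩
      · obtain rfl := List.mem_singleton.1 hv
        exact absurd (h.disjoint hk hvj) hkj
    obtain ⟨h1, h2⟩ := hI hst
    by_cases hki : k = i
    · subst hki
      exact absurd hf.1 (h.not_enabled_of_ended hp hi hj h1 h2 hk)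
    · rw [Function.update_of_ne (Ne.symm hki), Function.update_of_ne (Ne.symm hkj)]
      exact ⟨h1, h2⟩

theorem notMem_of_execOrder (h : N.IsConflictHidingFamily s e parts ps pe) (hT : N.T.Nonempty)
    {α β : List Tr} (hij : N.execOrder parts i j) (hr : N.Run (single s) (α ++ t :: β) M)
    (ht : t ∈ parts j) : ∀ u ∈ t :: β, u ∉ parts i := by
  obtain ⟨x, hxi, hxj⟩ := hij
  intro u hu hui
  rcases List.mem_cons.1 hu with rfl | hu
  · exact h.ne_of_mem hxi hxj (h.disjoint hui ht)
  · obtain ⟨β₁, β₂, rfl⟩ := List.append_of_mem hu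
    rw [← List.cons_append, ← List.append_assoc] at hr
    obtain ⟨M', hr', hu'⟩ := hr.of_append
    obtain ⟨m, hp, hI⟩ := h.ended_of_started hT hxi hxj hr'
    obtain ⟨h1, h2⟩ := hI ⟨t, by simp, ht⟩
    cases hu' with
    | cons hf _ => exact h.not_enabled_of_ended hp hxi hxj h1 h2 hui hf.1

/-- In a complete firing sequence, every part contributes a transition. -/
theorem exists_mem_of_run (h : N.IsConflictHidingFamily s e parts ps pe) (hT : N.T.Nonempty)
    (hr : N.Run (single s) σ (single e)) (i : Fin n) : ∃ t ∈ σ, t ∈ parts i := by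
  classical
  obtain ⟨m, hp⟩ := h.exists_projects hT hr
  have h1 := hp.run i
  rw [h.eq_single_exit_of_glue hp.glue hp.reachable i] at h1
  by_contra hc
  rw [List.filter_eq_nil_iff.2 (by simpa using hc)] at h1
  have h2 : 1 ≤ single (ps i) (pe i) := by rw [h1.eq_of_nil, single_self]
  exact h.ps_ne_pe i (eq_of_one_le_single h2).symm

/-- In a complete firing sequence, all transitions of a part come before those of the parts that
follow it in the execution order. -/
theorem notMem_of_transGen (h : N.IsConflictHidingFamily s e parts ps pe) (hT : N.T.Nonempty)
    (hr : N.Run (single s) σ (single e)) (hij : Relation.TransGen (N.execOrder parts) i j)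
    {α β : List Tr} (hσ : σ = α ++ t :: β) (ht : t ∈ parts j) : ∀ u ∈ t :: β, u ∉ parts i := by
  induction hij generalizing t α β with
  | single hij =>
    subst hσ
    exact h.notMem_of_execOrder hT hij hr ht
  | @tail k j _ hkj ih =>
    have hk : ∀ u ∈ t :: β, u ∉ parts k := by
      rw [hσ] at hr
      exact h.notMem_of_execOrder hT hkj hr ht
    obtain ⟨v, hv, hvk⟩ := h.exists_mem_of_run hT hr k
    rw [hσ] at hv
    rcases List.mem_append.1 hv with hv | hv
    · obtain ⟨α₁, α₂, rfl⟩ := List.append_of_mem hv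
      intro u hu
      refine ih (t := v) (α := α₁) (β := α₂ ++ t :: β) (by simp [hσ]) hvk u ?_
      exact List.mem_cons_of_mem _ (List.mem_append_right _ hu)
    · exact absurd hvk (hk v hv)

theorem transGen_irrefl (h : N.IsConflictHidingFamily s e parts ps pe) (hT : N.T.Nonempty)
    (i : Fin n) : ¬ Relation.TransGen (N.execOrder parts) i i := by
  intro hii
  obtain ⟨σ, hr⟩ := h.complete _ (.refl _)
  obtain ⟨t, ht, hti⟩ := h.exists_mem_of_run hT hr i
  obtain ⟨α, β, hσ⟩ := List.append_of_mem ht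
  exact h.notMem_of_transGen hT hr hii hσ hti t (by simp) hti

/-! ### The language of a net with a conflict-hiding partition -/

open Classical in
/-- A sequence of transitions is a shuffle of its restrictions to the parts, which is compatible
with every relation between parts that is respected by the sequence. -/
theorem isShuffle_filter (h : N.IsPartFamily parts) {r : Fin n → Fin n → Prop}
    (lab : Tr → Option A) {τ : List Tr} (hτ : ∀ t ∈ τ, t ∈ N.T)
    (hr : ∀ α t β i j, τ = α ++ t :: β → r i j → t ∈ parts j → ∀ u ∈ t :: β, u ∉ parts i) :
    IsShuffle r (fun i => (τ.filter (· ∈ parts i)).filterMap lab) (τ.filterMap lab) := by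
  induction τ with
  | nil => exact fun i => rfl
  | cons t τ ih =>
    have ih' := ih (fun u hu => hτ u (List.mem_cons_of_mem _ hu)) fun α u β i j hα hij hu =>
      hr (t :: α) u β i j (by simp [hα]) hij hu
    obtain ⟨i, hi⟩ := h.cover t (hτ t (by simp))
    have hne : ∀ {k}, k ≠ i → t ∉ parts k := fun hk hc => hk (h.disjoint hc hi)
    rcases hl : lab t with _ | a
    · rw [List.filterMap_cons_none hl]
      convert ih' using 2 with k
      by_cases hk : k = i
      · subst hk
        rw [List.filter_cons_of_pos (by simpa using hi), List.filterMap_cons_none hl]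
      · rw [List.filter_cons_of_neg (by simpa using hne hk)]
    · rw [List.filterMap_cons_some hl]
      refine ⟨i, (τ.filter (· ∈ parts i)).filterMap lab, ?_, ?_, ?_⟩
      · beta_reduce
        rw [List.filter_cons_of_pos (by simpa using hi), List.filterMap_cons_some hl]
      · intro j hj
        beta_reduce
        have := hr [] t τ j i rfl hj hi
        rw [List.filter_eq_nil_iff.2 (by simpa using this), List.filterMap_nil]
      · convert ih' using 1
        funext k
        by_cases hk : k = i
        · subst hk
          rw [Function.update_self]
        · rw [Function.update_of_ne hk, List.filter_cons_of_neg (by simpa using hne hk)]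

theorem enabled_of_core (h : N.IsConflictHidingFamily s e parts ps pe)
    (hg : N.Glue s e parts ps pe M m)
    (hen : (N.corePO (parts i) (ps i) (pe i)).Enabled (m i) t)
    (hbefore : ∀ j, N.execOrder parts j i → m j = single (pe j))
    (hafter : ∀ j, N.execOrder parts i j → m j = single (ps j)) : N.Enabled M t := by
  have ht : t ∈ parts i := hen.1.2
  refine ⟨hen.1.1, fun x hx => ?_⟩
  have hxm := mem_projP_of_pt hx ht
  have h1 := hen.2 _ ((h.pt_collapse_iff ht hxm).2 hx)
  by_cases hpre : x ∈ N.Pre (parts i)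
  · rw [collapse_of_mem_Pre hpre] at h1
    rcases h.eq_source_or_mem_Post hpre with rfl | ⟨j, hj⟩
    · rwa [hg.source hpre]
    · have h2 := hg.between hj hpre
      rw [hbefore j ⟨x, hj, hpre⟩, single_self] at h2
      omega
  by_cases hpost : x ∈ N.Post (parts i)
  · rw [h.collapse_of_exit hpost] at h1
    rcases h.eq_sink_or_mem_Pre hpost with rfl | ⟨j, hj⟩
    · rwa [hg.sink hpost]
    · have h2 := hg.between hpost hj
      rw [hafter j ⟨x, hpost, hj⟩, single_self] at h2
      omega
  · have hin : N.IsInner (parts i) x := ⟨hxm, not_or.2 ⟨hpre, hpost⟩⟩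
    rw [collapse_of_isInner hin] at h1
    rwa [hg.inner hin]

theorem eq_nil_of_isShuffle {r : Fin n → Fin n → Prop} {f : Fin n → List A} {w : List A}
    (hw : IsShuffle r f w) (hf : ∀ i, f i = []) : w = [] := by
  cases w with
  | nil => rfl
  | cons a w =>
    obtain ⟨i, rest, hi, -⟩ := hw
    simp [hf i] at hi

/-- Complete firing sequences `ρ i` of the projections can be interleaved to a complete firing
sequence of the net, for every order-preserving shuffle of their visible words. Silent transitions
may have to fire before the next visible letter: the next transition is taken from a minimal
unfinished part among the part that owns this letter and its predecessors. -/
theorem exists_run_of_shuffle (h : N.IsConflictHidingFamily s e parts ps pe) (hT : N.T.Nonempty)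
    (lab : Tr → Option A) {ρ : Fin n → List Tr} {w : List A} (hg : N.Glue s e parts ps pe M m)
    (hr : ∀ i, (N.corePO (parts i) (ps i) (pe i)).Run (m i) (ρ i) (single (pe i)))
    (hstart : ∀ i j, Relation.TransGen (N.execOrder parts) i j → ρ i ≠ [] → m j = single (ps j))
    (hw : IsShuffle (Relation.TransGen (N.execOrder parts)) (fun i => (ρ i).filterMap lab) w) :
    ∃ σ, N.Run M σ (single e) ∧ w = σ.filterMap lab := by
  induction hlen : ∑ i, (ρ i).length generalizing ρ w M m with
  | zero =>
    have hρ : ∀ i, ρ i = [] := fun i =>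
      List.eq_nil_of_length_eq_zero (Finset.sum_eq_zero_iff.1 hlen i (Finset.mem_univ i))
    have hm : m = fun i => single (pe i) := by
      funext i
      have := hr i
      rw [hρ i] at this
      exact this.eq_of_nil
    subst hm
    obtain rfl := h.eq_single_sink_of_glue hT hg
    exact ⟨[], .nil _, eq_nil_of_isShuffle hw fun i => by rw [hρ i]; rfl⟩
  | succ l ih =>
    -- The part `i₀` owns the first letter of `w`; if `w` is empty, any unfinished part will do.
    obtain ⟨i₀, hi₀, hw₀⟩ : ∃ i₀, ρ i₀ ≠ [] ∧ ∀ a w', w = a :: w' → ∃ rest,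
        (ρ i₀).filterMap lab = a :: rest ∧
        (∀ j, Relation.TransGen (N.execOrder parts) j i₀ → (ρ j).filterMap lab = []) ∧
        IsShuffle (Relation.TransGen (N.execOrder parts))
          (Function.update (fun i => (ρ i).filterMap lab) i₀ rest) w' := by
      cases w with
      | nil =>
        by_contra hc
        push Not at hc
        have hρ : ∀ i, ρ i = [] := by
          intro i
          by_contra hi
          obtain ⟨a, w', ha, -⟩ := hc i hi
          simp at ha
        simp [hρ] at hlen
      | cons a w =>
        obtain ⟨i₀, rest, h1, h2, h3⟩ := hw
        refine ⟨i₀, ?_, ?_⟩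
        · rintro hc
          simp [hc] at h1
        · rintro a' w' ha
          obtain ⟨rfl, rfl⟩ := List.cons.inj ha
          exact ⟨rest, h1, h2, h3⟩
    obtain ⟨i, hi, hii₀, hmin⟩ : ∃ i, ρ i ≠ [] ∧
        (i = i₀ ∨ Relation.TransGen (N.execOrder parts) i i₀) ∧
        ∀ j, Relation.TransGen (N.execOrder parts) j i → ρ j = [] := by
      have : Std.Irrefl (Relation.TransGen (N.execOrder parts)) := ⟨h.transGen_irrefl hT⟩
      have hwf : WellFounded (Relation.TransGen (N.execOrder parts)) :=
        Finite.wellFounded_of_trans_of_irrefl _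
      obtain ⟨i, ⟨hi, hii₀⟩, hmin⟩ := hwf.has_min
        {i | ρ i ≠ [] ∧ (i = i₀ ∨ Relation.TransGen (N.execOrder parts) i i₀)}
        ⟨i₀, hi₀, Or.inl rfl⟩
      refine ⟨i, hi, hii₀, fun j hj => ?_⟩
      by_contra hne
      refine hmin j ⟨hne, Or.inr ?_⟩ hj
      rcases hii₀ with rfl | hii₀
      · exact hj
      · exact hj.trans hii₀
    obtain ⟨t, τ, hρi⟩ := List.exists_cons_of_ne_nil hi
    have hri := hr i
    rw [hρi] at hri
    cases hri with
    | @cons _ m' _ _ _ hf hri =>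
    have hen : N.Enabled M t := by
      refine h.enabled_of_core hg hf.1 (fun j hj => ?_) fun j hj => hstart i j (.single hj) hi
      have := hr j
      rw [hmin j (.single hj)] at this
      exact this.eq_of_nil
    obtain ⟨M', hfN⟩ := hen.exists_fires
    have hupd : ∀ k, Function.update ρ i τ k = if k = i then τ else ρ k := fun k =>
      Function.update_apply ρ i τ k
    have hlen' : ∑ k, (Function.update ρ i τ k).length = l := by
      have h1 := Finset.add_sum_erase Finset.univ (fun k => (ρ k).length) (Finset.mem_univ i)
      have h2 := Finset.add_sum_erase Finset.univ
        (fun k => (Function.update ρ i τ k).length) (Finset.mem_univ i)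
      have h3 : ∑ k ∈ Finset.univ.erase i, (Function.update ρ i τ k).length =
          ∑ k ∈ Finset.univ.erase i, (ρ k).length :=
        Finset.sum_congr rfl fun k hk => by rw [Function.update_of_ne (Finset.ne_of_mem_erase hk)]
      simp only [Function.update_self] at h2
      simp only [hρi, List.length_cons] at h1
      omega
    have hstep := fun (w' : List A) (hw' : IsShuffle (Relation.TransGen (N.execOrder parts))
        (fun k => (Function.update ρ i τ k).filterMap lab) w') =>
      ih (M := M') (m := Function.update m i m') (ρ := Function.update ρ i τ) (w := w')
        (h.glue_fires hg hfN hf) (fun k => by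
          by_cases hk : k = i
          · subst hk
            rwa [Function.update_self, Function.update_self]
          · rw [Function.update_of_ne hk, Function.update_of_ne hk]
            exact hr k) (fun k j hkj hk => by
          have hki : k ≠ i ∨ τ ≠ [] := by
            by_contra hc
            push Not at hc
            rw [hupd, if_pos hc.1] at hk
            exact hk hc.2
          have hρk : ρ k ≠ [] := by
            by_cases hki : k = i
            · rw [hki]
              exact hi
            · rwa [hupd, if_neg hki] at hk
          have hj : j ≠ i := by
            rintro rfl
            exact hρk (hmin k hkj)
          rw [Function.update_of_ne hj]
          exact hstart k j hkj hρk) hw' hlen'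
    rcases hlab : lab t with _ | b
    · obtain ⟨σ, hσ, rfl⟩ := hstep w (by
        convert hw using 2 with k
        by_cases hk : k = i
        · rw [hk, Function.update_self, hρi, List.filterMap_cons_none hlab]
        · rw [Function.update_of_ne hk])
      exact ⟨t :: σ, .cons hfN hσ, by rw [List.filterMap_cons_none hlab]⟩
    · have hvis : (ρ i).filterMap lab = b :: τ.filterMap lab := by
        rw [hρi, List.filterMap_cons_some hlab]
      cases w with
      | nil =>
        have hnil : (ρ i).filterMap lab = [] := hw i
        rw [hvis] at hnil
        cases hnil
      | cons a w =>
        obtain ⟨rest, h1, h2, h3⟩ := hw₀ a w rfl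
        obtain rfl : i = i₀ := by
          refine hii₀.resolve_right fun hc => ?_
          have := h2 i hc
          rw [hvis] at this
          cases this
        rw [hvis] at h1
        obtain ⟨rfl, rfl⟩ := List.cons.inj h1
        obtain ⟨σ, hσ, rfl⟩ := hstep w (by
          convert h3 using 1
          funext k
          by_cases hk : k = i
          · subst hk
            rw [Function.update_self, Function.update_self]
          · rw [Function.update_of_ne hk, Function.update_of_ne hk])
        exact ⟨t :: σ, .cons hfN hσ, by rw [List.filterMap_cons_some hlab]⟩

theorem langBetween_eq (h : N.IsConflictHidingFamily s e parts ps pe) (hT : N.T.Nonempty)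
    (lab : Tr → Option A) : N.langBetween lab s e = {w | ∃ f : Fin n → List A,
      (∀ i, f i ∈ (N.corePO (parts i) (ps i) (pe i)).langBetween lab (ps i) (pe i)) ∧
      w ∈ shuffle (Relation.TransGen (N.execOrder parts)) f} := by
  classical
  ext w
  constructor
  · rintro ⟨σ, hr, rfl⟩
    obtain ⟨m, hp⟩ := h.exists_projects hT hr
    refine ⟨fun i => (σ.filter (· ∈ parts i)).filterMap lab, fun i => ⟨_, ?_, rfl⟩, ?_⟩
    · have := hp.run i
      rwa [h.eq_single_exit_of_glue hp.glue hp.reachable i] at this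
    · rw [mem_shuffle_iff]
      refine isShuffle_filter h.toIsPartFamily lab hr.mem_T ?_
      intro α t β i j hσ hij ht
      exact h.notMem_of_transGen hT hr hij hσ ht
  · rintro ⟨f, hf, hw⟩
    choose ρ hρ hfρ using hf
    obtain rfl : f = fun i => (ρ i).filterMap lab := funext hfρ
    rw [mem_shuffle_iff] at hw
    exact h.exists_run_of_shuffle hT lab (h.glue_init hT) hρ (fun i j _ _ => rfl) hw

end IsConflictHidingFamily

/-! ### Correctness of the conversion -/

theorem IsBase.langBetween_eq {t : Tr} (h : N.IsBase t) (lab : Tr → Option A) {s e : Pl}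
    (hs : N.IsSource s) (he : N.IsSink e) : N.langBetween lab s e = {(lab t).toList} := by
  obtain ⟨hT, -, s', e', hs', he', hpt, htp⟩ := h
  obtain rfl := hs.unique hs'
  obtain rfl := he.unique he'
  have hse : e ≠ s := by
    rintro rfl
    exact hs.not_tp t ((htp t e).2 ⟨rfl, rfl⟩)
  have hf : N.Fires (single s) t (single e) := by
    refine fires_iff.2 ⟨⟨hT ▸ rfl, fun p hp => ?_⟩, fun p => ?_⟩
    · rw [((hpt p t).1 hp).1, single_self]
    · simp only [hpt, htp, and_true, true_and]
      by_cases h1 : p = s <;> by_cases h2 : p = e <;> simp_all [single]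
  have hlab : [t].filterMap lab = (lab t).toList := by
    cases hl : lab t <;> simp [hl]
  ext w
  constructor
  · rintro ⟨σ, hr, rfl⟩
    refine Set.mem_singleton_iff.2 (Eq.trans ?_ hlab)
    cases σ with
    | nil =>
      have : 1 ≤ single s e := by rw [hr.eq_of_nil, single_self]
      exact absurd (eq_of_one_le_single this) hse
    | cons u σ =>
      cases hr with
      | cons hf' hr =>
        obtain rfl : u = t := by simpa [hT] using hf'.1.1
        obtain rfl := hf'.unique hf
        cases σ with
        | nil => rfl
        | cons v σ =>
          cases hr with
          | cons hf'' _ =>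
            obtain rfl : v = u := by simpa [hT] using hf''.1.1
            exact absurd (eq_of_one_le_single (hf''.1.2 s ((hpt s v).2 ⟨rfl, rfl⟩))).symm hse
  · rintro rfl
    exact ⟨[t], .cons hf (.nil _), hlab.symm⟩

/-- The conversion is correct for every net that is a workflow system between its source and its
sink; this property is inherited by the projections. -/
theorem Converts.isModel_and_langBetween_eq {lab : Tr → Option A} {φ : Term Tr}
    (hφ : Converts lab N φ) {s e : Pl} (hs : N.IsSource s) (he : N.IsSink e)
    (hw : N.IsWorkflow s e) : φ.IsModel ∧ N.langBetween lab s e = φ.lang lab := by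
  induction hφ generalizing s e with
  | base N t h => exact ⟨trivial, h.langBetween_eq lab hs he⟩
  | order N G n parts Ns φ _ _ accepts hparts hproj _ ih =>
    obtain ⟨hG, hch, -⟩ := accepts
    have hn := hparts.two_le hG
    choose ps pe hps hpe hne hnorm using hproj
    have hmem : ∀ i, parts i ∈ G := fun i => hparts.2 ▸ ⟨i, rfl⟩
    have uniq : ∀ {Q : Set Tr → Prop}, {S ∈ G | Q S}.encard ≤ 1 →
        ∀ {i j}, Q (parts i) → Q (parts j) → i = j := fun hQ _ _ hi hj =>
      hparts.1 (Set.encard_le_one_iff.1 hQ _ _ ⟨hmem _, hi⟩ ⟨hmem _, hj⟩)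
    have h : N.IsConflictHidingFamily s e parts ps pe :=
      { toIsWorkflow := hw
        toIsPartFamily := hch.partition.isPartFamily hparts
        source := hs
        sink := he
        pre_unique := fun hi hj => uniq (Q := fun S => _ ∈ N.Pre S)
          (hch.no_xor_split _ hi.1) hi hj
        post_unique := fun hi hj => uniq (Q := fun S => _ ∈ N.Post S)
          (hch.no_xor_join _ hi.1) hi hj
        entry_equiv := fun hx hy => hch.single_entry _ (hmem _) _ hx _ hy
        exit_equiv := fun hx hy => hch.single_exit _ (hmem _) _ hx _ hy
        ps_notMem := hps
        pe_notMem := hpe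
        ps_ne_pe := hne }
    have hT : N.T.Nonempty := by
      obtain ⟨t, ht⟩ := h.nonempty ⟨0, by omega⟩
      exact ⟨t, h.subset _ ht⟩
    have hrec : ∀ i, (φ i).IsModel ∧ (N.corePO (parts i) (ps i) (pe i)).langBetween lab
        (ps i) (pe i) = (φ i).lang lab := by
      intro i
      obtain ⟨s', e', hs', he', hw', hl⟩ := (h.isWorkflow_corePO hT i).normalize (hnorm i)
      rw [← hl]
      exact ih i hs' he' hw'
    refine ⟨⟨hn, h.transGen_irrefl hT, fun _ _ _ => .trans, fun i => (hrec i).1⟩, ?_⟩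
    rw [h.langBetween_eq hT lab]
    simp only [(hrec _).2]
    rfl
  | choice N _ G n parts Ns φ _ _ _ _ accepts hparts hproj _ ih =>
    obtain ⟨hG, hch, -⟩ := accepts
    have hn := hparts.two_le hG
    choose p q hp hq hnorm using hproj
    have h : N.IsSingleEntryExit s e parts p q :=
      { toIsWorkflow := hw
        toIsPartFamily := hch.partition.isPartFamily hparts
        source := hs
        sink := he
        pre_eq := hp
        post_eq := hq }
    have hT : N.T.Nonempty := by
      obtain ⟨t, ht⟩ := h.nonempty ⟨0, by omega⟩
      exact ⟨t, h.subset _ ht⟩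
    have hrec : ∀ i, (φ i).IsModel ∧ (N.coreCG (parts i)).langBetween lab
        (p i) (q i) = (φ i).lang lab := by
      intro i
      obtain ⟨s', e', hs', he', hw', hl⟩ := (h.isWorkflow_coreCG i).normalize (hnorm i)
      rw [← hl]
      exact ih i hs' he' hw'
    refine ⟨⟨hn, h.isChoiceGraph (by omega), fun i => (hrec i).1⟩, ?_⟩
    rw [h.langBetween_eq lab hT]
    simp only [(hrec _).2]
    rfl

end PetriNet
end POWL

theorem mainTheorem1 {Pl Tr A : Type*} (lab : Tr → Option A) (N : POWL.PetriNet Pl Tr)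
    (hwf : N.IsWFNet) (hsafe : N.IsSafe) (hsound : N.IsSound)
    (φ : POWL.Term Tr) (hφ : POWL.PetriNet.Converts lab N φ) :
    φ.IsModel ∧ N.lang lab = φ.lang lab := by
  obtain ⟨s, e, hs, he, hw⟩ := POWL.PetriNet.isWorkflow_of_wfNet hwf hsafe hsound
  rw [POWL.PetriNet.lang_eq_langBetween lab hs he]
  exact hφ.isModel_and_langBetween_eq hs he hw
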